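/- Let $k$ be an algebraically closed field of characteristic $p>0$; a variety is an integral separated scheme of finite type over $k$. For a scheme $S$ let $F_S^e$ denote the $e$-th iterate of its absolute Frobenius, and write $S^e$ for $S$ regarded as the source of $F_S^e$. For a morphism $f:X\to Z$ of varieties let $X_{Z^e}=X\times_Z Z^e$ be the base change of $f$ along $F_Z^e:Z^e\to Z$, and let $F^{(e)}_{X/Z}=(F_X^e,f):X^e\to X_{Z^e}$ be the relative Frobenius morphism. Let $X$ be a normal variety, let $\Delta$ be an effective $\mathbb Q$-Weil divisor on $X$, and let $f:X\to Z$ be a proper (for instance, projective) morphism to a smooth variety $Z$. The pair $(f,\Delta)$ is called *$F$-split* if there is an integer $e>0$ such that the composite $$\mathcal O_{X_{Z^e}}\longrightarrow (F^{(e)}_{X/Z})_*\mathcal O_{X^e}\hookrightarrow (F^{(e)}_{X/Z})_*\mathcal O_{X^e}(\lceil (p^e-1)\Delta\rceil)$$ is injective and splits as a homomorphism of $\mathcal O_{X_{Z^e}}$-modules. The morphism $f$ is called $F$-split if $(f,0)$ is. **Proposition.** Let $X$, $\Delta$, $Z$ and $f$ be as above and let $Y$ be a normal variety. Assume that $f=h\circ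 g$ with $g:X\to Y$ and $h:Y\to Z$ proper (for instance, projective) morphisms over $k$ such that the natural map $\mathcal O_Y\to g_*\mathcal O_X$ is an isomorphism. 1. If $(f,\Delta)$ is $F$-split, then $h$ is $F$-split. 2. Assume that $Y$ is smooth. If $(g,\Delta)$ and $h$ are $F$-split, then $(f,\Delta)$ is $F$-split. 3. Assume that $Y$ is smooth and that $K_Y\sim_{\mathbb Z_{(p)}}h^*K_Z$, that is, $m(K_Y-h^*K_Z)\sim 0$ for some integer $m>0$ not divisible by $p$. If $(f,\Delta)$ is $F$-split, then $(g,\Delta)$ and $h$ are $F$-split. -/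

import Mathlib

universe u

open AlgebraicGeometry CategoryTheory CategoryTheory.Limits TopologicalSpace

noncomputable section

/-! ### Iterated absolute Frobenius of a scheme in which `p = 0` -/

/-- The ring endomorphism `a ↦ a ^ (p ^ e)` of a commutative ring in which `p = 0`. -/
def iterFrobRingHom (p e : ℕ) [hp : Fact p.Prime] (R : Type u) [CommRing R]
    (h : (p : R) = 0) : R →+* R where
  toFun a := a ^ p ^ e
  map_one' := one_pow _
  map_mul' a b := mul_pow a b _
  map_zero' := zero_pow (pow_ne_zero _ hp.out.ne_zero)
  map_add' a b := by
    cases subsingleton_or_nontrivial R with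
    | inl _ => exact Subsingleton.elim _ _
    | inr _ =>
      have : CharP R p := (CharP.charP_iff_prime_eq_zero hp.out).mpr h
      exact add_pow_char_pow a b p e

namespace AlgebraicGeometry.Scheme

/-- `p = 0` on the scheme `X`, i.e. `X` is an `𝔽_p`-scheme. -/
class IsCharP (X : Scheme.{u}) (p : ℕ) : Prop where
  natCast_eq_zero : (p : Γ(X, ⊤)) = 0

lemma IsCharP.natCast_section (X : Scheme.{u}) (p : ℕ) [X.IsCharP p] (U : X.Opens) :
    (p : Γ(X, U)) = 0 := by
  have := congrArg (X.presheaf.map (homOfLE (le_top : U ≤ ⊤)).op)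
    (IsCharP.natCast_eq_zero (X := X) (p := p))
  simpa using this

/-- The morphism of presheafed spaces underlying `absFrob`. -/
def absFrobPre (X : Scheme.{u}) (p e : ℕ) [Fact p.Prime] [X.IsCharP p] :
    X.toPresheafedSpace.Hom X.toPresheafedSpace where
  base := 𝟙 _
  c :=
    { app := fun U => CommRingCat.ofHom
        (iterFrobRingHom p e Γ(X, U.unop) (IsCharP.natCast_section X p U.unop))
      naturality := by
        intro U V i
        ext a
        exact (map_pow (X.presheaf.map i).hom a (p ^ e)).symm }

/-- The `e`-th iterate of the absolute Frobenius of an `𝔽_p`-scheme: the identity on the underlying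
space and `a ↦ a ^ (p ^ e)` on sections. -/
def absFrob (X : Scheme.{u}) (p e : ℕ) [hp : Fact p.Prime] [X.IsCharP p] : X ⟶ X where
  toHom := absFrobPre X p e
  prop := by
    intro x
    constructor
    intro a ha
    obtain ⟨U, hxU, s, rfl⟩ := X.presheaf.exists_germ_eq a
    have key : (PresheafedSpace.Hom.stalkMap (absFrobPre X p e) x).hom
        (X.presheaf.germ U x hxU s) = X.presheaf.germ U x hxU (s ^ p ^ e) :=
      congrArg (fun φ => φ.hom s) (PresheafedSpace.stalkMap_germ
        (X := X.toPresheafedSpace) (Y := X.toPresheafedSpace) (absFrobPre X p e) U x hxU)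
    erw [key] at ha
    rw [map_pow] at ha
    exact (isUnit_pow_iff (pow_ne_zero _ hp.out.ne_zero)).mp ha

lemma absFrob_comm {X Y : Scheme.{u}} (f : X ⟶ Y) (p e : ℕ) [Fact p.Prime]
    [X.IsCharP p] [Y.IsCharP p] : X.absFrob p e ≫ f = f ≫ Y.absFrob p e := by
  refine Scheme.Hom.ext rfl ?_
  intro U
  ext a
  have h1 : (f ≫ Y.absFrob p e).app U a = f.app U (a ^ p ^ e) := rfl
  have h2 : (X.absFrob p e ≫ f).app U a = (f.app U a) ^ p ^ e := rfl
  erw [CategoryTheory.Functor.map_id, Category.comp_id, h1, h2, map_pow]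

end AlgebraicGeometry.Scheme

open AlgebraicGeometry.Scheme

/-! ### Varieties -/

/-- A variety over `k`: an integral separated scheme of finite type over `Spec k`. -/
structure Variety (k : Type u) [Field k] where
  toScheme : Scheme.{u}
  str : toScheme ⟶ Spec (.of k)
  isIntegral : IsIntegral toScheme
  isSeparated : IsSeparated str
  locallyOfFiniteType : LocallyOfFiniteType str
  quasiCompact : QuasiCompact str

namespace Variety

variable {k : Type u} [Field k]

instance (X : Variety k) : IsIntegral X.toScheme := X.isIntegral
instance (X : Variety k) : IsSeparated X.str := X.isSeparated
instance (X : Variety k) : LocallyOfFiniteType X.str := X.locallyOfFiniteType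
instance (X : Variety k) : QuasiCompact X.str := X.quasiCompact

instance (X : Variety k) : IsLocallyNoetherian X.toScheme :=
  LocallyOfFiniteType.isLocallyNoetherian X.str

/-- The ring homomorphism from `k` to the global functions on a variety over `k`. -/
def scalars (X : Variety k) : k →+* Γ(X.toScheme, ⊤) :=
  X.str.appTop.hom.comp (Scheme.ΓSpecIso (.of k)).inv.hom

instance (X : Variety k) (p : ℕ) [CharP k p] : X.toScheme.IsCharP p where
  natCast_eq_zero := by
    rw [← map_natCast X.scalars p, CharP.cast_eq_zero, map_zero]

/-- The local rings of a variety over `k`, and in particular its function field, are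
`k`-algebras. -/
instance (X : Variety k) (x : X.toScheme) : Algebra k (X.toScheme.presheaf.stalk x) :=
  ((X.toScheme.presheaf.germ ⊤ x trivial).hom.comp X.scalars).toAlgebra

/-- The function field of a variety. -/
abbrev K (X : Variety k) : Type u := X.toScheme.functionField

/-- A variety is normal if all its local rings are integrally closed. -/
class IsNormal (X : Variety k) : Prop where
  isIntegrallyClosed : ∀ x : X.toScheme, IsIntegrallyClosed (X.toScheme.presheaf.stalk x)

/-! ### Weil divisors -/

/-- Prime divisors of a variety, given by their generic points: the points of codimension one. -/
def PrimeDivisor (X : Variety k) : Type u := {x : X.toScheme // Order.coheight x = 1}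

/-- Weil divisors. -/
abbrev WeilDivisor (X : Variety k) : Type u := X.PrimeDivisor →₀ ℤ

/-- Weil divisors with rational coefficients. -/
abbrev QWeilDivisor (X : Variety k) : Type u := X.PrimeDivisor →₀ ℚ

/-- The round-up `⌈D⌉` of a `ℚ`-Weil divisor, coefficient by coefficient. -/
def QWeilDivisor.roundUp {X : Variety k} (D : X.QWeilDivisor) : X.WeilDivisor :=
  D.mapRange Int.ceil (by simp)

/-- Linear equivalence with `ℤ_(p)`-coefficients: `D - E` is the divisor of a nonzero rational
function after multiplication by an integer that is prime to `p`. -/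
def ZpLinEquiv (p : ℕ) {X : Variety k} (D E : X.WeilDivisor) : Prop :=
  ∃ m : ℕ, ¬ p ∣ m ∧ ∃ φ : X.K, φ ≠ 0 ∧ ∀ x : X.PrimeDivisor,
    (m : ℤ) * (D x - E x) = X.toScheme.ord φ x.1

lemma isDiscreteValuationRing_stalk (X : Variety k) [X.IsNormal] (x : X.toScheme)
    (hx : Order.coheight x = 1) : IsDiscreteValuationRing (X.toScheme.presheaf.stalk x) := by
  have := IsNormal.isIntegrallyClosed x
  have hdim := ringKrullDim_stalk_eq_coheight x
  rw [hx] at hdim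
  have hnf : ¬ IsField (X.toScheme.presheaf.stalk x) := by
    intro hf
    rw [ringKrullDim_eq_zero_of_isField hf] at hdim
    exact absurd hdim (by simp)
  have : Ring.KrullDimLE 1 (X.toScheme.presheaf.stalk x) := krullDimLE_of_coheight_le hx.le
  have : Ring.DimensionLEOne (X.toScheme.presheaf.stalk x) :=
    ⟨fun {I} hI hI' => Ring.krullDimLE_one_iff_of_isPrime_bot.mp this I hI hI'⟩
  have : IsDedekindDomain (X.toScheme.presheaf.stalk x) := {}
  exact ((IsDiscreteValuationRing.TFAE _ hnf).out 0 2).mpr this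

/-- The sections of `𝒪_X(D)` over a nonempty open set `U` of a normal variety `X`: the rational
functions `φ` with `φ = 0` or `div φ + D ≥ 0` on `U`, as a `Γ(X, U)`-module. -/
def sectionsO (X : Variety k) [X.IsNormal] (D : X.WeilDivisor) (U : X.toScheme.Opens)
    [Nonempty U] : Submodule Γ(X.toScheme, U) X.K where
  carrier := {φ | φ ≠ 0 → ∀ x : X.PrimeDivisor, x.1 ∈ U → 0 ≤ X.toScheme.ord φ x.1 + D x}
  zero_mem' := fun h => absurd rfl h
  add_mem' := by
    intro φ ψ hφ hψ h x hx
    have := X.isDiscreteValuationRing_stalk x.1 x.2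
    by_cases h1 : φ = 0
    · subst h1
      simpa using hψ (by simpa using h) x hx
    by_cases h2 : ψ = 0
    · subst h2
      simpa using hφ (by simpa using h) x hx
    have h3 := Scheme.ord_add (x := x.1) h
    have h4 := hφ h1 x hx
    have h5 := hψ h2 x hx
    rcases min_le_iff.mp h3 with h6 | h6 <;> linarith
  smul_mem' := by
    intro a φ hφ h x hx
    have ha : a ≠ 0 := by rintro rfl; simp at h
    have h1 : φ ≠ 0 := by rintro rfl; simp at h
    have := Scheme.ord_le_smul hx ha φ
    have h4 := hφ h1 x hx
    linarith

lemma sectionsO_mono (X : Variety k) [X.IsNormal] (D : X.WeilDivisor) {U V : X.toScheme.Opens}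
    [Nonempty U] [Nonempty V] (h : U ≤ V) {φ : X.K} (hφ : φ ∈ X.sectionsO D V) :
    φ ∈ X.sectionsO D U :=
  fun h0 x hx => hφ h0 x (h hx)

lemma one_mem_sectionsO (X : Variety k) [X.IsNormal] {D : X.WeilDivisor} (hD : 0 ≤ D)
    (U : X.toScheme.Opens) [Nonempty U] : (1 : X.K) ∈ X.sectionsO D U := by
  intro _ x hx
  have h1 : X.toScheme.ord (1 : X.K) x.1 = 0 := by
    have := Scheme.ord_of_isUnit (X := X.toScheme) (f := (1 : Γ(X.toScheme, U))) isUnit_one hx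
    rwa [map_one] at this
  rw [h1, zero_add]
  exact hD x

lemma roundUp_nonneg {X : Variety k} {D : X.QWeilDivisor} (hD : 0 ≤ D) : 0 ≤ D.roundUp :=
  fun x => Int.ceil_nonneg (hD x)

/-! ### Relative Frobenius and `F`-split morphisms -/

section Frobenius

variable {X Z : Variety k} (p e : ℕ) [Fact p.Prime]

lemma scaled_nonneg {Δ : X.QWeilDivisor} (hΔ : 0 ≤ Δ) : 0 ≤ ((p : ℚ) ^ e - 1) • Δ := by
  have h1 : (1 : ℚ) ≤ p := by exact_mod_cast (Fact.out : p.Prime).one_le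
  intro x
  exact mul_nonneg (sub_nonneg.mpr (one_le_pow₀ h1)) (hΔ x)

variable [CharP k p]

/-- The base change `X ×_Z Z^e` of `f : X ⟶ Z` along the `e`-th iterated absolute Frobenius
of `Z`. -/
abbrev frobBaseChange (f : X.toScheme ⟶ Z.toScheme) : Scheme.{u} :=
  pullback f (Z.toScheme.absFrob p e)

/-- The `e`-th relative Frobenius morphism `X^e ⟶ X ×_Z Z^e` of `f : X ⟶ Z`; its components are
the `e`-th absolute Frobenius of `X` and `f`. -/
def relFrob (f : X.toScheme ⟶ Z.toScheme) : X.toScheme ⟶ frobBaseChange p e f :=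
  pullback.lift (X.toScheme.absFrob p e) f (Scheme.absFrob_comm f p e)

/-- For an effective divisor `D` on `X`, a splitting of the homomorphism of `𝒪_P`-modules
`𝒪_P ⟶ F_* 𝒪_X ⟶ F_* (𝒪_X(D))`, where `P = X ×_Z Z^e` and `F : X^e ⟶ P` is the relative
Frobenius morphism: a homomorphism of `𝒪_P`-modules `F_* (𝒪_X(D)) ⟶ 𝒪_P` that sends `1` to `1`.
It is given by its values on the open sets with nonempty preimage; as `F` is a homeomorphism, these
are all the nonempty open sets. -/
structure RelFrobSplitting [X.IsNormal] (f : X.toScheme ⟶ Z.toScheme) (D : X.WeilDivisor)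
    (hD : 0 ≤ D) where
  toFun : ∀ (W : (frobBaseChange p e f).Opens) [Nonempty (relFrob p e f ⁻¹ᵁ W)],
    X.sectionsO D (relFrob p e f ⁻¹ᵁ W) →+ Γ(frobBaseChange p e f, W)
  map_smul : ∀ (W : (frobBaseChange p e f).Opens) [Nonempty (relFrob p e f ⁻¹ᵁ W)]
    (r : Γ(frobBaseChange p e f, W)) (φ : X.sectionsO D (relFrob p e f ⁻¹ᵁ W)),
    toFun W ((relFrob p e f).app W r • φ) = r * toFun W φ
  map_res : ∀ (W W' : (frobBaseChange p e f).Opens) [Nonempty (relFrob p e f ⁻¹ᵁ W)]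
    [Nonempty (relFrob p e f ⁻¹ᵁ W')] (h : W' ≤ W)
    (φ : X.sectionsO D (relFrob p e f ⁻¹ᵁ W)),
    toFun W' ⟨φ.1, X.sectionsO_mono D ((relFrob p e f).preimage_mono h) φ.2⟩ =
      (frobBaseChange p e f).presheaf.map (homOfLE h).op (toFun W φ)
  map_one : ∀ (W : (frobBaseChange p e f).Opens) [Nonempty (relFrob p e f ⁻¹ᵁ W)],
    toFun W ⟨1, X.one_mem_sectionsO hD _⟩ = 1

/-- The pair `(f, Δ)` is (sharply) `F`-split: for some `e > 0` the homomorphism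
`𝒪_P ⟶ F_* (𝒪_X(⌈(p ^ e - 1) Δ⌉))` splits, where `P = X ×_Z Z^e` and `F : X^e ⟶ P` is the
`e`-th relative Frobenius morphism. -/
def IsFSplit [X.IsNormal] (f : X.toScheme ⟶ Z.toScheme) (Δ : X.QWeilDivisor) (hΔ : 0 ≤ Δ) :
    Prop :=
  ∃ e : ℕ, 0 < e ∧ Nonempty (RelFrobSplitting p e f (((p : ℚ) ^ e - 1) • Δ).roundUp
    (roundUp_nonneg (scaled_nonneg p e hΔ)))

end Frobenius

/-! ### Canonical divisors -/

/-- The rank of the module of Kähler differentials of the function field over `k`, which is the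
dimension of the variety when `k` is perfect. -/
def dim (X : Variety k) : ℕ := Module.finrank X.K (Ω[X.K⁄k])

/-- Local coordinates at the point `x`: elements of the local ring `A` at `x` whose differentials
form a basis of the `A`-module `Ω_{A/k}`. -/
def IsCoordinates (X : Variety k) (x : X.toScheme) (a : Fin X.dim → X.toScheme.presheaf.stalk x) :
    Prop :=
  ∃ b : Module.Basis (Fin X.dim) (X.toScheme.presheaf.stalk x)
      (Ω[X.toScheme.presheaf.stalk x⁄k]),
    ∀ i, b i = KaehlerDifferential.D k (X.toScheme.presheaf.stalk x) (a i)

/-- Rational top differential forms. -/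
abbrev RatForm (X : Variety k) : Type u := ⋀[X.K]^X.dim (Ω[X.K⁄k])

/-- The rational top form `da₁ ∧ ⋯ ∧ daₙ` given by elements `aᵢ` of the local ring at `x`. When
the `aᵢ` are local coordinates, it generates the stalk at `x` of the canonical sheaf. -/
def coordForm (X : Variety k) (x : X.toScheme) (a : Fin X.dim → X.toScheme.presheaf.stalk x) :
    X.RatForm :=
  exteriorPower.ιMulti X.K X.dim fun i =>
    KaehlerDifferential.D k X.K (algebraMap (X.toScheme.presheaf.stalk x) X.K (a i))

/-- `D` is a canonical divisor of `X`, that is `D = div ω` for a nonzero rational top form `ω`: at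
each prime divisor `x`, with local coordinates `a` there, `ω = φ • (da₁ ∧ ⋯ ∧ daₙ)` and `D` has the
coefficient `ord_x φ`. -/
def IsCanonicalDivisor (X : Variety k) (D : X.WeilDivisor) : Prop :=
  ∃ ω : X.RatForm, ω ≠ 0 ∧ ∀ x : X.PrimeDivisor,
    ∃ (a : Fin X.dim → X.toScheme.presheaf.stalk x.1) (φ : X.K),
      X.IsCoordinates x.1 a ∧ ω = φ • X.coordForm x.1 a ∧ D x = X.toScheme.ord φ x.1

/-- `D` is the pullback `h^* K_Z` of a canonical divisor `K_Z = div ω` of `Z` whose support does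
not contain the image of `h : Y ⟶ Z`. Let `z` be the image of the generic point of `Y`, so that `h`
induces a homomorphism from the local ring at `z` to the function field of `Y`. At a prime divisor
`y` of `Y`, with local coordinates `b` of `Z` at `h y`, one has `ω = c • (db₁ ∧ ⋯ ∧ dbₘ)`
where `c` is a unit of the local ring at `z` (this says that `z` is not in the support of `div ω`),
and `D` has the coefficient `ord_y (h^* c)`. -/
def IsPullbackCanonicalDivisor {Y Z : Variety k} (h : Y.toScheme ⟶ Z.toScheme)
    (D : Y.WeilDivisor) : Prop :=
  ∃ ω : Z.RatForm, ∀ y : Y.PrimeDivisor,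
    ∃ (b : Fin Z.dim → Z.toScheme.presheaf.stalk (h y.1))
      (c : Z.toScheme.presheaf.stalk (h (genericPoint Y.toScheme))),
      Z.IsCoordinates (h y.1) b ∧ IsUnit c ∧
      ω = (algebraMap (Z.toScheme.presheaf.stalk (h (genericPoint Y.toScheme))) Z.K c) •
        Z.coordForm (h y.1) b ∧
      D y = Y.toScheme.ord (h.stalkMap (genericPoint Y.toScheme) c) y.1

/-- `K_Y ∼ h^* K_Z` with `ℤ_(p)`-coefficients. -/
def CanonicalZpEquivPullback (p : ℕ) {Y Z : Variety k} (h : Y.toScheme ⟶ Z.toScheme) : Prop :=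
  ∃ D E : Y.WeilDivisor, Y.IsCanonicalDivisor D ∧ IsPullbackCanonicalDivisor h E ∧
    ZpLinEquiv p D E

end Variety

end

open AlgebraicGeometry.Scheme

set_option linter.unusedSectionVars false

/-! ### Traces of the Frobenius endomorphism -/

/-! Write `q = p ^ e`. On a smooth variety the additive maps `T` of the function field with `T (r ^
q * x) = r * T x` are locally generated by a single one, the iterated Cartier operator in local
coordinates (`IsPBasis.trace`), and a change of coordinates with Jacobian `J` replaces this
generator by its scaling by `J ^ (1 - q)` (`IsPBasis.trace_change`, `pow_eq_scaleEnd`). A generator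
comes with a pair of dual frames, and these replace duality for the finite projection `X ×_Z Z^e ⟶
X`.

Functions on `X ×_Z Z^e` restrict along the relative Frobenius to sums of products of `q`-th powers
of functions on `X` with functions on `Z`. Composing a splitting with the pairing given by `T`
yields a root-linear map `τ` of the function field of `X` that is compatible with `T` along `f` and,
at each prime divisor `x`, carries `v * 𝒪_X(D)` into the local ring, where `D = ⌈(q - 1)Δ⌉` and `T
(v * ·)` generates at `f x`. Conversely such a `τ` gives back a splitting by a sum over a dual
frame. Thus `F`-splitting becomes a statement on function fields: `IsChart.isFSplit_iff`, from
`exists_isSplitTrace_of_splitting` and `nonempty_relFrobSplitting`.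

For the first assertion, `g_* 𝒪_X = 𝒪_Y` shows that `τ` restricts to a map `σ` of the function field
of `Y`, and `σ` splits `h` (`IsSplitTrace.exists_descent`).

For the second, the map belonging to `h` has the form `S (t * ·)`, with `S` the generator on `Y`. If
`τ` belongs to `g`, then `τ (t * ·)` belongs to `f` (`IsSplitTrace.comp`). The two exponents are
first made equal by iterating both maps (`IsSplitTrace.mul`).

For the third, restrict the map of `f` to `σ = S (t * ·)`. Then `τ (t⁻¹ * ·)` splits `g` provided
that the effective divisor given by `t`, which lies in the class of `(1 - q)(K_Y - h^* K_Z)`, is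
zero. After iteration `q - 1` is a multiple of `m`, so this divisor is `div u` for a rational
function `u`. As `u` has no poles and `h` is proper, `u` is integral over the function field of `Z`.
The splitting forces such an element to be separable, in the sense that `u⁻¹` is a combination of
`q`-th powers over the function field of `Z` (`exists_inv_eq_sum_pow`). Hence the projector
belonging to `σ` fixes `u⁻¹`; but it also sends `u⁻¹` to a regular element
(`IsSplitTrace.inv_mem_locRing`). So `u` is a unit and the divisor vanishes
(`IsSplitTrace.inv_mul_mem_locRing`). -/

section Trace

variable {N : Type*} [Field N]

/-- Additive maps that are linear up to `q`-th roots. -/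
def RootLinear (q : ℕ) (T : AddMonoid.End N) : Prop := ∀ r x, T (r ^ q * x) = r * T x

/-- The map `x ↦ T (v * x)`. -/
def scaleEnd (T : AddMonoid.End N) (v : N) : AddMonoid.End N := T.comp (AddMonoidHom.mulLeft v)

@[simp] lemma scaleEnd_apply (T : AddMonoid.End N) (v x : N) : scaleEnd T v x = T (v * x) := rfl

/-- The families `b` and `b'` are dual generating systems over the `q`-th powers, for the pairing
`(x, y) ↦ T (x * y)`. -/
structure IsDualFrame (q : ℕ) (T : AddMonoid.End N) {ι : Type} [Fintype ι] (b b' : ι → N) :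
    Prop where
  left : ∀ y, ∑ i, T (y * b' i) ^ q * b i = y
  right : ∀ y, ∑ i, T (y * b i) ^ q * b' i = y

/-- `T` is a generator of the module of root-linear maps, over the field `N` and over its
subring `R`. -/
structure IsTraceOn (q : ℕ) (T : AddMonoid.End N) (R : Subring N) : Prop where
  rootLinear : RootLinear q T
  map_mem : ∀ r ∈ R, T r ∈ R
  exists_frame : ∃ (ι : Type) (_ : Fintype ι) (b b' : ι → N), (∀ i, b i ∈ R) ∧ (∀ i, b' i ∈ R) ∧
    IsDualFrame q T b b'

lemma endMul_apply (S T : AddMonoid.End N) (x : N) : (S * T) x = S (T x) := rfl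

lemma RootLinear.scaleEnd {q : ℕ} {T : AddMonoid.End N} (h : RootLinear q T) (v : N) :
    RootLinear q (scaleEnd T v) := fun r x => by
  rw [scaleEnd_apply, mul_left_comm, h, scaleEnd_apply]

lemma RootLinear.map_div {q : ℕ} (hq : q ≠ 0) {T : AddMonoid.End N} (h : RootLinear q T)
    {a s : N} (hs : s ≠ 0) : T (a / s) = T (a * s ^ (q - 1)) / s := by
  have : a / s = (s⁻¹) ^ q * (a * s ^ (q - 1)) := by
    obtain ⟨r, rfl⟩ := Nat.exists_eq_succ_of_ne_zero hq
    simp only [Nat.succ_eq_add_one, Nat.add_sub_cancel, inv_pow]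
    field_simp
    ring
  rw [this, h, div_eq_inv_mul]

namespace IsTraceOn

variable {q : ℕ} {T : AddMonoid.End N} {R : Subring N}

lemma eq_of_forall (hT : IsTraceOn q T R) {t t' : N} (h : ∀ y, T (t * y) = T (t' * y)) :
    t = t' := by
  obtain ⟨ι, _, b, b', hb, hb', hd⟩ := hT.exists_frame
  rw [← hd.left t, ← hd.left t']
  simp_rw [h]

/-- Root-linear maps are multiples of a trace. -/
lemma exists_scale (hT : IsTraceOn q T R) {S : AddMonoid.End N} (hS : RootLinear q S) :
    ∃ t, ∀ y, S y = T (t * y) := by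
  obtain ⟨ι, _, b, b', hb, hb', hd⟩ := hT.exists_frame
  -- Expanding `y` in the frame `b` gives `S y = ∑ T (y * b' i) * S (b i)`; root-linearity of `T`
  -- moves each `S (b i)` inside as a `q`-th power, and this is the resulting factor.
  refine ⟨∑ i, S (b i) ^ q * b' i, fun y => ?_⟩
  have h1 : ∀ i, S (b i) ^ q * b' i * y = S (b i) ^ q * (y * b' i) := fun i => by ring
  simp_rw [Finset.sum_mul, map_sum, h1, hT.rootLinear _ _]
  nth_rw 1 [← hd.left y]
  simp_rw [map_sum, hS _ _]
  exact Finset.sum_congr rfl fun i _ => mul_comm _ _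

lemma ne_zero (hT : IsTraceOn q T R) : T ≠ 0 := by
  rintro rfl
  refine one_ne_zero (hT.eq_of_forall (t := (1 : N)) (t' := 0) fun y => ?_)
  simp

lemma scale_ne_zero {v : N} (hT : IsTraceOn q (scaleEnd T v) R) : v ≠ 0 := by
  rintro rfl
  refine hT.ne_zero ?_
  ext x
  simp

/-- Membership in the fractional ideal dual to `R`. -/
lemma exists_eq_mul {v : N} (hT : IsTraceOn q (scaleEnd T v) R) {z : N}
    (hz : ∀ r ∈ R, T (z * r) ∈ R) : ∃ u ∈ R, z = v * u := by
  obtain ⟨ι, _, b, b', hb, hb', hd⟩ := hT.exists_frame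
  have hv := hT.scale_ne_zero
  refine ⟨v⁻¹ * z, ?_, by field_simp⟩
  rw [← hd.right (v⁻¹ * z)]
  refine sum_mem fun i _ => mul_mem (pow_mem ?_ _) (hb' i)
  have : v * (v⁻¹ * z * b i) = z * b i := by field_simp
  rw [scaleEnd_apply, this]
  exact hz _ (hb i)

/-- Two trace scalings differ by a unit. -/
lemma exists_unit {v w : N} (hv : IsTraceOn q (scaleEnd T v) R)
    (hw : IsTraceOn q (scaleEnd T w) R) : ∃ u ∈ R, u⁻¹ ∈ R ∧ w = v * u := by
  obtain ⟨u, hu, rfl⟩ := hv.exists_eq_mul hw.map_mem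
  obtain ⟨u', hu', h⟩ := hw.exists_eq_mul hv.map_mem
  have h0 := hv.scale_ne_zero
  have h1 : u * u' = 1 := mul_left_cancel₀ h0 (by rw [← mul_assoc, ← h, mul_one])
  exact ⟨u, hu, by rwa [inv_eq_of_mul_eq_one_right h1], rfl⟩

lemma scale_unit (hT : IsTraceOn q T R) {u : N} (hu : u ∈ R) (hu' : u⁻¹ ∈ R) (h0 : u ≠ 0) :
    IsTraceOn q (scaleEnd T u) R := by
  obtain ⟨ι, _, b, b', hb, hb', hd⟩ := hT.exists_frame
  refine ⟨hT.rootLinear.scaleEnd u, fun r hr => hT.map_mem _ (mul_mem hu hr), ι, ‹_›, b,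
    fun i => u⁻¹ * b' i, hb, fun i => mul_mem hu' (hb' i), fun y => ?_, fun y => ?_⟩
  · have : ∀ i, u * (y * (u⁻¹ * b' i)) = y * b' i := fun i => by field_simp
    simp_rw [scaleEnd_apply, this]
    exact hd.left y
  · have h1 := hd.right (u * y)
    have : ∀ i, T (u * (y * b i)) ^ q * (u⁻¹ * b' i) = u⁻¹ * (T (u * y * b i) ^ q * b' i) :=
      fun i => by rw [← mul_assoc u]; ring
    simp_rw [scaleEnd_apply, this, ← Finset.mul_sum, h1]
    field_simp

/-- The same frame serves after localization: since `a / s = (a * s ^ (q - 1)) / s ^ q`,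
root-linearity takes the denominator out of `T`. -/
lemma of_fraction (hq : q ≠ 0) {A : Subring N} (hT : IsTraceOn q T A) (hAR : A ≤ R)
    (h : ∀ r ∈ R, ∃ a ∈ A, ∃ s ∈ A, s ≠ 0 ∧ s⁻¹ ∈ R ∧ r = a / s) : IsTraceOn q T R := by
  obtain ⟨ι, _, b, b', hb, hb', hd⟩ := hT.exists_frame
  refine ⟨hT.rootLinear, fun r hr => ?_, ι, ‹_›, b, b', fun i => hAR (hb i),
    fun i => hAR (hb' i), hd⟩
  obtain ⟨a, ha, s, hs, hs0, hsR, rfl⟩ := h r hr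
  rw [hT.rootLinear.map_div hq hs0, div_eq_mul_inv]
  exact mul_mem (hAR (hT.map_mem _ (mul_mem ha (pow_mem hs _)))) hsR

/-- Frames multiply: expand in `b` with coefficients that are `p`-th powers, then expand the `p`-th
roots of these coefficients in a frame `c` of `T ^ e`. The products `b i * c j ^ p` form the new
frame. -/
lemma pow {p : ℕ} [ExpChar N p] (hT : IsTraceOn p T R) (e : ℕ) :
    IsTraceOn (p ^ e) (T ^ e) R := by
  induction e with
  | zero =>
    refine ⟨fun r x => by simp, fun r hr => by simpa, Unit, inferInstance, fun _ => 1, fun _ => 1,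
      fun _ => one_mem _, fun _ => one_mem _, fun y => by simp, fun y => by simp⟩
  | succ e ih =>
    obtain ⟨ι, _, b, b', hb, hb', hd⟩ := hT.exists_frame
    obtain ⟨κ, _, c, c', hc, hc', hd2⟩ := ih.exists_frame
    have key : ∀ r x, (T ^ (e + 1)) (r ^ p * x) = (T ^ e) (r * T x) := fun r x => by
      rw [pow_succ, endMul_apply, hT.rootLinear]
    refine ⟨fun r x => ?_, fun r hr => ?_, ι × κ, inferInstance, fun x => b x.1 * c x.2 ^ p,
      fun x => b' x.1 * c' x.2 ^ p, fun x => mul_mem (hb _) (pow_mem (hc _) _),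
      fun x => mul_mem (hb' _) (pow_mem (hc' _) _), fun y => ?_, fun y => ?_⟩
    · rw [pow_succ p, pow_mul, key, ih.rootLinear, pow_succ T, endMul_apply]
    · rw [pow_succ, endMul_apply]
      exact ih.map_mem _ (hT.map_mem _ hr)
    · conv_rhs => rw [← hd.left y]
      rw [Fintype.sum_prod_type]
      refine Finset.sum_congr rfl fun i _ => ?_
      conv_rhs => rw [← hd2.left (T (y * b' i))]
      rw [sum_pow_char, Finset.sum_mul]
      refine Finset.sum_congr rfl fun j _ => ?_
      rw [show y * (b' i * c' j ^ p) = c' j ^ p * (y * b' i) by ring, key, mul_pow,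
        ← pow_mul, ← pow_succ, mul_comm (c' j)]
      ring
    · conv_rhs => rw [← hd.right y]
      rw [Fintype.sum_prod_type]
      refine Finset.sum_congr rfl fun i _ => ?_
      conv_rhs => rw [← hd2.right (T (y * b i))]
      rw [sum_pow_char, Finset.sum_mul]
      refine Finset.sum_congr rfl fun j _ => ?_
      rw [show y * (b i * c j ^ p) = c j ^ p * (y * b i) by ring, key, mul_pow,
        ← pow_mul, ← pow_succ, mul_comm (c j)]
      ring

end IsTraceOn

/-- Each factor `v` that is moved inside one more application of `T` is raised to the `p`-th power,
whence the geometric sum in the exponent. -/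
lemma scaleEnd_pow {p : ℕ} {T : AddMonoid.End N} (hT : RootLinear p T) (v : N) (e : ℕ) :
    (scaleEnd T v) ^ e = scaleEnd (T ^ e) (v ^ ∑ i ∈ Finset.range e, p ^ i) := by
  induction e with
  | zero => ext; simp
  | succ e ih =>
    ext x
    rw [pow_succ, endMul_apply, ih, scaleEnd_apply, scaleEnd_apply, scaleEnd_apply,
      pow_succ T, endMul_apply, ← hT, geom_sum_succ]
    ring_nf

lemma pow_rootLinear {p : ℕ} {T : AddMonoid.End N} (hT : RootLinear p T) (e : ℕ) :
    RootLinear (p ^ e) (T ^ e) := by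
  induction e with
  | zero => intro r x; simp
  | succ e ih =>
    intro r x
    rw [pow_succ T, pow_succ p, endMul_apply, pow_mul, hT, ih, endMul_apply]

/-- In the iterates of `J⁻¹ * T (J * ·)` the inner factors cancel. The remaining outer `J⁻¹` enters
`T ^ e` as a `p ^ e`-th power, which is the source of the exponent `1 - p ^ e` of the canonical
sheaf. -/
lemma pow_eq_scaleEnd {p : ℕ} {T S : AddMonoid.End N} (hT : RootLinear p T) {J : N}
    (hJ : J ≠ 0) (h : ∀ x, S x = J⁻¹ * T (J * x)) (e : ℕ) :
    S ^ e = scaleEnd (T ^ e) (J / J ^ p ^ e) := by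
  have : ∀ x, (S ^ e) x = J⁻¹ * (T ^ e) (J * x) := by
    induction e with
    | zero => intro x; simp; field_simp
    | succ e ih =>
      intro x
      rw [pow_succ, endMul_apply, ih, h, mul_inv_cancel_left₀ hJ, pow_succ,
        endMul_apply]
  ext x
  rw [this, scaleEnd_apply, ← pow_rootLinear hT]
  congr 1
  rw [inv_pow]
  field_simp

end Trace

/-! ### `p`-bases -/

section PBasis

open scoped TensorProduct in
/-- An unramified radicial finite algebra is a quotient. -/
lemma surjective_algebraMap_of_radicial (p : ℕ) [Fact p.Prime] {S R : Type*} [CommRing S]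
    [CommRing R] [CharP R p] [Algebra S R] [Module.Finite S R] [Algebra.FormallyUnramified S R]
    (h : ∀ x : R, ∃ s : S, algebraMap S R s = x ^ p) : Function.Surjective (algebraMap S R) := by
  rw [← Algebra.isEpi_iff_surjective_algebraMap_of_finite, Algebra.isEpi_iff_forall_one_tmul_eq]
  -- The kernel of multiplication is generated by the elements `1 ⊗ x - x ⊗ 1`, whose `p`-th powers
  -- vanish because `x ^ p` comes from `S`.
  have hI : IsNilpotent (KaehlerDifferential.ideal S R) := by
    rw [Ideal.FG.isNilpotent_iff_le_nilradical (KaehlerDifferential.ideal_fg S R),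
      ← KaehlerDifferential.span_range_eq_ideal, Ideal.span_le]
    rintro _ ⟨x, rfl⟩
    refine ⟨p, ?_⟩
    have : CharP (R ⊗[S] R) p ∨ Subsingleton (R ⊗[S] R) := by
      rcases subsingleton_or_nontrivial (R ⊗[S] R) with h | h
      · exact Or.inr h
      · refine Or.inl ((CharP.charP_iff_prime_eq_zero Fact.out).mpr ?_)
        rw [← map_natCast (Algebra.TensorProduct.includeLeft : R →ₐ[S] R ⊗[S] R),
          CharP.cast_eq_zero, map_zero]
    rcases this with h1 | h1
    · obtain ⟨s, hs⟩ := h x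
      rw [sub_pow_char, Algebra.TensorProduct.tmul_pow, Algebra.TensorProduct.tmul_pow, ← hs,
        one_pow, Algebra.algebraMap_eq_smul_one, TensorProduct.smul_tmul, sub_self]
      exact zero_mem _
    · exact Subsingleton.elim _ _
  intro a
  -- The two inclusions of `R` into `R ⊗[S] R` agree modulo a nilpotent ideal, hence are equal. So
  -- `R` is an epimorphic finite `S`-algebra, that is, a quotient.
  have := Algebra.FormallyUnramified.ext (R := S) (A := R) (KaehlerDifferential.ideal S R) hI
    (g₁ := Algebra.TensorProduct.includeRight) (g₂ := Algebra.TensorProduct.includeLeft)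
    (fun x => Ideal.Quotient.eq.mpr (KaehlerDifferential.one_smul_sub_smul_one_mem_ideal S x))
  exact DFunLike.congr_fun this a

/-- Frobenius is surjective on the perfect field `k`, so the Frobenius of `A` is of finite type; it
is integral because `x` is a root of `X ^ p - x ^ p`. -/
lemma frobenius_finite_of_finiteType (p : ℕ) [Fact p.Prime] {k A : Type*} [Field k] [CharP k p]
    [CommRing A] [Algebra k A] [CharP A p] (hk : ∀ a : k, ∃ c, c ^ p = a) [Algebra.FiniteType k A] :
    (frobenius A p).Finite := by
  have h1 : (frobenius A p).FiniteType := by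
    refine RingHom.FiniteType.of_comp_finiteType (f := algebraMap k A) ?_
    have : (frobenius A p).comp (algebraMap k A) = (algebraMap k A).comp (frobenius k p) := by
      ext a
      simp [frobenius_def]
    rw [this]
    refine RingHom.FiniteType.comp (RingHom.finiteType_algebraMap.mpr inferInstance)
      (RingHom.FiniteType.of_surjective _ fun a => ?_)
    obtain ⟨c, hc⟩ := hk a
    exact ⟨c, hc⟩
  refine RingHom.IsIntegral.to_finite (fun x => ?_) h1
  refine ⟨Polynomial.X ^ p - Polynomial.C x, Polynomial.monic_X_pow_sub_C _ (NeZero.ne p), ?_⟩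
  simp [frobenius_def]

variable (p : ℕ) {ι : Type} [Fintype ι] [DecidableEq ι]

/-- Monomials. -/
def mono {R : Type*} [CommRing R] (b : ι → R) (m : ι → ℕ) : R := ∏ i, b i ^ m i

/-- The family `b` generates `R` over the `p`-th powers. -/
def PSpans {R : Type*} [CommRing R] (b : ι → R) : Prop :=
  ∀ x : R, ∃ c : (ι → Fin p) → R, x = ∑ α, c α ^ p * mono b (fun i => α i)

lemma mono_add {R : Type*} [CommRing R] (b : ι → R) (m n : ι → ℕ) :
    mono b (m + n) = mono b m * mono b n := by
  simp [mono, pow_add, Finset.prod_mul_distrib]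

variable [hp : Fact p.Prime]

lemma mono_eq {R : Type*} [CommRing R] (b : ι → R) (m : ι → ℕ) :
    mono b m = (mono b fun i => m i / p) ^ p * mono b fun i => m i % p := by
  simp only [mono, ← Finset.prod_pow, ← Finset.prod_mul_distrib, ← pow_mul, ← pow_add]
  refine Finset.prod_congr rfl fun i _ => ?_
  rw [Nat.div_add_mod' (m i) p]

/-- The subring generated by `p`-th powers and a family `b`. -/
def pSpan {R : Type*} [CommRing R] [CharP R p] (b : ι → R) : Subring R where
  carrier := {x | ∃ c : (ι → Fin p) → R, x = ∑ α, c α ^ p * mono b (fun i => α i)}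
  zero_mem' := ⟨0, by simp [hp.out.ne_zero]⟩
  add_mem' := by
    rintro _ _ ⟨c, rfl⟩ ⟨d, rfl⟩
    exact ⟨c + d, by simp [add_pow_char, add_mul, Finset.sum_add_distrib]⟩
  neg_mem' := by
    rintro _ ⟨c, rfl⟩
    refine ⟨fun α => - c α, ?_⟩
    have : ∀ x : R, (-x) ^ p = - x ^ p := fun x => by
      have := sub_pow_char (R := R) (p := p) 0 x
      simpa [hp.out.ne_zero] using this
    simp [this]
  one_mem' := by
    refine ⟨Pi.single (fun _ => ⟨0, hp.out.pos⟩) 1, ?_⟩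
    rw [Finset.sum_eq_single (fun _ => ⟨0, hp.out.pos⟩)]
    · simp [mono]
    · intro α _ h
      rw [Pi.single_eq_of_ne h, zero_pow hp.out.ne_zero, zero_mul]
    · simp
  mul_mem' := by
    rintro x y ⟨c, hx⟩ ⟨d, hy⟩
    subst hx hy
    -- Exponents are added modulo `p`; the carries form a `p`-th power of a monomial, which goes
    -- into the coefficient.
    refine ⟨fun γ => ∑ x : (ι → Fin p) × (ι → Fin p),
      if (fun i => (x.1 i + x.2 i : ℕ) % p) = (fun i => (γ i : ℕ)) then
        c x.1 * d x.2 * mono b (fun i => (x.1 i + x.2 i : ℕ) / p) else 0, ?_⟩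
    simp_rw [sum_pow_char, ite_pow, zero_pow hp.out.ne_zero, Finset.sum_mul]
    rw [Finset.sum_comm, ← Finset.univ_product_univ, Finset.sum_product]
    refine Finset.sum_congr rfl fun α _ => ?_
    rw [Finset.mul_sum]
    refine Finset.sum_congr rfl fun β _ => ?_
    rw [Finset.sum_eq_single (fun i => ⟨(α i + β i : ℕ) % p, Nat.mod_lt _ hp.out.pos⟩)]
    · rw [if_pos rfl]
      have h := mono_eq p b (fun i => (α i : ℕ) + β i)
      have h2 := mono_add b (fun i => (α i : ℕ)) (fun i => (β i : ℕ))
      have h3 : (fun i => (α i : ℕ)) + (fun i => (β i : ℕ)) = fun i => (α i : ℕ) + β i := rfl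
      rw [h3, h] at h2
      simp only at h2 ⊢
      linear_combination (-(c α ^ p * d β ^ p)) * h2
    · intro γ _ hγ
      rw [if_neg, zero_mul]
      intro h
      exact hγ (funext fun i => Fin.ext (congrFun h i).symm)
    · simp

lemma pow_mul_mono_mem {R : Type*} [CommRing R] [CharP R p] (b : ι → R) (x : R)
    (m : ι → ℕ) : x ^ p * mono b m ∈ pSpan p b := by
  rw [mono_eq p b m, ← mul_assoc, ← mul_pow]
  refine ⟨Pi.single (fun i => ⟨m i % p, Nat.mod_lt _ hp.out.pos⟩) (x * mono b fun i => m i / p), ?_⟩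
  rw [Finset.sum_eq_single (fun i => ⟨m i % p, Nat.mod_lt _ hp.out.pos⟩)]
  · simp
  · intro α _ h
    simp [Pi.single_eq_of_ne h, hp.out.ne_zero]
  · simp

/-- Elements whose differentials generate the module of differentials generate the ring over the
`p`-th powers. -/
lemma pSpans_of_span_eq_top {k R : Type*} [CommRing k] [CommRing R] [Algebra k R] [CharP R p]
    (hk : ∀ a : k, ∃ c, c ^ p = a) (hR : (frobenius R p).Finite) (b : ι → R)
    (hb : Submodule.span R (Set.range fun i => KaehlerDifferential.D k R (b i)) = ⊤) :
    PSpans p b := by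
  classical
  have hpow : ∀ x : R, x ^ p ∈ pSpan p b := fun x => by
    simpa [mono] using pow_mul_mono_mem p b x 0
  -- This is the ring generated by `b` over the `p`-th powers; it contains `k` because `k` is
  -- perfect.
  let S : Subalgebra k R := { pSpan p b with
    algebraMap_mem' := fun a => by
      obtain ⟨c, rfl⟩ := hk a
      rw [map_pow]
      exact hpow _ }
  have hS : ∀ x, x ∈ S ↔ x ∈ pSpan p b := fun x => Iff.rfl
  have hfin : Module.Finite S R := by
    have h : (frobenius R p) = (algebraMap S R).comp
        ((frobenius R p).codRestrict S fun x => hpow x) := by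
      ext; rfl
    rw [h] at hR
    exact RingHom.finite_algebraMap.mp (RingHom.Finite.of_comp_finite hR)
  -- The differentials of `R` over `S` are generated by the images of the `d (b i)`, which vanish
  -- since `b i` lies in `S`.
  have hunr : Algebra.FormallyUnramified S R := by
    refine ⟨?_⟩
    rw [← Submodule.subsingleton_iff R, ← subsingleton_iff_bot_eq_top, eq_comm, eq_bot_iff,
      ← LinearMap.range_eq_top.mpr (KaehlerDifferential.map_surjective k S R),
      LinearMap.range_eq_map, ← hb, Submodule.map_span, Submodule.span_le]
    rintro _ ⟨_, ⟨i, rfl⟩, rfl⟩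
    have hbi : b i ∈ S := by
      have := pow_mul_mono_mem p b 1 (Pi.single i 1)
      exact (hS _).mpr (by simpa [mono, Pi.single_apply, Finset.prod_ite_eq] using this)
    rw [KaehlerDifferential.map_D]
    exact (KaehlerDifferential.D S R).map_algebraMap ⟨b i, hbi⟩
  intro x
  obtain ⟨s, rfl⟩ := surjective_algebraMap_of_radicial p (S := S) (R := R)
    (fun x => ⟨⟨x ^ p, hpow x⟩, rfl⟩) x
  exact s.2

end PBasis

/-! ### Independence of monomials over constants and the trace of a `p`-basis. -/

section PBasisField

variable (p : ℕ) [hp : Fact p.Prime] {ι : Type} [Fintype ι] [DecidableEq ι]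
  {k N : Type*} [Field k] [Field N] [Algebra k N] [CharP N p]

lemma Derivation.map_pow_char (D : Derivation k N N) (x : N) : D (x ^ p) = 0 := by
  simp [Derivation.leibniz_pow]

/-- Powers of an element with derivative one are independent over constants. -/
lemma const_independent (D : Derivation k N N) {x : N} (hx : D x = 1) (n : ℕ) (hn : n ≤ p)
    (g : ℕ → N) (hg : ∀ m, D (g m) = 0) (h : ∑ m ∈ Finset.range n, g m * x ^ m = 0) :
    ∀ m < n, g m = 0 := by
  induction n generalizing g with
  | zero => simp
  | succ n ih =>
    -- Differentiating the relation shortens it by one term; the new factors `m + 1` are less than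
    -- `p`, hence invertible.
    have h1 : ∑ m ∈ Finset.range n, ((m + 1 : ℕ) * g (m + 1)) * x ^ m = 0 := by
      have := congrArg D h
      rw [Finset.sum_range_succ', map_add, map_sum, map_zero] at this
      simp only [Derivation.leibniz, hg, smul_zero, add_zero, Derivation.leibniz_pow, hx,
        pow_zero, Derivation.map_one_eq_zero, add_tsub_cancel_right] at this
      rw [← this]
      refine Finset.sum_congr rfl fun m _ => ?_
      simp only [nsmul_eq_mul, smul_eq_mul, mul_one]
      ring
    have h2 := ih (by omega) (fun m => (m + 1 : ℕ) * g (m + 1)) (fun m => by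
      simp [Derivation.leibniz, hg]) h1
    have h3 : ∀ m < n, g (m + 1) = 0 := fun m hm => by
      rcases mul_eq_zero.mp (h2 m hm) with h | h
      · rw [CharP.cast_eq_zero_iff N p] at h
        exact absurd (Nat.le_of_dvd (by omega) h) (by omega)
      · exact h
    rw [Finset.sum_range_succ', Finset.sum_eq_zero (fun m hm => by
      rw [h3 m (Finset.mem_range.mp hm), zero_mul])] at h
    intro m hm
    rcases m with _ | m
    · simpa using h
    · exact h3 m (by omega)

/-- Monomials in dual coordinates of a family of derivations are independent over constants. -/
lemma mono_independent (D : ι → Derivation k N N) (b : ι → N)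
    (hD : ∀ i j, D i (b j) = if i = j then 1 else 0) (c : (ι → Fin p) → N)
    (hc : ∀ i α, D i (c α) = 0) (h : ∑ α, c α * mono b (fun i => α i) = 0) : c = 0 := by
  -- The exponents are separated one coordinate at a time. For the coordinate `j`, the terms are
  -- grouped by the exponent of `b j`; the coefficients of the resulting polynomial in `b j` are
  -- killed by `D j`, so each of them vanishes.
  have key : ∀ (s : Finset ι) (α₀ : ι → Fin p),
      ∑ α with (∀ i ∈ s, α i = α₀ i), c α * ∏ i ∈ sᶜ, b i ^ (α i : ℕ) = 0 := by
    intro s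
    induction s using Finset.induction_on with
    | empty => intro α₀; simpa [mono] using h
    | insert j s hj ih =>
      intro α₀
      let g : ℕ → N := fun m => ∑ α with ((∀ i ∈ s, α i = α₀ i) ∧ (α j : ℕ) = m),
        c α * ∏ i ∈ (insert j s)ᶜ, b i ^ (α i : ℕ)
      have hg : ∀ m, D j (g m) = 0 := by
        intro m
        simp only [g, map_sum, Derivation.leibniz, hc, smul_zero, add_zero]
        refine Finset.sum_eq_zero fun α _ => ?_
        have : D j (∏ i ∈ (insert j s)ᶜ, b i ^ (α i : ℕ)) = 0 := by
          have : ∀ t : Finset ι, j ∉ t → D j (∏ i ∈ t, b i ^ (α i : ℕ)) = 0 := by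
            intro t
            induction t using Finset.induction_on with
            | empty => simp
            | insert i t hi iht =>
              intro hjt
              rw [Finset.mem_insert, not_or] at hjt
              rw [Finset.prod_insert hi, Derivation.leibniz, iht hjt.2, Derivation.leibniz_pow,
                hD, if_neg hjt.1]
              simp
          exact this _ (by simp)
        rw [this, smul_zero]
      have hsum : ∑ m ∈ Finset.range p, g m * b j ^ m = 0 := by
        rw [← ih α₀]
        rw [← Finset.sum_fiberwise_of_maps_to (s := Finset.univ.filter
          fun α : ι → Fin p => ∀ i ∈ s, α i = α₀ i) (t := Finset.range p)
          (g := fun α => (α j : ℕ)) (fun α _ => Finset.mem_range.mpr (α j).2)]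
        refine Finset.sum_congr rfl fun m _ => ?_
        simp only [g]
        rw [Finset.filter_filter, Finset.sum_mul]
        refine Finset.sum_congr rfl fun α hα => ?_
        have hm : (α j : ℕ) = m := (Finset.mem_filter.mp hα).2.2
        have : sᶜ = insert j (insert j s)ᶜ := by
          ext i
          by_cases hij : i = j
          · subst hij; simp [hj]
          · simp [hij]
        rw [this, Finset.prod_insert (by simp), hm]
        ring
      have hj0 := const_independent p (D j) (x := b j) (by simp [hD]) p le_rfl g hg hsum
        (α₀ j) (α₀ j).2
      rw [← hj0]
      refine Finset.sum_congr ?_ fun _ _ => rfl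
      ext α
      simp only [Finset.mem_insert, forall_eq_or_imp, Finset.mem_filter, Finset.mem_univ, true_and,
        Fin.ext_iff]
      exact and_comm
  ext α
  have := key Finset.univ α
  simpa [← funext_iff, Finset.filter_eq'] using this

/-- The derivations dual to a basis of differentials. -/
noncomputable def dualDer {κ : Type*} (B : Module.Basis κ N (Ω[N⁄k])) (i : κ) :
    Derivation k N N := (B.coord i).compDer (KaehlerDifferential.D k N)

/-- The family `b` is a `p`-basis of the field `N`. -/
structure IsPBasis (b : ι → N) : Prop where
  spans : PSpans p b
  indep : ∀ c : (ι → Fin p) → N, ∑ α, c α ^ p * mono b (fun i => α i) = 0 → c = 0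

lemma isPBasis_of_basis (b : ι → N) (B : Module.Basis ι N (Ω[N⁄k]))
    (hB : ∀ i, B i = KaehlerDifferential.D k N (b i)) (hspan : PSpans p b) : IsPBasis p b := by
  refine ⟨hspan, fun c hc => ?_⟩
  have := mono_independent p (dualDer B) b (fun i j => ?_) (fun α => c α ^ p)
    (fun i α => Derivation.map_pow_char p _ _) hc
  · ext α
    exact (pow_eq_zero_iff hp.out.ne_zero).mp (congrFun this α)
  · simp [dualDer, ← hB, Module.Basis.coord_apply, Finsupp.single_apply, eq_comm]

namespace IsPBasis

variable {p} {b : ι → N} (hb : IsPBasis p b)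

/-- The coefficients with respect to a `p`-basis. -/
noncomputable def coef (hb : IsPBasis p b) (x : N) : (ι → Fin p) → N := (hb.spans x).choose

lemma sum_coef (x : N) : ∑ α, hb.coef x α ^ p * mono b (fun i => α i) = x :=
  (hb.spans x).choose_spec.symm

lemma coef_unique {x : N} {c : (ι → Fin p) → N}
    (h : ∑ α, c α ^ p * mono b (fun i => α i) = x) : hb.coef x = c := by
  have := hb.indep (hb.coef x - c) (by
    simp only [Pi.sub_apply, sub_pow_char, sub_mul, Finset.sum_sub_distrib, sum_coef, h, sub_self])
  exact sub_eq_zero.mp this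

variable (p) in
/-- The top exponent. -/
def top (_ : ι) : Fin p := ⟨p - 1, Nat.sub_lt hp.out.pos one_pos⟩

/-- The `p`-th root of the top coefficient with respect to a `p`-basis. -/
noncomputable def trace (hb : IsPBasis p b) : AddMonoid.End N where
  toFun x := hb.coef x (top p)
  map_zero' := by
    rw [hb.coef_unique (c := 0) (by simp [hp.out.ne_zero])]
    rfl
  map_add' x y := by
    rw [hb.coef_unique (c := hb.coef x + hb.coef y)
      (by simp [add_pow_char, add_mul, Finset.sum_add_distrib, sum_coef])]
    rfl

lemma trace_apply (x : N) : hb.trace x = hb.coef x (top p) := rfl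

lemma coef_mul (r x : N) : hb.coef (r ^ p * x) = fun α => r * hb.coef x α := by
  apply hb.coef_unique
  conv_rhs => rw [← hb.sum_coef x, Finset.mul_sum]
  exact Finset.sum_congr rfl fun α _ => by ring

lemma trace_rootLinear : RootLinear p hb.trace := fun r x => by
  rw [trace_apply, coef_mul, trace_apply]

lemma trace_mono (m : ι → ℕ) :
    hb.trace (mono b m) = if ∀ i, m i % p = p - 1 then mono b (fun i => m i / p) else 0 := by
  rw [trace_apply, hb.coef_unique (c := Pi.single (fun i => ⟨m i % p, Nat.mod_lt _ hp.out.pos⟩)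
    (mono b fun i => m i / p))]
  · split_ifs with h
    · have : (fun i => (⟨m i % p, Nat.mod_lt _ hp.out.pos⟩ : Fin p)) = top p := by
        ext i; exact h i
      rw [this, Pi.single_eq_same]
    · rw [Pi.single_eq_of_ne]
      intro h'
      exact h fun i => by have := congrFun h' i; exact (congrArg Fin.val this).symm
  · rw [mono_eq p b m, Finset.sum_eq_single (fun i => ⟨m i % p, Nat.mod_lt _ hp.out.pos⟩)]
    · simp
    · intro α _ h
      simp [Pi.single_eq_of_ne h, hp.out.ne_zero]
    · simp

/-- The complementary exponents. -/
def compl (α : ι → Fin p) : ι → Fin p := fun i => (α i).rev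

/-- The exponents of the product are `α i + (p - 1 - β i)`, and all of them are congruent to `p - 1`
modulo `p` only if `α = β`. Thus complementary monomials are dual for the trace form. -/
lemma trace_mul_compl (α β : ι → Fin p) :
    hb.trace (mono b (fun i => α i) * mono b fun i => (compl β i : Fin p)) =
      if α = β then 1 else 0 := by
  rw [← mono_add, trace_mono]
  have h1 : ∀ i, (((fun i => (α i : ℕ)) + fun i => ((compl β i : Fin p) : ℕ)) i) =
      α i + (p - (β i + 1)) := fun i => by simp [compl, Fin.val_rev]
  by_cases h : α = β
  · subst h
    have h2 : ∀ i, (α i : ℕ) + (p - (α i + 1)) = p - 1 := fun i => by have := (α i).2; omega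
    have h3 : (p - 1) % p = p - 1 := Nat.mod_eq_of_lt (Nat.sub_lt hp.out.pos one_pos)
    have h4 : (p - 1) / p = 0 := Nat.div_eq_of_lt (Nat.sub_lt hp.out.pos one_pos)
    simp only [h1, h2, h3, h4, implies_true, if_true]
    simp [mono]
  · rw [if_neg h, if_neg]
    intro h2
    apply h
    ext i
    have h3 := h2 i
    rw [h1] at h3
    have ha := (α i).2
    have hbb := (β i).2
    by_cases h4 : (α i : ℕ) + (p - (β i + 1)) < p
    · rw [Nat.mod_eq_of_lt h4] at h3
      omega
    · rw [Nat.mod_eq_sub_mod (by omega), Nat.mod_eq_of_lt (by omega)] at h3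
      omega

lemma trace_mul_mono (y : N) (β : ι → Fin p) :
    hb.trace (y * mono b fun i => (compl β i : Fin p)) = hb.coef y β := by
  conv_lhs => rw [← hb.sum_coef y, Finset.sum_mul, map_sum]
  simp_rw [mul_assoc, hb.trace_rootLinear _ _, trace_mul_compl]
  simp

lemma isDualFrame : IsDualFrame p hb.trace (fun α : ι → Fin p => mono b fun i => (α i : ℕ))
    (fun α => mono b fun i => (compl α i : Fin p)) := by
  have h : ∀ y, ∑ α, hb.trace (y * mono b fun i => (compl α i : Fin p)) ^ p *
      mono b (fun i => (α i : ℕ)) = y := fun y => by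
    simp_rw [trace_mul_mono, sum_coef]
  refine ⟨h, fun y => ?_⟩
  have hinv : Function.Involutive (compl : (ι → Fin p) → _) := fun α => by ext; simp [compl]
  conv_rhs => rw [← h y]
  refine Fintype.sum_equiv hinv.toPerm _ _ fun α => ?_
  simp only [Function.Involutive.coe_toPerm]
  rw [hinv α]

lemma isTraceOn (R : Subring N) (hbR : ∀ i, b i ∈ R)
    (hR : ∀ x ∈ R, ∃ c : (ι → Fin p) → N, (∀ α, c α ∈ R) ∧
      x = ∑ α, c α ^ p * mono b (fun i => α i)) : IsTraceOn p hb.trace R := by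
  have hm : ∀ m : ι → ℕ, mono b m ∈ R := fun m => prod_mem fun i _ => pow_mem (hbR i) _
  refine ⟨hb.trace_rootLinear, fun r hr => ?_, _, inferInstance, _, _, fun α => hm _,
    fun α => hm _, hb.isDualFrame⟩
  obtain ⟨c, hc, h⟩ := hR r hr
  rw [trace_apply, hb.coef_unique h.symm]
  exact hc _

end IsPBasis

end PBasisField

/-! ### The Cartier operator and its behaviour under a change of coordinates. -/

section ChangeOfCoordinates

variable {p : ℕ} [hp : Fact p.Prime] {ι : Type} [Fintype ι] [DecidableEq ι]
  {k N : Type*} [Field k] [Field N] [Algebra k N] [CharP N p]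

lemma Derivation.map_mono {D : Derivation k N N} {b : ι → N} {j : ι}
    (hD : ∀ i, D (b i) = if j = i then 1 else 0) (m : ι → ℕ) :
    D (mono b m) = m j * mono b (m - Pi.single j 1) := by
  have h1 : ∀ t : Finset ι, j ∉ t → D (∏ i ∈ t, b i ^ m i) = 0 := by
    intro t
    induction t using Finset.induction_on with
    | empty => simp
    | insert i t hi iht =>
      intro hjt
      rw [Finset.mem_insert, not_or] at hjt
      rw [Finset.prod_insert hi, Derivation.leibniz, iht hjt.2, Derivation.leibniz_pow, hD,
        if_neg hjt.1]
      simp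
  rw [mono, ← Finset.mul_prod_erase _ _ (Finset.mem_univ j), Derivation.leibniz,
    h1 _ (Finset.notMem_erase _ _), Derivation.leibniz_pow, hD, if_pos rfl, mono,
    ← Finset.mul_prod_erase _ _ (Finset.mem_univ j)]
  have h2 : ∏ i ∈ Finset.univ.erase j, b i ^ (m - Pi.single j 1 : ι → ℕ) i =
      ∏ i ∈ Finset.univ.erase j, b i ^ m i := by
    refine Finset.prod_congr rfl fun i hi => ?_
    simp [Pi.single_eq_of_ne (Finset.ne_of_mem_erase hi)]
  rw [h2]
  simp
  ring

namespace IsPBasis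

variable {b : ι → N} (hb : IsPBasis p b) {D : Derivation k N N} {j : ι}
  (hD : ∀ i, D (b i) = if j = i then 1 else 0)

include hD

/-- The trace vanishes on exact elements. -/
lemma trace_der (y : N) : hb.trace (D y) = 0 := by
  rw [← hb.sum_coef y, map_sum, map_sum]
  refine Finset.sum_eq_zero fun α _ => ?_
  rw [Derivation.leibniz, Derivation.map_pow_char, smul_zero, add_zero, smul_eq_mul,
    hb.trace_rootLinear, Derivation.map_mono hD, ← nsmul_eq_mul, map_nsmul, trace_mono]
  -- Differentiation lowers the exponent of `b j`, so it can no longer be `p - 1`; if the exponent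
  -- was zero, the term vanishes.
  rcases Nat.eq_zero_or_pos (α j : ℕ) with h | h
  · simp [h]
  · rw [if_neg]
    · simp
    · intro h1
      have h2 := h1 j
      have h3 := (α j).2
      simp only [Pi.sub_apply, Pi.single_eq_same] at h2
      rw [Nat.mod_eq_of_lt (by omega)] at h2
      omega

/-- Additivity of `f ↦ f ^ (p - 1) df` up to exact elements. -/
lemma trace_log_add {z : N} (hz : D z = 0) (f g : N) :
    hb.trace (z * ((f + g) ^ (p - 1) * D (f + g))) =
      hb.trace (z * (f ^ (p - 1) * D f)) + hb.trace (z * (g ^ (p - 1) * D g)) := by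
  obtain ⟨r, hr⟩ : ∃ r, p = r + 1 := ⟨p - 1, by have := hp.out.pos; omega⟩
  -- Here `n` is the integer `p.choose (i + 1) / p`. The defect of additivity is the derivative of
  -- `∑ n i * f ^ (i + 1) * g ^ (p - 1 - i)`, which is `((f + g) ^ p - f ^ p - g ^ p) / p` taken
  -- before reduction modulo `p`.
  have hn : ∀ i < r, ∃ n : ℕ, (i + 1) * n = r.choose i ∧ (r - i) * n = r.choose (i + 1) := by
    intro i hi
    obtain ⟨n, hn⟩ := hp.out.dvd_choose_self (k := i + 1) (by omega) (by omega)
    refine ⟨n, ?_, ?_⟩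
    · have := Nat.add_one_mul_choose_eq r i
      rw [← hr, hn] at this
      exact (Nat.eq_of_mul_eq_mul_left hp.out.pos (by rw [this]; ring)).symm
    · have h2 := Nat.choose_mul_succ_eq r (i + 1)
      rw [← hr, hn] at h2
      have h3 : p - (i + 1) = r - i := by omega
      rw [h3] at h2
      exact (Nat.eq_of_mul_eq_mul_left hp.out.pos (by linarith)).symm
  choose! n hn1 hn2 using hn
  have key : D (z * ∑ i ∈ Finset.range r, n i * (f ^ (i + 1) * g ^ (r - i))) =
      z * ((f + g) ^ (p - 1) * D (f + g)) - z * (f ^ (p - 1) * D f) -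
        z * (g ^ (p - 1) * D g) := by
    have hp1 : p - 1 = r := by omega
    have hA : ∑ i ∈ Finset.range r, (n i : N) * ((i + 1 : ℕ) * f ^ i * g ^ (r - i)) =
        (f + g) ^ r - f ^ r := by
      rw [add_pow, Finset.sum_range_succ]
      simp only [Nat.sub_self, pow_zero, Nat.choose_self, Nat.cast_one, mul_one,
        add_sub_cancel_right]
      refine Finset.sum_congr rfl fun i hi => ?_
      rw [← hn1 i (Finset.mem_range.mp hi)]
      push_cast
      ring
    have hB : ∑ i ∈ Finset.range r, (n i : N) * ((r - i : ℕ) * f ^ (i + 1) * g ^ (r - i - 1)) =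
        (f + g) ^ r - g ^ r := by
      rw [add_pow, Finset.sum_range_succ']
      simp only [pow_zero, Nat.sub_zero, Nat.choose_zero_right, Nat.cast_one, mul_one, one_mul,
        add_sub_cancel_right]
      refine Finset.sum_congr rfl fun i hi => ?_
      rw [← hn2 i (Finset.mem_range.mp hi), Nat.sub_sub]
      push_cast
      ring
    rw [Derivation.leibniz, hz, smul_zero, add_zero, map_sum, smul_eq_mul, hp1]
    have : ∀ i, D (n i * (f ^ (i + 1) * g ^ (r - i))) =
        (n i : N) * ((i + 1 : ℕ) * f ^ i * g ^ (r - i)) * D f +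
        (n i : N) * ((r - i : ℕ) * f ^ (i + 1) * g ^ (r - i - 1)) * D g := by
      intro i
      simp only [Derivation.leibniz, Derivation.leibniz_pow, Derivation.map_natCast,
        smul_eq_mul, nsmul_eq_mul, Nat.add_sub_cancel]
      ring
    simp_rw [this, Finset.sum_add_distrib, ← Finset.sum_mul, hA, hB, map_add]
    ring
  have h := hb.trace_der hD (z * ∑ i ∈ Finset.range r, n i * (f ^ (i + 1) * g ^ (r - i)))
  rw [key, map_sub, map_sub] at h
  linear_combination h

/-- The trace of `f ^ (p - 1) df`. -/
lemma trace_log {m : ι → ℕ} (hm : m j = 0) (f : N) :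
    hb.trace (mono b m * (f ^ (p - 1) * D f)) = D f * hb.trace (mono b m * b j ^ (p - 1)) := by
  have hz : D (mono b m) = 0 := by rw [Derivation.map_mono hD, hm]; simp
  -- Both sides are additive in `f`, the left one by `trace_log_add`, so it suffices to treat a
  -- `p`-th power times a monomial.
  let E : AddMonoid.End N :=
    { toFun := fun f => hb.trace (mono b m * (f ^ (p - 1) * D f))
      map_zero' := by simp
      map_add' := hb.trace_log_add hD hz }
  have hE : ∀ f, E f = hb.trace (mono b m * (f ^ (p - 1) * D f)) := fun f => rfl
  rw [← hE, ← hb.sum_coef f, map_sum, map_sum, Finset.sum_mul]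
  refine Finset.sum_congr rfl fun β _ => ?_
  rw [hE, Derivation.leibniz, Derivation.map_pow_char, smul_zero, add_zero, smul_eq_mul,
    Derivation.map_mono hD]
  rcases Nat.eq_zero_or_pos (β j : ℕ) with h | h
  · simp [h]
  · set μ := mono b ((fun i => (β i : ℕ)) - Pi.single j 1)
    have h1 : mono b (fun i => (β i : ℕ)) = b j * μ := by
      have : (fun i => (β i : ℕ)) = Pi.single j 1 + ((fun i => (β i : ℕ)) - Pi.single j 1) := by
        ext i
        by_cases hi : i = j
        · subst hi; simp; omega
        · simp [Pi.single_eq_of_ne hi]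
      rw [this, mono_add]
      congr 1
      simp [mono, Pi.single_apply]
    rw [h1]
    set c := hb.coef f β
    obtain ⟨r, hr⟩ : ∃ r, p = r + 1 := ⟨p - 1, by have := hp.out.pos; omega⟩
    have h2 : mono b m * ((c ^ p * (b j * μ)) ^ (p - 1) * (c ^ p * ((β j : ℕ) * μ))) =
        (β j : ℕ) • ((c ^ p * μ) ^ p * (mono b m * b j ^ (p - 1))) := by
      have hp1 : p - 1 = r := by omega
      have : ∀ x : N, x ^ p = x ^ r * x := fun x => by rw [hr, pow_succ]
      rw [hp1, nsmul_eq_mul, this (c ^ p * μ)]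
      ring
    rw [h2, map_nsmul, hb.trace_rootLinear, nsmul_eq_mul]
    ring

/-- Change of one coordinate. -/
lemma trace_update {c : N} (hb' : IsPBasis p (Function.update b j c)) (x : N) :
    hb.trace (D c * x) = D c * hb'.trace x := by
  -- Both sides are root-linear in `x`, so it suffices to treat monomials in the new coordinates.
  have hmono : ∀ β : ι → Fin p, hb.trace (D c * mono (Function.update b j c) fun i => β i) =
      D c * hb'.trace (mono (Function.update b j c) fun i => β i) := by
    intro β
    set m : ι → ℕ := Function.update (fun i => (β i : ℕ)) j 0 with hm
    have hsplit : ∀ b' : ι → N, (∀ i ≠ j, b' i = b i) →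
        mono b' (fun i => β i) = b' j ^ (β j : ℕ) * mono b m := by
      intro b' hb'
      rw [mono, mono, ← Finset.mul_prod_erase _ _ (Finset.mem_univ j),
        ← Finset.mul_prod_erase _ (fun i => b i ^ m i) (Finset.mem_univ j)]
      simp only [hm, Function.update_self, pow_zero, one_mul]
      congr 1
      refine Finset.prod_congr rfl fun i hi => ?_
      rw [Function.update_of_ne (Finset.ne_of_mem_erase hi), hb' i (Finset.ne_of_mem_erase hi)]
    have hz : D (mono b m) = 0 := by rw [Derivation.map_mono hD]; simp [hm]
    have h1 := hsplit (Function.update b j c) (fun i hi => Function.update_of_ne hi _ _)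
    rw [Function.update_self] at h1
    have hmod : ∀ i, (β i : ℕ) % p = β i := fun i => Nat.mod_eq_of_lt (β i).2
    have hdiv : ∀ i, (β i : ℕ) / p = 0 := fun i => Nat.div_eq_of_lt (β i).2
    have hlt := (β j).2
    rw [trace_mono, h1]
    by_cases hj : (β j : ℕ) = p - 1
    · have h2 := hb.trace_log hD (m := m) (by simp [hm]) c
      have h3 := hsplit b (fun i _ => rfl)
      rw [hj] at h3 ⊢
      rw [show D c * (c ^ (p - 1) * mono b m) = mono b m * (c ^ (p - 1) * D c) by ring, h2,
        mul_comm (mono b m), ← h3, trace_mono]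
      simp [hdiv, mono]
    -- For an exponent `β j < p - 1` the element `c ^ β j * D c` is exact up to the invertible
    -- factor `β j + 1`, so both sides vanish.
    · rw [if_neg (fun h => hj (by rw [← hmod j]; exact h j)), mul_zero]
      have h2 := hb.trace_der hD (mono b m * c ^ ((β j : ℕ) + 1))
      rw [Derivation.leibniz, hz, smul_zero, add_zero, Derivation.leibniz_pow,
        Nat.add_sub_cancel, smul_comm, map_nsmul, nsmul_eq_mul] at h2
      rcases mul_eq_zero.mp h2 with h | h
      · rw [CharP.cast_eq_zero_iff N p] at h
        exact absurd (Nat.le_of_dvd (by omega) h) (by omega)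
      · rw [← h]
        congr 1
        simp only [smul_eq_mul]
        ring
  rw [← hb'.sum_coef x, Finset.mul_sum, map_sum, map_sum, Finset.mul_sum]
  refine Finset.sum_congr rfl fun β _ => ?_
  rw [mul_left_comm, hb.trace_rootLinear, hb'.trace_rootLinear, hmono]
  ring

end IsPBasis

lemma Module.Basis.det_update_self {V : Type*} [AddCommGroup V] [Module N V]
    (B : Module.Basis ι N V) (j : ι) (w : V) :
    B.det (Function.update B j w) = B.coord j w := by
  rw [Module.Basis.det_apply, Module.Basis.toMatrix_update, Module.Basis.toMatrix_self,
    ← Matrix.cramer_apply, Matrix.cramer_one]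
  rfl

/-- The differentials of `b` are a basis. -/
def IsCoordBasis (k : Type*) [Field k] [Algebra k N] (b : ι → N) : Prop :=
  ∃ B : Module.Basis ι N (Ω[N⁄k]), ∀ i, B i = KaehlerDifferential.D k N (b i)

lemma IsCoordBasis.isPBasis {b : ι → N} (hk : ∀ a : k, ∃ c, c ^ p = a)
    (hN : (frobenius N p).Finite) (hb : IsCoordBasis k b) : IsPBasis p b := by
  obtain ⟨B, hB⟩ := hb
  refine isPBasis_of_basis p b B hB (pSpans_of_span_eq_top p hk hN b ?_)
  rw [← B.span_eq]
  congr 2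
  ext i
  exact (hB i).symm

lemma exists_update_basis {V : Type*} [AddCommGroup V] [Module N V]
    (B : Module.Basis ι N V) (j : ι) (w : V) (h : B.coord j w ≠ 0) :
    ∃ B' : Module.Basis ι N V, ⇑B' = Function.update B j w := by
  have := (Module.Basis.is_basis_iff_det B (v := Function.update B j w)).mpr
    (by rw [Module.Basis.det_update_self]; exact h.isUnit)
  exact ⟨Module.Basis.mk this.1 this.2.ge, Module.Basis.coe_mk _ _⟩

lemma IsPBasis.trace_change_one {b : ι → N} (B : Module.Basis ι N (Ω[N⁄k]))
    (hB : ∀ i, B i = KaehlerDifferential.D k N (b i)) (hb : IsPBasis p b) (j : ι) (c : N)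
    (hb' : IsPBasis p (Function.update b j c)) (x : N) :
    hb.trace (B.coord j (KaehlerDifferential.D k N c) * x) =
      B.coord j (KaehlerDifferential.D k N c) * hb'.trace x :=
  hb.trace_update (D := dualDer B j) (fun i => by
    simp [dualDer, ← hB, Finsupp.single_apply, eq_comm]) hb' x

/-- Transformation of the trace under a change of coordinates. -/
lemma IsPBasis.trace_change (hk : ∀ a : k, ∃ c, c ^ p = a) (hN : (frobenius N p).Finite)
    {b b' : ι → N} (B : Module.Basis ι N (Ω[N⁄k])) (hB : ∀ i, B i = KaehlerDifferential.D k N (b i))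
    (B' : Module.Basis ι N (Ω[N⁄k])) (hB' : ∀ i, B' i = KaehlerDifferential.D k N (b' i))
    (hb : IsPBasis p b) (hb' : IsPBasis p b') (x : N) :
    hb.trace (B.det B' * x) = B.det B' * hb'.trace x := by
  -- An exchange argument: the coordinates are replaced one at a time, with induction on the size of
  -- a set `s` outside which the two systems agree. The determinants multiply along the way.
  suffices H : ∀ (n : ℕ) (s : Finset ι), s.card = n → ∀ (b : ι → N) (B : Module.Basis ι N (Ω[N⁄k])),
      (∀ i, B i = KaehlerDifferential.D k N (b i)) → ∀ (hb : IsPBasis p b),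
      (∀ i ∉ s, b i = b' i) → ∀ x, hb.trace (B.det B' * x) = B.det B' * hb'.trace x from
    H _ Finset.univ rfl b B hB hb (by simp) x
  intro n
  induction n with
  | zero =>
    intro s hs b B hB hb h x
    rw [Finset.card_eq_zero] at hs
    subst hs
    obtain rfl : b = b' := funext fun i => h i (by simp)
    obtain rfl : B = B' := Module.Basis.eq_of_apply_eq fun i => by rw [hB, hB']
    rw [Module.Basis.det_self, one_mul, one_mul]
  | succ n ih =>
    intro s hs b B hB hb h x
    obtain ⟨i, hi⟩ : s.Nonempty := by rw [← Finset.card_pos]; omega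
    have step : ∀ (b : ι → N) (B : Module.Basis ι N (Ω[N⁄k])),
        (∀ i, B i = KaehlerDifferential.D k N (b i)) → ∀ (hb : IsPBasis p b),
        (∀ i ∉ s, b i = b' i) → B.coord i (B' i) ≠ 0 →
        ∀ x, hb.trace (B.det B' * x) = B.det B' * hb'.trace x := by
      intro b B hB hb h hne x
      obtain ⟨B₁, hB₁⟩ := exists_update_basis B i (B' i) hne
      have hB₁' : ∀ l, B₁ l = KaehlerDifferential.D k N (Function.update b i (b' i) l) := by
        intro l
        rw [hB₁]
        by_cases hl : l = i
        · subst hl; simp [hB']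
        · simp [hl, hB]
      have hb₁ : IsPBasis p (Function.update b i (b' i)) := IsCoordBasis.isPBasis hk hN ⟨B₁, hB₁'⟩
      have h1 := ih (s.erase i) (by rw [Finset.card_erase_of_mem hi]; omega) _ B₁ hB₁' hb₁
        (fun l hl => by
          by_cases hli : l = i
          · subst hli; simp
          · rw [Function.update_of_ne hli]
            exact h l fun hls => hl (Finset.mem_erase.mpr ⟨hli, hls⟩)) x
      have h2 := IsPBasis.trace_change_one B hB hb i (b' i) hb₁
      rw [← hB'] at h2
      have h3 : B.det B' = B.coord i (B' i) * B₁.det B' := by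
        rw [← Module.Basis.det_mul_det B B₁ B', ← Module.Basis.det_update_self, hB₁]
      rw [h3, mul_assoc, h2, h1, mul_assoc]
    by_cases hii : B.coord i (B' i) ≠ 0
    · exact step b B hB hb h hii x
    push Not at hii
    obtain ⟨j, hj, hjne⟩ : ∃ j ∈ s, B.coord j (B' i) ≠ 0 := by
      by_contra! hcon
      have h1 : B' i ∈ Submodule.span N (B' '' (sᶜ : Set ι)) := by
        rw [← B.sum_repr (B' i)]
        refine Submodule.sum_mem _ fun l _ => ?_
        by_cases hl : l ∈ s
        · have := hcon l hl
          rw [Module.Basis.coord_apply] at this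
          rw [this, zero_smul]
          exact zero_mem _
        · rw [hB, h l hl, ← hB']
          exact Submodule.smul_mem _ _ (Submodule.subset_span ⟨l, by simpa using hl, rfl⟩)
      exact B'.linearIndependent.notMem_span_image (by simpa using hi) h1
    have hji : j ≠ i := by rintro rfl; exact hjne hii
    -- When `d (b' i)` has no component along `d (b i)`, it has one along some `d (b j)` with `j` in
    -- `s`. Replacing `b j` by `b j + b i` has determinant one, and makes the component along `d (b
    -- i)` the negative of that one.
    have hone : B.coord j (B j + B i) = 1 := by
      simp [hji.symm]
    obtain ⟨B₂, hB₂⟩ := exists_update_basis B j (B j + B i) (by rw [hone]; exact one_ne_zero)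
    have hB₂' : ∀ l, B₂ l = KaehlerDifferential.D k N (Function.update b j (b j + b i) l) := by
      intro l
      rw [hB₂]
      by_cases hl : l = j
      · subst hl; simp [hB]
      · simp [hl, hB]
    have hb₂ : IsPBasis p (Function.update b j (b j + b i)) := IsCoordBasis.isPBasis hk hN ⟨B₂, hB₂'⟩
    have h2 : ∀ x, hb.trace x = hb₂.trace x := fun x => by
      have := IsPBasis.trace_change_one B hB hb j (b j + b i) hb₂ x
      rwa [map_add, ← hB, ← hB, hone, one_mul, one_mul] at this
    have h3 : B.det B' = B₂.det B' := by
      rw [← Module.Basis.det_mul_det B B₂ B', hB₂, Module.Basis.det_update_self, hone, one_mul]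
    have h4 : B₂.coord i (B' i) ≠ 0 := by
      have h5 : B' i = ∑ l, (B.coord l (B' i) - if l = i then B.coord j (B' i) else 0) • B₂ l := by
        conv_lhs => rw [← B.sum_repr (B' i)]
        simp only [sub_smul, Finset.sum_sub_distrib, ite_smul, zero_smul, Finset.sum_ite_eq',
          Finset.mem_univ, if_true, hB₂, Module.Basis.coord_apply]
        rw [← Finset.add_sum_erase _ _ (Finset.mem_univ j),
          ← Finset.add_sum_erase _ _ (Finset.mem_univ j), Function.update_self,
          Function.update_of_ne hji.symm]
        have h7 : ∑ l ∈ Finset.univ.erase j, B.repr (B' i) l •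
            Function.update (⇑B) j (B j + B i) l =
            ∑ l ∈ Finset.univ.erase j, B.repr (B' i) l • B l :=
          Finset.sum_congr rfl fun l hl => by
            rw [Function.update_of_ne (Finset.ne_of_mem_erase hl)]
        rw [h7]
        module
      rw [h5, map_sum]
      simp only [map_smul, Module.Basis.coord_apply, Module.Basis.repr_self, Finsupp.single_apply,
        smul_eq_mul, mul_ite, mul_one, mul_zero, Finset.sum_ite_eq', Finset.mem_univ, if_true]
      rw [Module.Basis.coord_apply] at hii hjne
      rw [hii, zero_sub, neg_ne_zero]
      exact hjne
    have h6 := step _ B₂ hB₂' hb₂ (fun l hl => by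
      have : l ≠ j := by rintro rfl; exact hl hj
      rw [Function.update_of_ne this]
      exact h l hl) h4
    rw [h2, h3, h6]

end ChangeOfCoordinates

/-! ### Noetherian normal domains and height one primes -/

/-- An element of the fraction field of a Noetherian normal domain that is integral at all primes
of height one is integral. -/
theorem exists_algebraMap_eq_of_height_one {A K : Type*} [CommRing A] [IsDomain A]
    [IsNoetherianRing A] [IsIntegrallyClosed A] [Field K] [Algebra A K] [IsFractionRing A K] (c : K)
    (h : ∀ P : Ideal A, P.IsPrime → P.height = 1 → ∃ s ∉ P, ∃ a, s • c = algebraMap A K a) :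
    ∃ a, algebraMap A K a = c := by
  by_contra hc
  let I : K → Ideal A := fun y => (1 : Submodule A K).colon {y}
  have hI : ∀ y s, s ∈ I y ↔ ∃ a, algebraMap A K a = s • y := fun y s => by
    rw [Submodule.mem_colon_singleton, Submodule.mem_one]
  -- `I y` is the ideal of denominators of `y`. Among the multiples of `c` outside `A`, one is
  -- chosen whose ideal of denominators is maximal; maximality makes it prime.
  obtain ⟨P, ⟨r, rfl, hr⟩, hmax⟩ := set_has_maximal_iff_noetherian.mpr ‹IsNoetherianRing A›
    {P | ∃ r : A, P = I (r • c) ∧ ¬ ∃ a, algebraMap A K a = r • c} ⟨_, 1, rfl, by simpa using hc⟩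
  set y := r • c with hy
  have hprime : (I y).IsPrime := by
    refine ⟨fun h => hr ?_, fun {u v} huv => or_iff_not_imp_left.mpr fun hu => ?_⟩
    · have : (1 : A) ∈ I y := h ▸ trivial
      simpa using (hI _ _).mp this
    · have h1 : I y ≤ I ((u * r) • c) := fun s hs => by
        obtain ⟨a, ha⟩ := (hI _ _).mp hs
        exact (hI _ _).mpr ⟨u * a, by rw [map_mul, ha, mul_smul, ← hy, smul_comm s u,
          Algebra.smul_def u (s • y)]⟩
      have h2 := h1.eq_of_not_lt (hmax _ ⟨u * r, rfl, fun ⟨a, ha⟩ => hu ((hI _ _).mpr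
        ⟨a, by rw [ha, mul_smul]⟩)⟩)
      rw [h2]
      obtain ⟨a, ha⟩ := (hI _ _).mp huv
      exact (hI _ _).mpr ⟨a, by rw [ha, hy, ← mul_smul, ← mul_smul]; congr 1; ring⟩
  obtain ⟨a, b, hb, hab⟩ := IsFractionRing.div_surjective A y
  have hb0 : b ≠ 0 := nonZeroDivisors.ne_zero hb
  have hbK : algebraMap A K b ≠ 0 := by simpa using hb0
  have hbI : b ∈ I y := (hI _ _).mpr ⟨a, by rw [← hab, Algebra.smul_def]; field_simp⟩
  -- If multiplication by `y` preserved the finitely generated ideal `I y`, then `y` would be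
  -- integral over `A`, hence in `A`.
  have hnot : ¬ ∀ s ∈ I y, ∃ t ∈ I y, algebraMap A K t = s • y := by
    intro hcon
    let M : Submodule A K := Submodule.map (Algebra.linearMap A K) (I y)
    have hint : IsIntegral A y := by
      refine isIntegral_of_smul_mem_submodule (R := A) (A := K) M ?_ ?_ y ?_
      · intro h0
        have : algebraMap A K b ∈ M := ⟨b, hbI, rfl⟩
        rw [h0, Submodule.mem_bot] at this
        exact hbK this
      · exact (IsNoetherian.noetherian (I y)).map _
      · rintro _ ⟨s, hs, rfl⟩
        obtain ⟨t, ht, hts⟩ := hcon s hs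
        exact ⟨t, ht, by simp only [Algebra.linearMap_apply]; rw [hts, Algebra.smul_def, smul_eq_mul, mul_comm]⟩
    exact hr ((IsIntegrallyClosed.isIntegral_iff).mp hint)
  push Not at hnot
  obtain ⟨s, hs, hst⟩ := hnot
  obtain ⟨t, ht⟩ := (hI _ _).mp hs
  have htI : t ∉ I y := fun h => hst t h ht
  have hy0 : y ≠ 0 := by
    intro h0
    exact hr ⟨0, by rw [map_zero, ← h0]⟩
  -- Now `s * y = t` with `s` in `I y` and `t` outside. For `s'` in `I y` the product `s' * t` is a
  -- multiple of `s`, so any prime between `s` and `I y` contains `s'`. Krull's principal ideal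
  -- theorem then bounds the height by one, which contradicts the hypothesis at this prime.
  have hmin : I y ∈ (Ideal.span {s}).minimalPrimes := by
    refine ⟨⟨hprime, (Ideal.span_singleton_le_iff_mem _).mpr hs⟩, ?_⟩
    rintro Q ⟨hQ, hsQ⟩ hQI s' hs'
    obtain ⟨t', ht'⟩ := (hI _ _).mp hs'
    have h1 : s' * t = t' * s := by
      apply IsFractionRing.injective A K
      rw [map_mul, map_mul, ht, ht', Algebra.smul_def, Algebra.smul_def]
      ring
    have h2 : s' * t ∈ Q := h1 ▸ Q.mul_mem_left _ ((Ideal.span_singleton_le_iff_mem _).mp hsQ)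
    exact (hQ.mem_or_mem h2).resolve_right fun h => htI (hQI h)
  have hle := Ideal.height_le_one_of_isPrincipal_of_mem_minimalPrimes _ _ hmin
  have hne : (I y).height ≠ 0 := by
    intro h0
    rw [Ideal.height_eq_zero_iff] at h0
    have : (I y) = ⊥ := by
      rw [IsDomain.minimalPrimes_eq_singleton_bot] at h0
      exact h0
    rw [this] at hbI
    exact hb0 hbI
  have hone : (I y).height = 1 := le_antisymm hle (Order.one_le_iff_ne_zero.mpr hne)
  obtain ⟨s', hs', a', ha'⟩ := h _ hprime hone
  exact hs' ((hI _ _).mpr ⟨r * a', by rw [map_mul, ← ha', hy, smul_comm, Algebra.smul_def r]⟩)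

/-! ### Local rings and rings of sections inside the function field -/

namespace AlgebraicGeometry.Scheme

variable {X : Scheme.{u}} [IsIntegral X]

/-- The local ring at a point, as a subring of the function field. -/
noncomputable def locRing (x : X) : Subring X.functionField :=
  (algebraMap (X.presheaf.stalk x) X.functionField).range

/-- The ring of sections over a nonempty open set, as a subring of the function field. -/
noncomputable def secRing (U : X.Opens) [Nonempty U] : Subring X.functionField :=
  (X.germToFunctionField U).hom.range

lemma germ_mem_locRing {U : X.Opens} [Nonempty U] {x : X} (hx : x ∈ U) (s : Γ(X, U)) :
    X.germToFunctionField U s ∈ locRing x :=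
  ⟨X.presheaf.germ U x hx s, algebraMap_germ_eq_germToFunctionField X hx s⟩

lemma secRing_le_locRing {U : X.Opens} [Nonempty U] {x : X} (hx : x ∈ U) :
    secRing U ≤ locRing x := by
  rintro _ ⟨s, rfl⟩
  exact germ_mem_locRing hx s

lemma germToFunctionField_res {U V : X.Opens} [Nonempty U] [Nonempty V] (h : U ≤ V) (s : Γ(X, V)) :
    X.germToFunctionField U (X.presheaf.map (homOfLE h).op s) = X.germToFunctionField V s :=
  X.presheaf.germ_res_apply (homOfLE h) _ _ s

lemma exists_mem_secRing {x : X} {c : X.functionField} (hc : c ∈ locRing x) (W : X.Opens)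
    (hW : x ∈ W) : ∃ (U : X.Opens) (_ : Nonempty U), IsAffineOpen U ∧ x ∈ U ∧ U ≤ W ∧
      c ∈ secRing U := by
  obtain ⟨s, rfl⟩ := hc
  obtain ⟨V, hV, s, rfl⟩ := X.presheaf.exists_germ_eq s
  obtain ⟨_, ⟨U, hU, rfl⟩, hxU, hUV⟩ :=
    X.isBasis_affineOpens.exists_subset_of_mem_open (⟨hV, hW⟩ : x ∈ V ⊓ W) (V ⊓ W).isOpen
  have : Nonempty U := ⟨x, hxU⟩
  have : Nonempty V := ⟨x, hV⟩
  refine ⟨U, ‹_›, hU, hxU, fun y hy => (hUV hy).2, X.presheaf.map (homOfLE fun y hy => (hUV hy).1).op s, ?_⟩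
  rw [algebraMap_germ_eq_germToFunctionField X hV]
  exact germToFunctionField_res _ s

lemma mem_secRing_of_forall {U : X.Opens} [Nonempty U] {c : X.functionField}
    (h : ∀ x ∈ U, c ∈ locRing x) : c ∈ secRing U := by
  have h1 : ∀ x : U, ∃ (V : X.Opens) (_ : Nonempty V), x.1 ∈ V ∧ V ≤ U ∧ c ∈ secRing V := fun x => by
    obtain ⟨V, hV, -, h2, h3, h4⟩ := exists_mem_secRing (h x.1 x.2) U x.2
    exact ⟨V, hV, h2, h3, h4⟩
  choose V hVn hxV hVU hc using h1
  choose s hs using hc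
  obtain ⟨t, ht, -⟩ := X.sheaf.existsUnique_gluing' V U (fun x => homOfLE (hVU x))
    (fun x hx => Opens.mem_iSup.mpr ⟨⟨x, hx⟩, hxV ⟨x, hx⟩⟩) s (by
      intro x y
      have := hVn x
      have := hVn y
      have : Nonempty (V x ⊓ V y : X.Opens) := by
        refine ⟨⟨genericPoint X, ?_, ?_⟩⟩
        · exact ((genericPoint_spec X).mem_open_set_iff (V x).isOpen).mpr (by simpa using hVn x)
        · exact ((genericPoint_spec X).mem_open_set_iff (V y).isOpen).mpr (by simpa using hVn y)
      apply X.germToFunctionField_injective (V x ⊓ V y)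
      exact ((germToFunctionField_res inf_le_left (s x)).trans (hs x)).trans
        ((germToFunctionField_res inf_le_right (s y)).trans (hs y)).symm)
  refine ⟨t, ?_⟩
  let x : U := Classical.arbitrary U
  have := hVn x
  rw [← hs x, ← ht x]
  exact (germToFunctionField_res (hVU x) t).symm

lemma genericPoint_mem (U : X.Opens) [Nonempty U] : genericPoint X ∈ U :=
  ((genericPoint_spec X).mem_open_set_iff U.isOpen).mpr (by simpa using ‹Nonempty U›)

instance (U V : X.Opens) [Nonempty U] [Nonempty V] : Nonempty (U ⊓ V : X.Opens) :=
  ⟨⟨genericPoint X, genericPoint_mem U, genericPoint_mem V⟩⟩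

/-- Elements of local rings are fractions of sections. -/
lemma exists_fraction {U : X.Opens} [Nonempty U] (hU : IsAffineOpen U) {x : X} (hx : x ∈ U)
    {c : X.functionField} (hc : c ∈ locRing x) : ∃ a s : Γ(X, U),
      s ∉ (hU.primeIdealOf ⟨x, hx⟩).asIdeal ∧
      c = X.germToFunctionField U a / X.germToFunctionField U s := by
  obtain ⟨c, rfl⟩ := hc
  have := hU.isLocalization_stalk ⟨x, hx⟩
  let _ := TopCat.Presheaf.algebra_section_stalk X.presheaf (⟨x, hx⟩ : U)
  obtain ⟨⟨a, s⟩, h⟩ := IsLocalization.surj (hU.primeIdealOf ⟨x, hx⟩).asIdeal.primeCompl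
    (c : X.presheaf.stalk (⟨x, hx⟩ : U).1)
  refine ⟨a, s, s.2, ?_⟩
  rw [eq_div_iff]
  · have h2 := congrArg (algebraMap (X.presheaf.stalk x) X.functionField) h
    rw [map_mul] at h2
    have h3 : ∀ t : Γ(X, U), algebraMap (X.presheaf.stalk x) X.functionField
      (algebraMap Γ(X, U) (X.presheaf.stalk (⟨x, hx⟩ : U).1) t) = X.germToFunctionField U t :=
      fun t => algebraMap_germ_eq_germToFunctionField X hx t
    rwa [h3, h3] at h2
  · intro h0
    rw [map_eq_zero_iff _ (X.germToFunctionField_injective U)] at h0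
    exact s.2 (h0 ▸ zero_mem _)

lemma inv_mem_locRing {U : X.Opens} [Nonempty U] (hU : IsAffineOpen U) {x : X} (hx : x ∈ U)
    {s : Γ(X, U)} (hs : s ∉ (hU.primeIdealOf ⟨x, hx⟩).asIdeal) :
    (X.germToFunctionField U s)⁻¹ ∈ locRing x := by
  have := hU.isLocalization_stalk ⟨x, hx⟩
  let _ := TopCat.Presheaf.algebra_section_stalk X.presheaf (⟨x, hx⟩ : U)
  obtain ⟨u, hu⟩ := IsLocalization.map_units (X.presheaf.stalk (⟨x, hx⟩ : U).1)
    (⟨s, hs⟩ : (hU.primeIdealOf ⟨x, hx⟩).asIdeal.primeCompl)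
  have h3 : algebraMap (X.presheaf.stalk x) X.functionField u = X.germToFunctionField U s := by
    rw [hu]
    exact algebraMap_germ_eq_germToFunctionField X hx s
  refine ⟨((u⁻¹ : _ˣ) : X.presheaf.stalk x), ?_⟩
  rw [← h3]
  refine eq_inv_of_mul_eq_one_left ?_
  rw [← map_mul, Units.inv_mul, map_one]

lemma coheight_eq_height {U : X.Opens} (hU : IsAffineOpen U) {x : X} (hx : x ∈ U) :
    Order.coheight x = (hU.primeIdealOf ⟨x, hx⟩).asIdeal.height := by
  have := hU.isLocalization_stalk ⟨x, hx⟩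
  let _ := TopCat.Presheaf.algebra_section_stalk X.presheaf (⟨x, hx⟩ : U)
  have h := IsLocalization.AtPrime.ringKrullDim_eq_height (hU.primeIdealOf ⟨x, hx⟩).asIdeal
    (X.presheaf.stalk (⟨x, hx⟩ : U).1)
  have h2 := ringKrullDim_stalk_eq_coheight x
  exact WithBot.coe_injective (h2.symm.trans h)

end AlgebraicGeometry.Scheme

/-! ### Codimension one on varieties -/

namespace AlgebraicGeometry.Scheme

lemma exists_primeIdealOf_eq {X : Scheme.{u}} {U : X.Opens} (hU : IsAffineOpen U)
    (P : PrimeSpectrum Γ(X, U)) : ∃ x : U, hU.primeIdealOf x = P :=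
  ⟨hU.isoSpec.inv P, by
    refine (Scheme.Hom.comp_apply hU.isoSpec.inv hU.isoSpec.hom P).symm.trans ?_
    rw [Iso.inv_hom_id]; rfl⟩

lemma primeIdealOf_injective {X : Scheme.{u}} {U : X.Opens} (hU : IsAffineOpen U) :
    Function.Injective hU.primeIdealOf := fun x y h => by
  apply Subtype.ext
  rw [← hU.fromSpec_primeIdealOf x, h, hU.fromSpec_primeIdealOf]

lemma exists_affine_mem {X : Scheme.{u}} {x : X} {W : X.Opens} (hx : x ∈ W) :
    ∃ (U : X.Opens) (_ : Nonempty U), IsAffineOpen U ∧ x ∈ U ∧ U ≤ W := by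
  obtain ⟨_, ⟨U, hU, rfl⟩, hxU, hUW⟩ := X.isBasis_affineOpens.exists_subset_of_mem_open hx W.isOpen
  exact ⟨U, ⟨x, hxU⟩, hU, hxU, hUW⟩

end AlgebraicGeometry.Scheme

namespace Variety

variable {k : Type u} [Field k] {X : Variety k}

lemma mem_locRing_of_isIntegral [X.IsNormal] {R : Type u} [CommRing R] [Algebra R X.K]
    (x : X.toScheme) (hR : ∀ r, algebraMap R X.K r ∈ locRing x) {c : X.K} (hc : IsIntegral R c) :
    c ∈ locRing x := by
  have := IsNormal.isIntegrallyClosed (X := X) x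
  obtain ⟨P, hP, hPc⟩ := hc
  refine (IsIntegrallyClosed.isIntegral_iff (R := X.toScheme.presheaf.stalk x)).mp ?_
  choose l hl using hR
  have hlinj := IsFractionRing.injective (X.toScheme.presheaf.stalk x) X.K
  let L : R →+* X.toScheme.presheaf.stalk x :=
    { toFun := l
      map_one' := hlinj (by rw [hl, map_one, map_one])
      map_zero' := hlinj (by rw [hl, map_zero, map_zero])
      map_mul' := fun a b => hlinj (by rw [hl, map_mul, map_mul, hl, hl])
      map_add' := fun a b => hlinj (by rw [hl, map_add, map_add, hl, hl]) }
  refine ⟨P.map L, hP.map L, ?_⟩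
  rw [Polynomial.eval₂_map, ← hPc]
  congr 1
  exact RingHom.ext hl

lemma isIntegrallyClosed_section [X.IsNormal] {U : X.toScheme.Opens} [Nonempty U]
    (hU : IsAffineOpen U) : IsIntegrallyClosed Γ(X.toScheme, U) := by
  have := functionField_isFractionRing_of_isAffineOpen X.toScheme U hU
  rw [isIntegrallyClosed_iff X.K]
  intro c hc
  exact mem_secRing_of_forall fun x hx =>
    mem_locRing_of_isIntegral x (fun r => germ_mem_locRing hx r) hc

/-- A rational function on a normal variety that is regular in codimension one is regular. -/
lemma mem_locRing_of_codim_one [X.IsNormal] {U : X.toScheme.Opens} {c : X.K}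
    (h : ∀ x ∈ U, Order.coheight x = 1 → c ∈ locRing x) {x : X.toScheme} (hx : x ∈ U) :
    c ∈ locRing x := by
  obtain ⟨V, hVn, hV, hxV, hVU⟩ := exists_affine_mem hx
  have := functionField_isFractionRing_of_isAffineOpen X.toScheme V hV
  have := isIntegrallyClosed_section hV
  have : IsNoetherianRing Γ(X.toScheme, V) := IsLocallyNoetherian.component_noetherian ⟨V, hV⟩
  refine secRing_le_locRing hxV (exists_algebraMap_eq_of_height_one c fun P hP hP1 => ?_)
  obtain ⟨⟨y, hy⟩, hyP⟩ := exists_primeIdealOf_eq hV ⟨P, hP⟩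
  have hP' : (hV.primeIdealOf ⟨y, hy⟩).asIdeal = P := by rw [hyP]
  obtain ⟨a, s, hs, hc⟩ := exists_fraction hV hy
    (h y (hVU hy) (by rw [coheight_eq_height hV hy, hP', hP1]))
  refine ⟨s, hP' ▸ hs, a, ?_⟩
  have hs0 : X.toScheme.germToFunctionField V s ≠ 0 := by
    intro h0
    rw [map_eq_zero_iff _ (X.toScheme.germToFunctionField_injective V)] at h0
    exact hs (h0 ▸ zero_mem _)
  rw [hc, Algebra.smul_def]
  exact mul_div_cancel₀ _ hs0

lemma mem_secRing_of_codim_one [X.IsNormal] {U : X.toScheme.Opens} [Nonempty U] {c : X.K}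
    (h : ∀ x ∈ U, Order.coheight x = 1 → c ∈ locRing x) : c ∈ secRing U :=
  mem_secRing_of_forall fun _ hx => mem_locRing_of_codim_one h hx

lemma ord_one (x : X.toScheme) : X.toScheme.ord (1 : X.K) x = 0 := by
  have : Nonempty (⊤ : X.toScheme.Opens) := ⟨⟨x, trivial⟩⟩
  have := Scheme.ord_of_isUnit (X := X.toScheme) (U := ⊤)
    (f := (1 : Γ(X.toScheme, ⊤))) isUnit_one (x := x) trivial
  rwa [map_one] at this

lemma ordHom_eq (x : X.toScheme) (hx : Order.coheight x = 1) :
    haveI : Ring.KrullDimLE 1 (X.toScheme.presheaf.stalk x) := krullDimLE_of_coheight_le hx.le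
    ordHom x hx = Ring.ordFrac (K := X.K) (X.toScheme.presheaf.stalk x) := rfl

lemma ord_nonneg_iff [X.IsNormal] {x : X.toScheme} (hx : Order.coheight x = 1) {c : X.K}
    (hc : c ≠ 0) : 0 ≤ X.toScheme.ord c x ↔ c ∈ locRing x := by
  have := X.isDiscreteValuationRing_stalk x hx
  have : Ring.KrullDimLE 1 (X.toScheme.presheaf.stalk x) := krullDimLE_of_coheight_le hx.le
  have hle : ∀ a : X.toScheme.presheaf.stalk x, a ≠ 0 →
      0 ≤ X.toScheme.ord (algebraMap (X.toScheme.presheaf.stalk x) X.K a) x := fun a ha => by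
    rw [le_ord_iff hx ((map_ne_zero_iff _ (IsFractionRing.injective _ _)).mpr ha)]
    exact Ring.ordFrac_ge_one_of_ne_zero ha
  constructor
  · intro h
    rcases ValuationRing.isInteger_or_isInteger (X.toScheme.presheaf.stalk x) c with ⟨a, ha⟩ | ⟨a, ha⟩
    · exact ⟨a, ha⟩
    · have ha0 : a ≠ 0 := by
        rintro rfl
        rw [map_zero] at ha
        exact hc (inv_eq_zero.mp ha.symm)
      have h1 := hle a ha0
      have h2 : X.toScheme.ord c x + X.toScheme.ord (algebraMap (X.toScheme.presheaf.stalk x) X.K a) x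
          = 0 := by
        rw [← ord_mul hc (by rw [ha]; exact inv_ne_zero hc), ha, mul_inv_cancel₀ hc, ord_one]
      have h3 : X.toScheme.ord (algebraMap (X.toScheme.presheaf.stalk x) X.K a) x = 0 := by omega
      rw [ord_eq_iff hx (by rw [ha]; exact inv_ne_zero hc), ordHom_eq] at h3
      have hu := Ring.isUnit_iff_ordFrac_one_of_isDiscreteValuationRing.mpr h3
      refine ⟨((hu.unit⁻¹ : _ˣ) : X.toScheme.presheaf.stalk x), ?_⟩
      rw [← inv_inv c, ← ha]
      refine eq_inv_of_mul_eq_one_left ?_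
      rw [← map_mul, IsUnit.val_inv_mul, map_one]
  · rintro ⟨a, rfl⟩
    exact hle a (by rintro rfl; simp at hc)

lemma ord_inv {x : X.toScheme} {c : X.K} (hc : c ≠ 0) :
    X.toScheme.ord c⁻¹ x = - X.toScheme.ord c x := by
  have h := ord_mul (X := X.toScheme) (x := x) hc (inv_ne_zero hc)
  rw [mul_inv_cancel₀ hc, ord_one] at h
  omega

lemma exists_ord_eq_one [X.IsNormal] {x : X.toScheme} (hx : Order.coheight x = 1) :
    ∃ t : X.K, t ≠ 0 ∧ X.toScheme.ord t x = 1 := by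
  have := X.isDiscreteValuationRing_stalk x hx
  have : Ring.KrullDimLE 1 (X.toScheme.presheaf.stalk x) := krullDimLE_of_coheight_le hx.le
  obtain ⟨t, ht⟩ := IsDiscreteValuationRing.exists_irreducible (X.toScheme.presheaf.stalk x)
  have h0 : algebraMap (X.toScheme.presheaf.stalk x) X.K t ≠ 0 :=
    (map_ne_zero_iff _ (IsFractionRing.injective _ _)).mpr ht.ne_zero
  refine ⟨_, h0, ?_⟩
  rw [ord_eq_iff hx h0, ordHom_eq]
  exact Ring.ordFrac_irreducible ht

lemma ord_pow {x : X.toScheme} {c : X.K} (hc : c ≠ 0) (n : ℕ) :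
    X.toScheme.ord (c ^ n) x = n * X.toScheme.ord c x := by
  induction n with
  | zero => simp [ord_one]
  | succ n ih => rw [pow_succ, ord_mul (pow_ne_zero _ hc) hc, ih]; push_cast; ring

lemma exists_ord_eq [X.IsNormal] {x : X.toScheme} (hx : Order.coheight x = 1) (n : ℤ) :
    ∃ t : X.K, t ≠ 0 ∧ X.toScheme.ord t x = n := by
  obtain ⟨t, ht, h1⟩ := exists_ord_eq_one hx
  obtain ⟨n, rfl | rfl⟩ := n.eq_nat_or_neg
  · exact ⟨t ^ n, pow_ne_zero _ ht, by rw [ord_pow ht, h1, mul_one]⟩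
  · exact ⟨(t ^ n)⁻¹, inv_ne_zero (pow_ne_zero _ ht),
      by rw [ord_inv (pow_ne_zero _ ht), ord_pow ht, h1, mul_one]⟩

/-- `φ` satisfies the condition `div φ + D ≥ 0` at the prime divisor `x`. -/
def MemDivAt (D : X.WeilDivisor) (x : X.PrimeDivisor) (φ : X.K) : Prop :=
  φ ≠ 0 → 0 ≤ X.toScheme.ord φ x.1 + D x

lemma memDivAt_iff [X.IsNormal] {D : X.WeilDivisor} {x : X.PrimeDivisor} {t : X.K} (ht : t ≠ 0)
    (h : X.toScheme.ord t x.1 = D x) (φ : X.K) : MemDivAt D x φ ↔ t * φ ∈ locRing x.1 := by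
  by_cases hφ : φ = 0
  · subst hφ
    simp [MemDivAt, zero_mem]
  · rw [← ord_nonneg_iff x.2 (mul_ne_zero ht hφ), ord_mul ht hφ, h]
    simp [MemDivAt, hφ, add_comm]

lemma memDivAt_zero_iff [X.IsNormal] {x : X.PrimeDivisor} (φ : X.K) :
    MemDivAt 0 x φ ↔ φ ∈ locRing x.1 := by
  by_cases hφ : φ = 0
  · subst hφ
    simp [MemDivAt, zero_mem]
  · rw [← ord_nonneg_iff x.2 hφ]
    simp [MemDivAt, hφ]

lemma memDivAt_of_mem_locRing [X.IsNormal] {D : X.WeilDivisor} (hD : 0 ≤ D) {x : X.PrimeDivisor}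
    {φ : X.K} (h : φ ∈ locRing x.1) : MemDivAt D x φ := fun h0 =>
  add_nonneg ((ord_nonneg_iff x.2 h0).mpr h) (hD x)

lemma mem_sectionsO_iff [X.IsNormal] {D : X.WeilDivisor} {U : X.toScheme.Opens} [Nonempty U]
    {φ : X.K} : φ ∈ X.sectionsO D U ↔ ∀ x : X.PrimeDivisor, x.1 ∈ U → MemDivAt D x φ :=
  ⟨fun h x hx h0 => h h0 x hx, fun h h0 x hx => h x hx h0⟩

lemma mem_minimalPrimes_of_height_one {A : Type*} [CommRing A] [IsDomain A] {P : Ideal A}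
    [hP : P.IsPrime] (h : P.height = 1) {s : A} (hs : s ≠ 0) (hsP : s ∈ P) :
    P ∈ (Ideal.span {s}).minimalPrimes := by
  refine ⟨⟨hP, (Ideal.span_singleton_le_iff_mem _).mpr hsP⟩, ?_⟩
  rintro Q ⟨hQ, hsQ⟩ hQP
  by_contra hne
  have hlt : Q < P := lt_of_le_not_ge hQP hne
  have : (Q.height) + 1 ≤ P.height := by
    have := Ideal.height_add_one_le_of_lt_of_isPrime hlt
    exact this
  rw [h] at this
  have h0 : Q.height = 0 := by
    have h1 : Q.height + 1 ≤ 0 + 1 := by simpa using this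
    have := (ENat.add_le_add_iff_right ENat.one_ne_top).mp h1
    simpa using this
  rw [Ideal.height_eq_zero_iff, IsDomain.minimalPrimes_eq_singleton_bot] at h0
  rw [Set.mem_singleton_iff.mp h0] at hsQ
  exact hs (by simpa using hsQ)

lemma eq_of_specializes_of_coheight_one {x y : X.toScheme} (hx : Order.coheight x = 1)
    (hy : Order.coheight y = 1) (h : y ⤳ x) : y = x := by
  by_contra hne
  have hlt : x < y := lt_of_le_not_ge h fun h' => hne (h.antisymm h').eq
  have := Order.coheight_strictAnti hlt (by rw [hy]; exact ENat.natCast_lt_top 1)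
  rw [hx, hy] at this
  exact lt_irrefl _ this

-- Written as `a / s` on an affine neighbourhood, `φ` can have poles only along the finitely many
-- prime divisors that contain `s`. Removing the closures of those other than `x` leaves a
-- neighbourhood where the condition can fail only at `x`; away from `x`, effectivity of `D` makes
-- regularity sufficient.
open Classical in
lemma exists_mem_sectionsO [X.IsNormal] {D : X.WeilDivisor} (hD : 0 ≤ D) {x : X.PrimeDivisor}
    {φ : X.K} (h : MemDivAt D x φ) (W : X.toScheme.Opens) (hW : x.1 ∈ W) :
    ∃ (V : X.toScheme.Opens) (_ : Nonempty V), IsAffineOpen V ∧ x.1 ∈ V ∧ V ≤ W ∧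
      φ ∈ X.sectionsO D V := by
  obtain ⟨U, hUn, hU, hxU, hUW⟩ := exists_affine_mem hW
  have := functionField_isFractionRing_of_isAffineOpen X.toScheme U hU
  have : IsNoetherianRing Γ(X.toScheme, U) := IsLocallyNoetherian.component_noetherian ⟨U, hU⟩
  obtain ⟨a, s, hs, rfl⟩ := IsFractionRing.div_surjective Γ(X.toScheme, U) φ
  have hs0 := nonZeroDivisors.ne_zero hs
  let B : Set X.toScheme := {y | ∃ hy : y ∈ U, Order.coheight y = 1 ∧
    s ∈ (hU.primeIdealOf ⟨y, hy⟩).asIdeal ∧ y ≠ x.1}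
  have hB : B.Finite := by
    have hfin := Ideal.finite_minimalPrimes_of_isNoetherianRing Γ(X.toScheme, U) (Ideal.span {s})
    refine Set.Finite.of_finite_image (f := fun y : X.toScheme =>
      if hy : y ∈ U then (hU.primeIdealOf ⟨y, hy⟩).asIdeal else ⊥) (hfin.subset ?_) ?_
    · rintro _ ⟨y, ⟨hy, hy1, hys, -⟩, rfl⟩
      beta_reduce
      rw [dif_pos hy]
      rw [coheight_eq_height hU hy] at hy1
      exact mem_minimalPrimes_of_height_one hy1 hs0 hys
    · rintro y ⟨hy, -⟩ z ⟨hz, -⟩ hyz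
      beta_reduce at hyz
      rw [dif_pos hy, dif_pos hz] at hyz
      exact congrArg Subtype.val (primeIdealOf_injective hU (PrimeSpectrum.ext hyz))
  let C : Set X.toScheme := ⋃ y ∈ B, closure {y}
  have hC : IsClosed C := hB.isClosed_biUnion fun y _ => isClosed_closure
  have hxC : x.1 ∉ C := by
    intro hx
    obtain ⟨y, hy, hyx⟩ := Set.mem_iUnion₂.mp hx
    exact hy.choose_spec.2.2 (eq_of_specializes_of_coheight_one x.2 hy.choose_spec.1
      (specializes_iff_mem_closure.mpr hyx))
  obtain ⟨V, hVn, hV, hxV, hVU⟩ :=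
    exists_affine_mem (x := x.1) (W := U ⊓ ⟨Cᶜ, hC.isOpen_compl⟩) ⟨hxU, hxC⟩
  refine ⟨V, hVn, hV, hxV, fun y hy => hUW (hVU hy).1, mem_sectionsO_iff.mpr fun y hy => ?_⟩
  by_cases hyx : y = x
  · rwa [hyx]
  refine memDivAt_of_mem_locRing hD ?_
  have hyU : y.1 ∈ U := (hVU hy).1
  rw [div_eq_mul_inv]
  refine mul_mem (germ_mem_locRing hyU a) (inv_mem_locRing hU hyU fun hsy => (hVU hy).2 ?_)
  exact Set.mem_biUnion (show y.1 ∈ B from ⟨hyU, y.2, hsy, fun h => hyx (Subtype.ext h)⟩)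
    (subset_closure rfl)

end Variety

/-! ### The homomorphism of function fields of a dominant morphism -/

namespace AlgebraicGeometry.Scheme

variable {X Y Z : Scheme.{u}} [IsIntegral X] [IsIntegral Y] [IsIntegral Z]

/-- The homomorphism of function fields of a morphism that preserves the generic point. -/
noncomputable def Hom.fsharp (f : X ⟶ Z) (hf : f (genericPoint X) = genericPoint Z) :
    Z.functionField →+* X.functionField :=
  (Z.presheaf.stalkSpecializes (specializes_of_eq hf) ≫ f.stalkMap (genericPoint X)).hom

lemma nonempty_preimage {f : X ⟶ Z} (hf : f (genericPoint X) = genericPoint Z) (U : Z.Opens)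
    [Nonempty U] : Nonempty (f ⁻¹ᵁ U) :=
  ⟨⟨genericPoint X, by
    change f (genericPoint X) ∈ U
    rw [hf]
    exact genericPoint_mem U⟩⟩

lemma fsharp_germ {f : X ⟶ Z} (hf : f (genericPoint X) = genericPoint Z) {U : Z.Opens}
    [Nonempty U] [Nonempty (f ⁻¹ᵁ U)] (s : Γ(Z, U)) :
    f.fsharp hf (Z.germToFunctionField U s) = X.germToFunctionField (f ⁻¹ᵁ U) (f.app U s) := by
  have h1 := Z.presheaf.germ_stalkSpecializes_apply (genericPoint_mem U) (specializes_of_eq hf) s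
  have h2 := Hom.germ_stalkMap_apply f U (genericPoint X) (genericPoint_mem (f ⁻¹ᵁ U)) s
  exact (congrArg (f.stalkMap (genericPoint X)) h1).trans h2

lemma fsharp_algebraMap {f : X ⟶ Z} (hf : f (genericPoint X) = genericPoint Z) (x : X)
    (c : Z.presheaf.stalk (f x)) :
    f.fsharp hf (algebraMap _ Z.functionField c) = algebraMap _ X.functionField (f.stalkMap x c) := by
  obtain ⟨U, hU, s, rfl⟩ := Z.presheaf.exists_germ_eq c
  have : Nonempty U := ⟨⟨_, hU⟩⟩
  have : Nonempty (f ⁻¹ᵁ U) := nonempty_preimage hf U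
  rw [algebraMap_germ_eq_germToFunctionField, fsharp_germ,
    Hom.germ_stalkMap_apply f U x hU s]
  exact (algebraMap_germ_eq_germToFunctionField X (x := x) (U := f ⁻¹ᵁ U) hU _).symm

lemma fsharp_mem_locRing {f : X ⟶ Z} (hf : f (genericPoint X) = genericPoint Z) {x : X}
    {c : Z.functionField} (hc : c ∈ locRing (f x)) : f.fsharp hf c ∈ locRing x := by
  obtain ⟨c, rfl⟩ := hc
  exact ⟨_, (fsharp_algebraMap hf x c).symm⟩

lemma exists_germToFunctionField_eq (c : X.functionField) :
    ∃ (U : X.Opens) (_ : Nonempty U) (s : Γ(X, U)), X.germToFunctionField U s = c := by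
  obtain ⟨U, hU, s, rfl⟩ := X.presheaf.exists_germ_eq c
  exact ⟨U, ⟨⟨_, hU⟩⟩, s, rfl⟩

lemma fsharp_comp {g : X ⟶ Y} {h : Y ⟶ Z} (hg : g (genericPoint X) = genericPoint Y)
    (hh : h (genericPoint Y) = genericPoint Z)
    (hgh : (g ≫ h) (genericPoint X) = genericPoint Z) (c : Z.functionField) :
    (g ≫ h).fsharp hgh c = g.fsharp hg (h.fsharp hh c) := by
  obtain ⟨U, hU, s, rfl⟩ := exists_germToFunctionField_eq c
  have : Nonempty (h ⁻¹ᵁ U) := nonempty_preimage hh U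
  have : Nonempty (g ⁻¹ᵁ (h ⁻¹ᵁ U)) := nonempty_preimage hg _
  have : Nonempty ((g ≫ h) ⁻¹ᵁ U) := nonempty_preimage hgh U
  rw [fsharp_germ, fsharp_germ, fsharp_germ, Hom.comp_app]
  rfl

end AlgebraicGeometry.Scheme

/-! ### The relative Frobenius morphism -/

/-- The universal property of `S' = S ⊗[R] R'`, with `R` acting on `Q` through `a`. For `b` a power
of Frobenius, the hypothesis on `θ` is root-linearity. -/
lemma exists_lift_of_isPushout {R S R' S' : CommRingCat.{u}} {a : R ⟶ S} {b : R ⟶ R'} {i : S ⟶ S'}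
    {j : R' ⟶ S'} (h : IsPushout a b i j) {Q : Type*} [AddCommGroup Q] [Module S Q] (θ : R' →+ Q)
    (hθ : ∀ r x, θ (b r * x) = a r • θ x) :
    ∃ Ψ : S' →+ Q, ∀ s x, Ψ (i s * j x) = s • θ x := by
  algebraize [a.hom, b.hom, i.hom, j.hom, (a ≫ i).hom]
  have : IsScalarTower R S S' := .of_algebraMap_eq' rfl
  have : IsScalarTower R R' S' := .of_algebraMap_eq' (congrArg CommRingCat.Hom.hom h.w)
  have hP : Algebra.IsPushout R S R' S' := CommRingCat.isPushout_iff_isPushout.mp h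
  let _ : Module R Q := Module.compHom Q (algebraMap R S)
  have : IsScalarTower R S Q := ⟨fun r s q => by
    rw [Algebra.smul_def, mul_smul]; rfl⟩
  let θ' : R' →ₗ[R] Q :=
    { θ with
      map_smul' := fun r x => by
        change θ (r • x) = a r • θ x
        rw [Algebra.smul_def]
        exact hθ r x }
  refine ⟨(hP.out.lift θ').toAddMonoidHom, fun s x => ?_⟩
  have h1 := hP.out.lift_eq θ' x
  have h2 := (hP.out.lift θ').map_smul s ((IsScalarTower.toAlgHom R R' S').toLinearMap x)
  rw [h1, Algebra.smul_def] at h2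
  exact h2

lemma induction_of_isPushout {R S R' S' : CommRingCat.{u}} {a : R ⟶ S} {b : R ⟶ R'} {i : S ⟶ S'}
    {j : R' ⟶ S'} (h : IsPushout a b i j) {motive : S' → Prop} (w : S')
    (mul : ∀ s x, motive (i s * j x)) (add : ∀ x y, motive x → motive y → motive (x + y)) :
    motive w := by
  algebraize [a.hom, b.hom, i.hom, j.hom, (a ≫ i).hom]
  have : IsScalarTower R S S' := .of_algebraMap_eq' rfl
  have : IsScalarTower R R' S' := .of_algebraMap_eq' (congrArg CommRingCat.Hom.hom h.w)
  have hP : Algebra.IsPushout R S R' S' := CommRingCat.isPushout_iff_isPushout.mp h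
  have key : ∀ w : S', ∀ s, motive (i s * w) := fun w => by
    refine hP.out.inductionOn w (fun w => ∀ s, motive (i s * w)) ?_ ?_ ?_ ?_
    · intro s
      simpa using mul 0 0
    · exact fun x s => mul s x
    · intro s w hw s'
      rw [Algebra.smul_def, ← mul_assoc]
      have := hw (s' * s)
      rwa [map_mul] at this
    · intro w w' hw hw' s
      rw [mul_add]
      exact add _ _ (hw s) (hw' s)
  simpa using key w 1

namespace AlgebraicGeometry.Scheme

lemma absFrob_appLE (X : Scheme.{u}) (p e : ℕ) [Fact p.Prime] [X.IsCharP p] (U : X.Opens)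
    (h : U ≤ X.absFrob p e ⁻¹ᵁ U) (a : Γ(X, U)) :
    (X.absFrob p e).appLE U U h a = a ^ p ^ e := by
  have h1 : (X.absFrob p e).app U a = a ^ p ^ e := rfl
  rw [Hom.appLE]
  refine (CategoryTheory.comp_apply _ _ _).trans ?_
  erw [h1]
  exact congrArg (fun φ => φ.hom (a ^ p ^ e)) (X.presheaf.map_id (Opposite.op U))

end AlgebraicGeometry.Scheme

namespace Variety

variable {k : Type u} [Field k] {X Z : Variety k} (p e : ℕ) [Fact p.Prime] [CharP k p]
  (f : X.toScheme ⟶ Z.toScheme)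

/-- The projection from the Frobenius base change. -/
noncomputable abbrev frobFst : frobBaseChange p e f ⟶ X.toScheme := pullback.fst _ _

/-- The projection from the Frobenius base change to the base. -/
noncomputable abbrev frobSnd : frobBaseChange p e f ⟶ Z.toScheme := pullback.snd _ _

instance : (frobBaseChange p e f).IsCharP p where
  natCast_eq_zero := by
    rw [← map_natCast (frobFst p e f).appTop.hom p, IsCharP.natCast_eq_zero, map_zero]

lemma relFrob_fst : relFrob p e f ≫ frobFst p e f = X.toScheme.absFrob p e :=
  pullback.lift_fst _ _ _

lemma relFrob_snd : relFrob p e f ≫ frobSnd p e f = f :=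
  pullback.lift_snd _ _ _

/-- In both orders the composition of the projection with the relative Frobenius is an absolute
Frobenius, the identity on points. The two maps are therefore inverse homeomorphisms, and the open
sets of the base change are the preimages of those of `X`. -/
lemma fst_relFrob : frobFst p e f ≫ relFrob p e f = (frobBaseChange p e f).absFrob p e := by
  apply pullback.hom_ext
  · rw [Category.assoc, relFrob_fst, Scheme.absFrob_comm]
  · rw [Category.assoc, relFrob_snd, Scheme.absFrob_comm, pullback.condition]

lemma fst_relFrob_apply (x : X.toScheme) : frobFst p e f (relFrob p e f x) = x := by
  rw [← Scheme.Hom.comp_apply, relFrob_fst]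
  rfl

lemma relFrob_fst_apply (w : frobBaseChange p e f) : relFrob p e f (frobFst p e f w) = w := by
  rw [← Scheme.Hom.comp_apply, fst_relFrob]
  rfl

lemma fst_preimage_relFrob (W : (frobBaseChange p e f).Opens) :
    frobFst p e f ⁻¹ᵁ (relFrob p e f ⁻¹ᵁ W) = W := by
  ext w
  change relFrob p e f (frobFst p e f w) ∈ W ↔ w ∈ W
  rw [relFrob_fst_apply]

lemma relFrob_preimage_fst (V : X.toScheme.Opens) :
    relFrob p e f ⁻¹ᵁ (frobFst p e f ⁻¹ᵁ V) = V := by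
  ext w
  change frobFst p e f (relFrob p e f w) ∈ V ↔ w ∈ V
  rw [fst_relFrob_apply]

lemma fst_preimage_le {V : X.toScheme.Opens} {T : Z.toScheme.Opens} (h : V ≤ f ⁻¹ᵁ T) :
    frobFst p e f ⁻¹ᵁ V ≤ frobSnd p e f ⁻¹ᵁ T := fun w hw => by
  have h1 : f (frobFst p e f w) ∈ T := h hw
  rw [← Scheme.Hom.comp_apply, pullback.condition] at h1
  exact h1

instance (V : X.toScheme.Opens) [hV : Nonempty V] :
    Nonempty (relFrob p e f ⁻¹ᵁ (frobFst p e f ⁻¹ᵁ V)) := by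
  rw [relFrob_preimage_fst]
  exact hV

lemma isPushout_sections {V : X.toScheme.Opens} {T : Z.toScheme.Opens} (hV : IsAffineOpen V)
    (hT : IsAffineOpen T) (h : V ≤ f ⁻¹ᵁ T) :
    IsPushout (f.appLE T V h) ((Z.toScheme.absFrob p e).appLE T T le_rfl)
      ((frobFst p e f).appLE V (frobFst p e f ⁻¹ᵁ V) le_rfl)
      ((frobSnd p e f).appLE T (frobFst p e f ⁻¹ᵁ V) (fst_preimage_le p e f h)) :=
  (isIso_pushoutSection_iff (IsPullback.of_hasPullback f (Z.toScheme.absFrob p e)) (US := T)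
    (UT := T) (UX := V) (UY := frobFst p e f ⁻¹ᵁ V) le_rfl h
    (le_antisymm (le_inf le_rfl (fst_preimage_le p e f h)) inf_le_left)).mp
    (isIso_pushoutSection_of_isAffineOpen _ _ _ _ hT hT hV)

/-- Restriction of functions on the Frobenius base change to the generic point. -/
noncomputable def frobGerm (W : (frobBaseChange p e f).Opens) [Nonempty (relFrob p e f ⁻¹ᵁ W)] :
    Γ(frobBaseChange p e f, W) →+* X.K :=
  ((relFrob p e f).app W ≫ X.toScheme.germToFunctionField (relFrob p e f ⁻¹ᵁ W)).hom

lemma frobGerm_apply (W : (frobBaseChange p e f).Opens) [Nonempty (relFrob p e f ⁻¹ᵁ W)]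
    (w : Γ(frobBaseChange p e f, W)) : frobGerm p e f W w =
      X.toScheme.germToFunctionField (relFrob p e f ⁻¹ᵁ W) ((relFrob p e f).app W w) := rfl

lemma frobGerm_res {W W' : (frobBaseChange p e f).Opens} [Nonempty (relFrob p e f ⁻¹ᵁ W)]
    [Nonempty (relFrob p e f ⁻¹ᵁ W')] (h : W' ≤ W) (w : Γ(frobBaseChange p e f, W)) :
    frobGerm p e f W' ((frobBaseChange p e f).presheaf.map (homOfLE h).op w) =
      frobGerm p e f W w := by
  rw [frobGerm_apply, frobGerm_apply]
  have h1 := congrArg (fun φ => φ.hom w) ((relFrob p e f).naturality (homOfLE h).op)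
  refine (congrArg (X.toScheme.germToFunctionField (relFrob p e f ⁻¹ᵁ W')) h1).trans ?_
  exact germToFunctionField_res ((relFrob p e f).preimage_mono h) _

lemma germToFunctionField_appLE {S : Scheme.{u}} (a : X.toScheme ⟶ S) {U : S.Opens}
    {V : X.toScheme.Opens} [Nonempty V] [Nonempty (a ⁻¹ᵁ U)] (h : V ≤ a ⁻¹ᵁ U) (s : Γ(S, U)) :
    X.toScheme.germToFunctionField V (a.appLE U V h s) =
      X.toScheme.germToFunctionField (a ⁻¹ᵁ U) (a.app U s) :=
  germToFunctionField_res h _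

variable {f} in
lemma frobGerm_appLE {S : Scheme.{u}} {a : frobBaseChange p e f ⟶ S} {b : X.toScheme ⟶ S}
    (hb : relFrob p e f ≫ a = b) {U : S.Opens} {W : (frobBaseChange p e f).Opens}
    [Nonempty (relFrob p e f ⁻¹ᵁ W)] [Nonempty (b ⁻¹ᵁ U)] (h : W ≤ a ⁻¹ᵁ U) (s : Γ(S, U)) :
    frobGerm p e f W (a.appLE U W h s) = X.toScheme.germToFunctionField (b ⁻¹ᵁ U) (b.app U s) := by
  subst hb
  have : Nonempty (relFrob p e f ⁻¹ᵁ (a ⁻¹ᵁ U)) := ‹Nonempty ((relFrob p e f ≫ a) ⁻¹ᵁ U)›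
  exact frobGerm_res p e f h _

/-- Together with `frobGerm_snd`: the tensor `c ⊗ t` restricts to `c ^ q` times the pullback of `t`,
with `q = p ^ e`. -/
lemma frobGerm_fst {V : X.toScheme.Opens} [hV : Nonempty V] (c : Γ(X.toScheme, V)) :
    frobGerm p e f (frobFst p e f ⁻¹ᵁ V) ((frobFst p e f).appLE V _ le_rfl c) =
      X.toScheme.germToFunctionField V c ^ p ^ e := by
  have : Nonempty (X.toScheme.absFrob p e ⁻¹ᵁ V) := hV
  rw [frobGerm_appLE p e (relFrob_fst p e f), ← map_pow]
  rfl

variable {f} in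
lemma frobGerm_snd (hf : f (genericPoint X.toScheme) = genericPoint Z.toScheme)
    {V : X.toScheme.Opens} [Nonempty V] {T : Z.toScheme.Opens} [Nonempty T] (h : V ≤ f ⁻¹ᵁ T)
    (t : Γ(Z.toScheme, T)) :
    frobGerm p e f (frobFst p e f ⁻¹ᵁ V)
      ((frobSnd p e f).appLE T _ (fst_preimage_le p e f h) t) =
      f.fsharp hf (Z.toScheme.germToFunctionField T t) := by
  have : Nonempty (f ⁻¹ᵁ T) := nonempty_preimage hf T
  rw [frobGerm_appLE p e (relFrob_snd p e f), fsharp_germ]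

end Variety

/-! ### From a compatible root-linear map to a splitting -/

section FrameSum

variable {M K : Type*} [Field M] [Field K] (q : ℕ) (φ : M →+* K) (τ : AddMonoid.End K)

/-- The expansion of `x` with respect to a dual frame of the base field. -/
def frameSum {ι : Type} [Fintype ι] (v : M) (b b' : ι → M) (x : K) : K :=
  ∑ i, τ (φ (v * b' i) * x) ^ q * φ (b i)

variable {q φ τ} {T : AddMonoid.End M} {ι : Type} [Fintype ι] {v : M} {b b' : ι → M}

lemma frameSum_pow_mul (hτ : RootLinear q τ) (c x : K) :
    frameSum q φ τ v b b' (c ^ q * x) = c ^ q * frameSum q φ τ v b b' x := by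
  simp_rw [frameSum, mul_left_comm _ (c ^ q) x, hτ _ _, mul_pow, mul_assoc, Finset.mul_sum]

variable (p e : ℕ) [Fact p.Prime] [CharP K p]

lemma frameSum_zero : frameSum (p ^ e) φ τ v b b' 0 = 0 := by
  simp [frameSum, (Fact.out : p.Prime).ne_zero]

lemma frameSum_add (x y : K) : frameSum (p ^ e) φ τ v b b' (x + y) =
    frameSum (p ^ e) φ τ v b b' x + frameSum (p ^ e) φ τ v b b' y := by
  simp_rw [frameSum, mul_add, map_add, add_pow_char_pow, add_mul, Finset.sum_add_distrib]

variable {p e}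

/-- Expanding `t * b' i` in the frame `b'` and `t * b j` in the frame `b` produces the same
coefficients `T (v * t * b j * b' i)`. With `frameSum_pow_mul` this makes the frame sum linear over
`q`-th powers and over the base field, hence over the functions on the Frobenius base change. -/
lemma frameSum_map_mul (hτ : RootLinear (p ^ e) τ)
    (hb : IsDualFrame (p ^ e) (scaleEnd T v) b b') (t : M) (x : K) :
    frameSum (p ^ e) φ τ v b b' (φ t * x) = φ t * frameSum (p ^ e) φ τ v b b' x := by
  have h1 : ∀ i, τ (φ (v * b' i) * (φ t * x)) =
      ∑ j, φ (scaleEnd T v (t * b j * b' i)) * τ (φ (v * b' j) * x) := fun i => by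
    have h2 := hb.right (t * b' i)
    have h3 : φ (v * b' i) * (φ t * x) = ∑ j, φ (scaleEnd T v (t * b j * b' i)) ^ p ^ e *
        (φ (v * b' j) * x) := by
      have : φ (v * b' i) * (φ t * x) = φ v * φ (t * b' i) * x := by
        rw [map_mul, map_mul]; ring
      rw [this]
      nth_rw 1 [← h2]
      rw [map_sum, Finset.mul_sum, Finset.sum_mul]
      refine Finset.sum_congr rfl fun j _ => ?_
      rw [map_mul, map_pow, map_mul φ v, show t * b' i * b j = t * b j * b' i by ring]
      ring
    rw [h3, map_sum]
    exact Finset.sum_congr rfl fun j _ => hτ _ _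
  simp_rw [frameSum, h1, sum_pow_char_pow, Finset.sum_mul]
  rw [Finset.sum_comm, Finset.mul_sum]
  refine Finset.sum_congr rfl fun j _ => ?_
  have h4 := congrArg φ (hb.left (t * b j))
  rw [map_sum, map_mul] at h4
  rw [mul_left_comm, ← h4, Finset.mul_sum]
  refine Finset.sum_congr rfl fun i _ => ?_
  simp only [map_mul φ, map_pow φ]
  ring

lemma frameSum_one (hφ : ∀ m, τ (φ m) = φ (T m)) (hb : IsDualFrame q (scaleEnd T v) b b') :
    frameSum q φ τ v b b' 1 = 1 := by
  have h := congrArg φ (hb.left 1)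
  rw [map_one, map_sum] at h
  refine Eq.trans (Finset.sum_congr rfl fun i _ => ?_) h
  rw [mul_one, hφ, map_mul φ, map_pow φ, scaleEnd_apply, one_mul]

/-- The frame sum does not depend on the generator and the frame, so the local frames of different
charts define one and the same map. -/
lemma frameSum_frame (hτ : RootLinear (p ^ e) τ)
    (hv : v ≠ 0) (hb : IsDualFrame (p ^ e) (scaleEnd T v) b b')
    {κ : Type} [Fintype κ] {w : M} {c c' : κ → M} (hw : w ≠ 0)
    (hc : IsDualFrame (p ^ e) (scaleEnd T w) c c') (x : K) :
    frameSum (p ^ e) φ τ w c c' x = frameSum (p ^ e) φ τ v b b' x := by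
  have h1 : ∀ j, τ (φ (v * b' j) * x) =
      ∑ i, φ (scaleEnd T v (c i * b' j)) * τ (φ (w * c' i) * x) := fun j => by
    have h2 := congrArg (fun m => φ (w * m) * x) (hc.right (v * b' j / w))
    beta_reduce at h2
    rw [mul_div_cancel₀ _ hw, Finset.mul_sum, map_sum, Finset.sum_mul] at h2
    rw [← h2, map_sum]
    refine Finset.sum_congr rfl fun i _ => ?_
    have h3 : w * (v * b' j / w * c i) = v * (c i * b' j) := by field_simp
    rw [mul_left_comm, map_mul φ, map_pow φ, mul_assoc, hτ, scaleEnd_apply, scaleEnd_apply, h3]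
  simp_rw [frameSum, h1, sum_pow_char_pow, Finset.sum_mul]
  rw [Finset.sum_comm]
  refine Finset.sum_congr rfl fun i _ => ?_
  have h4 := congrArg φ (hb.left (c i))
  rw [map_sum] at h4
  nth_rw 1 [← h4]
  rw [Finset.mul_sum]
  refine Finset.sum_congr rfl fun j _ => ?_
  simp only [map_mul φ, map_pow φ]
  ring

end FrameSum

/-! ### Split traces and functions on the Frobenius base change. -/

namespace Variety

variable {k : Type u} [Field k]

/-- Every point has an affine neighbourhood over which a multiple of `T` is a trace. -/
def HasTraceCharts (Z : Variety k) (q : ℕ) (T : AddMonoid.End Z.K) : Prop :=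
  ∀ z : Z.toScheme, ∃ (U : Z.toScheme.Opens) (_ : Nonempty U), IsAffineOpen U ∧ z ∈ U ∧
    ∃ v, IsTraceOn q (scaleEnd T v) (secRing U)

variable {X Z : Variety k}

lemma _root_.IsTraceOn.locRing {q : ℕ} (hq : q ≠ 0) {T : AddMonoid.End Z.K} {U : Z.toScheme.Opens}
    [Nonempty U] (hU : IsAffineOpen U) {z : Z.toScheme} (hz : z ∈ U)
    (hT : IsTraceOn q T (secRing U)) : IsTraceOn q T (locRing z) := by
  refine hT.of_fraction hq (secRing_le_locRing hz) fun r hr => ?_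
  obtain ⟨a, s, hs, rfl⟩ := exists_fraction hU hz hr
  refine ⟨_, ⟨a, rfl⟩, _, ⟨s, rfl⟩, fun h0 => ?_, inv_mem_locRing hU hz hs, rfl⟩
  have h1 := (map_eq_zero_iff _ (Z.toScheme.germToFunctionField_injective U)).mp h0
  exact hs (h1 ▸ zero_mem _)

/-- A root-linear map on the function field of `X` that induces a splitting of the relative
Frobenius morphism. -/
structure IsSplitTrace [X.IsNormal] (q : ℕ) (f : X.toScheme ⟶ Z.toScheme)
    (hf : f (genericPoint X.toScheme) = genericPoint Z.toScheme) (D : X.WeilDivisor)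
    (T : AddMonoid.End Z.K) (τ : AddMonoid.End X.K) : Prop where
  rootLinear : RootLinear q τ
  map_fsharp : ∀ m, τ (f.fsharp hf m) = f.fsharp hf (T m)
  mem : ∀ (x : X.PrimeDivisor) (v : Z.K), IsTraceOn q (scaleEnd T v) (locRing (f x.1)) →
    ∀ φ, MemDivAt D x φ → τ (f.fsharp hf v * φ) ∈ locRing x.1

lemma MemDivAt.mul [X.IsNormal] {D : X.WeilDivisor} {x : X.PrimeDivisor} {φ c : X.K}
    (h : MemDivAt D x φ) (hc : c ∈ locRing x.1) : MemDivAt D x (c * φ) := by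
  obtain ⟨t, ht, ht'⟩ := exists_ord_eq x.2 (D x)
  rw [memDivAt_iff ht ht'] at h ⊢
  rw [mul_left_comm]
  exact mul_mem hc h

instance (X : Variety k) (p : ℕ) [CharP k p] : CharP X.K p :=
  charP_of_injective_algebraMap (algebraMap k X.K).injective p

variable (p e : ℕ) [hp : Fact p.Prime] [CharP k p] {f : X.toScheme ⟶ Z.toScheme}

section Expansion

variable (hf : f (genericPoint X.toScheme) = genericPoint Z.toScheme)
  {V : X.toScheme.Opens} [Nonempty V] {U : Z.toScheme.Opens} [Nonempty U]
  {T : AddMonoid.End Z.K} {ι : Type} [Fintype ι] {b b' : ι → Γ(Z.toScheme, U)}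

/-- The frame expands `t` as `∑ r i ^ q * b i`, with `q = p ^ e`, and the `q`-th powers cross the
tensor product as the pullbacks of the `r i`. -/
lemma exists_expansion (hV : IsAffineOpen V) (hU : IsAffineOpen U) (h : V ≤ f ⁻¹ᵁ U)
    (hT : ∀ r ∈ secRing U, T r ∈ secRing U)
    (hb : IsDualFrame (p ^ e) T (fun i => Z.toScheme.germToFunctionField U (b i))
      fun i => Z.toScheme.germToFunctionField U (b' i))
    (w : Γ(frobBaseChange p e f, frobFst p e f ⁻¹ᵁ V)) :
    ∃ c : ι → Γ(X.toScheme, V), w = ∑ i, (frobFst p e f).appLE V _ le_rfl (c i) *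
      (frobSnd p e f).appLE U _ (fst_preimage_le p e f h) (b i) := by
  have hpo := isPushout_sections p e f hV hU h
  refine induction_of_isPushout hpo
    (motive := fun w => ∃ c : ι → Γ(X.toScheme, V), w = ∑ i, (frobFst p e f).appLE V _ le_rfl (c i) *
      (frobSnd p e f).appLE U _ (fst_preimage_le p e f h) (b i)) w (fun s t => ?_) ?_
  · have hr : ∀ i, ∃ r : Γ(Z.toScheme, U), Z.toScheme.germToFunctionField U r =
        T (Z.toScheme.germToFunctionField U t * Z.toScheme.germToFunctionField U (b' i)) :=
      fun i => hT _ (mul_mem ⟨t, rfl⟩ ⟨b' i, rfl⟩)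
    choose r hr using hr
    have ht : t = ∑ i, r i ^ p ^ e * b i := by
      apply Z.toScheme.germToFunctionField_injective U
      rw [map_sum, ← hb.left (Z.toScheme.germToFunctionField U t)]
      refine Finset.sum_congr rfl fun i _ => ?_
      rw [map_mul (Z.toScheme.germToFunctionField U).hom, map_pow (Z.toScheme.germToFunctionField U).hom, hr]
    refine ⟨fun i => s * f.appLE U V h (r i), ?_⟩
    rw [ht, map_sum, Finset.mul_sum]
    refine Finset.sum_congr rfl fun i _ => ?_
    rw [map_mul, map_mul, mul_assoc]
    congr 2
    rw [← absFrob_appLE Z.toScheme p e U le_rfl]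
    exact congrArg (fun φ => φ.hom (r i)) hpo.w.symm
  · rintro _ _ ⟨c, rfl⟩ ⟨d, rfl⟩
    refine ⟨c + d, ?_⟩
    simp_rw [Pi.add_apply, map_add, add_mul, Finset.sum_add_distrib]

lemma frobGerm_expansion (h : V ≤ f ⁻¹ᵁ U) (c : ι → Γ(X.toScheme, V)) :
    frobGerm p e f (frobFst p e f ⁻¹ᵁ V) (∑ i, (frobFst p e f).appLE V _ le_rfl (c i) *
      (frobSnd p e f).appLE U _ (fst_preimage_le p e f h) (b i)) =
    ∑ i, X.toScheme.germToFunctionField V (c i) ^ p ^ e *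
      f.fsharp hf (Z.toScheme.germToFunctionField U (b i)) := by
  rw [map_sum]
  refine Finset.sum_congr rfl fun i _ => ?_
  rw [map_mul, frobGerm_fst, frobGerm_snd p e hf h]

end Expansion

end Variety

namespace Variety

variable {k : Type u} [Field k] {X Z : Variety k} [X.IsNormal] {p e : ℕ} [hp : Fact p.Prime]
  [CharP k p] {f : X.toScheme ⟶ Z.toScheme}
  {hf : f (genericPoint X.toScheme) = genericPoint Z.toScheme}
  {D : X.WeilDivisor} {T : AddMonoid.End Z.K} {τ : AddMonoid.End X.K}

lemma exists_frame_sections {q : ℕ} {U : Z.toScheme.Opens} [Nonempty U] {T : AddMonoid.End Z.K}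
    (hT : IsTraceOn q T (secRing U)) : ∃ (ι : Type) (_ : Fintype ι) (b b' : ι → Γ(Z.toScheme, U)),
      IsDualFrame q T (fun i => Z.toScheme.germToFunctionField U (b i))
        fun i => Z.toScheme.germToFunctionField U (b' i) := by
  obtain ⟨ι, _, b, b', hb, hb', hd⟩ := hT.exists_frame
  choose c hc using hb
  choose c' hc' using hb'
  refine ⟨ι, ‹_›, c, c', ?_⟩
  convert hd using 1
  · exact funext hc
  · exact funext hc'

/-- A split trace recovers enough of the function `∑ c i ⊗ b i` from its restriction `∑ c i ^ q * b
i`, with `q = p ^ e`: applying `τ` after multiplication by the dual frame shows that the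
coefficients of its re-expansion in the frame vanish. -/
lemma frobGerm_injective_of_le (hτ : IsSplitTrace (p ^ e) f hf D T τ) {V : X.toScheme.Opens}
    [Nonempty V] (hV : IsAffineOpen V) {U : Z.toScheme.Opens} [Nonempty U] (hU : IsAffineOpen U)
    (h : V ≤ f ⁻¹ᵁ U) {v : Z.K} (hT : IsTraceOn (p ^ e) (scaleEnd T v) (secRing U)) :
    Function.Injective (frobGerm p e f (frobFst p e f ⁻¹ᵁ V)) := by
  rw [injective_iff_map_eq_zero]
  intro w hw
  obtain ⟨ι, _, b, b', hd⟩ := exists_frame_sections hT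
  have hpo := isPushout_sections p e f hV hU h
  obtain ⟨c, rfl⟩ := exists_expansion p e hV hU h hT.map_mem hd w
  rw [frobGerm_expansion p e hf h] at hw
  have hr : ∀ i j, ∃ r : Γ(Z.toScheme, U), Z.toScheme.germToFunctionField U r =
      scaleEnd T v (Z.toScheme.germToFunctionField U (b i) *
        Z.toScheme.germToFunctionField U (b' j)) :=
    fun i j => hT.map_mem _ (mul_mem ⟨b i, rfl⟩ ⟨b' j, rfl⟩)
  choose r hr using hr
  have : Nonempty (f ⁻¹ᵁ U) := nonempty_preimage hf U
  have hfr : ∀ t, f.fsharp hf (Z.toScheme.germToFunctionField U t) =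
      X.toScheme.germToFunctionField V (f.appLE U V h t) := fun t => by
    rw [fsharp_germ, germToFunctionField_appLE]
  have h1 : ∀ j, ∑ i, c i * f.appLE U V h (r i j) = 0 := fun j => by
    apply X.toScheme.germToFunctionField_injective V
    have h2 := congrArg (fun x => τ (f.fsharp hf (v * Z.toScheme.germToFunctionField U (b' j)) * x)) hw
    simp only [mul_zero, map_zero, Finset.mul_sum, map_sum] at h2
    rw [map_sum, map_zero, ← h2]
    refine Finset.sum_congr rfl fun i _ => ?_
    rw [mul_left_comm, hτ.rootLinear, ← map_mul (f.fsharp hf), hτ.map_fsharp,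
      map_mul (X.toScheme.germToFunctionField V).hom, ← hfr, hr, scaleEnd_apply]
    congr 3
    ring
  -- The frame need not be independent over the `p ^ e`-th powers, so the `c i` themselves need not
  -- vanish. Re-expanding each `b i` in the frame turns the coefficients into the sums that vanish
  -- by `h1`.
  have hb : ∀ i, b i = ∑ j, r i j ^ p ^ e * b j := fun i => by
    apply Z.toScheme.germToFunctionField_injective U
    rw [map_sum, ← hd.left (Z.toScheme.germToFunctionField U (b i))]
    refine Finset.sum_congr rfl fun j _ => ?_
    rw [map_mul (Z.toScheme.germToFunctionField U).hom,
      map_pow (Z.toScheme.germToFunctionField U).hom, hr]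
  have h3 : ∀ s : Γ(Z.toScheme, U), (frobSnd p e f).appLE U _ (fst_preimage_le p e f h) (s ^ p ^ e) =
      (frobFst p e f).appLE V _ le_rfl (f.appLE U V h s) := fun s => by
    rw [← absFrob_appLE Z.toScheme p e U le_rfl]
    exact congrArg (fun φ => φ.hom s) hpo.w.symm
  have h4 : ∀ i, (frobSnd p e f).appLE U _ (fst_preimage_le p e f h) (b i) =
      ∑ j, (frobFst p e f).appLE V _ le_rfl (f.appLE U V h (r i j)) *
        (frobSnd p e f).appLE U _ (fst_preimage_le p e f h) (b j) := fun i => by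
    nth_rw 1 [hb i]
    rw [map_sum]
    refine Finset.sum_congr rfl fun j _ => ?_
    rw [map_mul, h3]
  refine (Finset.sum_congr rfl fun i _ => (congrArg _ (h4 i)).trans
    (Finset.mul_sum _ _ _)).trans ?_
  rw [Finset.sum_comm]
  refine Finset.sum_eq_zero fun j _ => ?_
  have h5 := congrArg ((frobFst p e f).appLE V _ le_rfl) (h1 j)
  rw [map_zero, map_sum] at h5
  refine Eq.trans ?_ (zero_mul ((frobSnd p e f).appLE U _ (fst_preimage_le p e f h) (b j)))
  rw [← h5, Finset.sum_mul]
  refine Finset.sum_congr rfl fun i _ => ?_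
  rw [map_mul, mul_assoc]

/-- In a frame adapted to `U` the coefficients of the frame sum are regular at all codimension one
points of `V`, by the integrality condition of a split trace, hence regular on `V` by normality. So
the frame sum comes from a function on the base change. -/
lemma exists_frobGerm_eq_of_le (hτ : IsSplitTrace (p ^ e) f hf D T τ) {V : X.toScheme.Opens}
    [Nonempty V] {U : Z.toScheme.Opens} [Nonempty U] (hU : IsAffineOpen U)
    (h : V ≤ f ⁻¹ᵁ U) {v : Z.K} (hT : IsTraceOn (p ^ e) (scaleEnd T v) (secRing U))
    {ι : Type} [Fintype ι] {v₀ : Z.K} (hv₀ : v₀ ≠ 0) {b b' : ι → Z.K}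
    (hb : IsDualFrame (p ^ e) (scaleEnd T v₀) b b') {φ : X.K}
    (hφ : ∀ x : X.PrimeDivisor, x.1 ∈ V → MemDivAt D x φ) :
    ∃ w, frobGerm p e f (frobFst p e f ⁻¹ᵁ V) w = frameSum (p ^ e) (f.fsharp hf) τ v₀ b b' φ := by
  obtain ⟨ι, _, c, c', hd⟩ := exists_frame_sections hT
  have hpe : p ^ e ≠ 0 := pow_ne_zero _ hp.out.ne_zero
  rw [← frameSum_frame hτ.rootLinear hv₀ hb hT.scale_ne_zero hd]
  have hs : ∀ i, τ (f.fsharp hf (v * Z.toScheme.germToFunctionField U (c' i)) * φ) ∈ secRing V := by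
    intro i
    refine mem_secRing_of_codim_one fun x hx hx1 => ?_
    rw [map_mul (f.fsharp hf), mul_assoc]
    exact hτ.mem ⟨x, hx1⟩ v (hT.locRing hpe hU (h hx)) _ ((hφ ⟨x, hx1⟩ hx).mul
      (fsharp_mem_locRing hf (germ_mem_locRing (show f x ∈ U from h hx) _)))
  choose s hs using hs
  refine ⟨∑ i, (frobFst p e f).appLE V _ le_rfl (s i) *
      (frobSnd p e f).appLE U _ (fst_preimage_le p e f h) (c i), ?_⟩
  rw [frobGerm_expansion p e hf h]
  refine Finset.sum_congr rfl fun i _ => ?_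
  rw [hs]

/-- Good affine neighbourhoods of points of an open set. -/
lemma exists_good_affine (hc : Z.HasTraceCharts (p ^ e) T) (V : X.toScheme.Opens) (x : V) :
    ∃ (V' : X.toScheme.Opens) (_ : Nonempty V') (U : Z.toScheme.Opens) (_ : Nonempty U),
      IsAffineOpen V' ∧ IsAffineOpen U ∧ x.1 ∈ V' ∧ V' ≤ V ∧ V' ≤ f ⁻¹ᵁ U ∧
        ∃ v, IsTraceOn (p ^ e) (scaleEnd T v) (secRing U) := by
  obtain ⟨U, hUn, hU, hxU, v, hv⟩ := hc (f x.1)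
  obtain ⟨V', hV'n, hV', hxV', hle⟩ := exists_affine_mem (x := x.1) (W := V ⊓ f ⁻¹ᵁ U) ⟨x.2, hxU⟩
  exact ⟨V', hV'n, U, hUn, hV', hU, hxV', hle.trans inf_le_left, hle.trans inf_le_right, v, hv⟩

lemma fst_preimage_le_of_le (W : (frobBaseChange p e f).Opens) {V : X.toScheme.Opens}
    (h : V ≤ relFrob p e f ⁻¹ᵁ W) : frobFst p e f ⁻¹ᵁ V ≤ W := by
  conv_rhs => rw [← fst_preimage_relFrob p e f W]
  exact (frobFst p e f).preimage_mono h

lemma frobGerm_injective (hc : Z.HasTraceCharts (p ^ e) T) (hτ : IsSplitTrace (p ^ e) f hf D T τ)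
    (W : (frobBaseChange p e f).Opens) [Nonempty (relFrob p e f ⁻¹ᵁ W)] :
    Function.Injective (frobGerm p e f W) := by
  intro w w' hw
  choose V hVn U hUn hV hU hxV hVW hVU v hv using
    exists_good_affine (f := f) hc (relFrob p e f ⁻¹ᵁ W)
  refine (frobBaseChange p e f).sheaf.eq_of_locally_eq' (fun x => frobFst p e f ⁻¹ᵁ V x) W
    (fun x => homOfLE (fst_preimage_le_of_le W (hVW x))) (fun y hy => Opens.mem_iSup.mpr ?_) _ _ ?_
  · have hy' : frobFst p e f y ∈ relFrob p e f ⁻¹ᵁ W := by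
      change relFrob p e f (frobFst p e f y) ∈ W
      rwa [relFrob_fst_apply]
    exact ⟨⟨_, hy'⟩, hxV ⟨_, hy'⟩⟩
  · intro x
    have := hVn x
    have := hUn x
    apply frobGerm_injective_of_le hτ (hV x) (hU x) (hVU x) (hv x)
    refine (frobGerm_res p e f (fst_preimage_le_of_le W (hVW x)) w).trans (hw.trans ?_)
    exact (frobGerm_res p e f (fst_preimage_le_of_le W (hVW x)) w').symm

lemma exists_frobGerm_eq (hc : Z.HasTraceCharts (p ^ e) T) (hτ : IsSplitTrace (p ^ e) f hf D T τ)
    {ι : Type} [Fintype ι] {v₀ : Z.K} (hv₀ : v₀ ≠ 0) {b b' : ι → Z.K}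
    (hb : IsDualFrame (p ^ e) (scaleEnd T v₀) b b')
    (W : (frobBaseChange p e f).Opens) [Nonempty (relFrob p e f ⁻¹ᵁ W)]
    (φ : X.sectionsO D (relFrob p e f ⁻¹ᵁ W)) :
    ∃ w, frobGerm p e f W w = frameSum (p ^ e) (f.fsharp hf) τ v₀ b b' φ.1 := by
  choose V hVn U hUn hV hU hxV hVW hVU v hv using
    exists_good_affine (f := f) hc (relFrob p e f ⁻¹ᵁ W)
  have hs : ∀ x, ∃ s, frobGerm p e f (frobFst p e f ⁻¹ᵁ V x) s =
      frameSum (p ^ e) (f.fsharp hf) τ v₀ b b' φ.1 := fun x => by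
    have := hUn x
    exact exists_frobGerm_eq_of_le hτ (hU x) (hVU x) (hv x) hv₀ hb
      fun y hy => mem_sectionsO_iff.mp φ.2 y (hVW x hy)
  choose s hs using hs
  obtain ⟨t, ht, -⟩ := (frobBaseChange p e f).sheaf.existsUnique_gluing'
    (fun x => frobFst p e f ⁻¹ᵁ V x) W
    (fun x => homOfLE (fst_preimage_le_of_le W (hVW x))) (fun y hy => Opens.mem_iSup.mpr (by
      have hy' : frobFst p e f y ∈ relFrob p e f ⁻¹ᵁ W := by
        change relFrob p e f (frobFst p e f y) ∈ W
        rwa [relFrob_fst_apply]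
      exact ⟨⟨_, hy'⟩, hxV ⟨_, hy'⟩⟩)) s (by
      intro x y
      have := hVn x
      have := hVn y
      have hne : Nonempty (relFrob p e f ⁻¹ᵁ (frobFst p e f ⁻¹ᵁ (V x ⊓ V y))) := inferInstance
      have : Nonempty (relFrob p e f ⁻¹ᵁ (frobFst p e f ⁻¹ᵁ V x ⊓ frobFst p e f ⁻¹ᵁ V y)) := hne
      apply frobGerm_injective hc hτ (frobFst p e f ⁻¹ᵁ V x ⊓ frobFst p e f ⁻¹ᵁ V y)
      exact ((frobGerm_res p e f inf_le_left (s x)).trans (hs x)).trans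
        ((frobGerm_res p e f inf_le_right (s y)).trans (hs y)).symm)
  refine ⟨t, ?_⟩
  obtain ⟨x⟩ := id ‹Nonempty (relFrob p e f ⁻¹ᵁ W)›
  have := hVn x
  rw [← hs x, ← ht x]
  exact (frobGerm_res p e f (fst_preimage_le_of_le W (hVW x)) t).symm

/-- On a small affine open set `r` becomes a sum of products of `p ^ e`-th powers with elements of
the base field, and the frame sum commutes with both kinds of factors. -/
lemma frameSum_frobGerm_mul (hc : Z.HasTraceCharts (p ^ e) T) (hτ : IsSplitTrace (p ^ e) f hf D T τ)
    {ι : Type} [Fintype ι] {v₀ : Z.K} {b b' : ι → Z.K}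
    (hb : IsDualFrame (p ^ e) (scaleEnd T v₀) b b')
    (W : (frobBaseChange p e f).Opens) [Nonempty (relFrob p e f ⁻¹ᵁ W)]
    (r : Γ(frobBaseChange p e f, W)) (φ : X.K) :
    frameSum (p ^ e) (f.fsharp hf) τ v₀ b b' (frobGerm p e f W r * φ) =
      frobGerm p e f W r * frameSum (p ^ e) (f.fsharp hf) τ v₀ b b' φ := by
  obtain ⟨x⟩ := id ‹Nonempty (relFrob p e f ⁻¹ᵁ W)›
  obtain ⟨V, hVn, U, hUn, hV, hU, hxV, hVW, hVU, v, hv⟩ :=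
    exists_good_affine (f := f) hc (relFrob p e f ⁻¹ᵁ W) x
  rw [← frobGerm_res p e f (fst_preimage_le_of_le W hVW)]
  obtain ⟨κ, _, c, c', hd⟩ := exists_frame_sections hv
  obtain ⟨s, hs⟩ := exists_expansion p e hV hU hVU hv.map_mem hd
    ((frobBaseChange p e f).presheaf.map (homOfLE (fst_preimage_le_of_le W hVW)).op r)
  rw [hs, frobGerm_expansion p e hf hVU, Finset.sum_mul, Finset.sum_mul]
  let F : X.K →+ X.K := ⟨⟨frameSum (p ^ e) (f.fsharp hf) τ v₀ b b', frameSum_zero p e⟩,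
    frameSum_add p e⟩
  have hF : ∀ x, frameSum (p ^ e) (f.fsharp hf) τ v₀ b b' x = F x := fun _ => rfl
  rw [hF, map_sum]
  refine Finset.sum_congr rfl fun i _ => ?_
  rw [← hF, mul_assoc, frameSum_pow_mul hτ.rootLinear, frameSum_map_mul hτ.rootLinear hb,
    mul_assoc]

/-- A compatible root-linear map on the function field gives a splitting. -/
theorem nonempty_relFrobSplitting (hD : 0 ≤ D) (hc : Z.HasTraceCharts (p ^ e) T)
    (hτ : IsSplitTrace (p ^ e) f hf D T τ) :
    Nonempty (RelFrobSplitting p e f D hD) := by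
  obtain ⟨U, hUn, hU, -, v, hv⟩ := hc (genericPoint Z.toScheme)
  obtain ⟨ι, _, b, b', -, -, hb⟩ := hv.exists_frame
  have hv0 := hv.scale_ne_zero
  have hex := fun (W : (frobBaseChange p e f).Opens) [Nonempty (relFrob p e f ⁻¹ᵁ W)]
    (φ : X.sectionsO D (relFrob p e f ⁻¹ᵁ W)) => exists_frobGerm_eq hc hτ hv0 hb W φ
  choose s hs using hex
  exact ⟨{
    toFun := fun W _ =>
      { toFun := s W
        map_zero' := frobGerm_injective hc hτ W (by
          rw [hs, map_zero]
          exact frameSum_zero p e)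
        map_add' := fun φ ψ => frobGerm_injective hc hτ W (by
          rw [map_add, hs, hs, hs]
          exact frameSum_add p e _ _) }
    map_smul := fun W _ r φ => frobGerm_injective hc hτ W (by
      rw [map_mul]
      exact (hs W _).trans ((frameSum_frobGerm_mul hc hτ hb W r φ.1).trans
        (congrArg (frobGerm p e f W r * ·) (hs W φ).symm)))
    map_res := fun W W' _ _ h φ => frobGerm_injective hc hτ W' (by
      rw [frobGerm_res p e f h]
      exact (hs W' _).trans (hs W φ).symm)
    map_one := fun W _ => frobGerm_injective hc hτ W (by
      rw [map_one]
      exact (hs W _).trans (frameSum_one hτ.map_fsharp hb)) }⟩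

end Variety

/-! ### From a splitting to a compatible root-linear map -/

lemma exists_rootLinear_extension {A K : Type*} [CommRing A] [IsDomain A] [Field K] [Algebra A K]
    [IsFractionRing A K] {q : ℕ} (hq : q ≠ 0) (τ₀ : A →+ K)
    (h : ∀ r x, τ₀ (r ^ q * x) = algebraMap A K r * τ₀ x) :
    ∃ τ : AddMonoid.End K, RootLinear q τ ∧ ∀ a, τ (algebraMap A K a) = τ₀ a := by
  obtain ⟨n, rfl⟩ : ∃ n, q = n + 1 := ⟨q - 1, by omega⟩
  have hinj := IsFractionRing.injective A K
  have h0 : ∀ {s : A}, s ≠ 0 → algebraMap A K s ≠ 0 := fun hs => (map_ne_zero_iff _ hinj).mpr hs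
  have hfrac : ∀ x : K, ∃ a s : A, s ≠ 0 ∧ x = algebraMap A K a / algebraMap A K s := fun x => by
    obtain ⟨a, s, hs, rfl⟩ := IsFractionRing.div_surjective A x
    exact ⟨a, s, nonZeroDivisors.ne_zero hs, rfl⟩
  choose num den hden hx using hfrac
  -- Root-linearity forces this value, since `x = num * den ^ (q - 1) / den ^ q`; here `n = q - 1`.
  let F : K → K := fun x => τ₀ (num x * den x ^ n) / algebraMap A K (den x)
  have hF : ∀ a s : A, s ≠ 0 → F (algebraMap A K a / algebraMap A K s) =
      τ₀ (a * s ^ n) / algebraMap A K s := fun a s hs => by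
    set x := algebraMap A K a / algebraMap A K s with hxd
    have h1 : num x * s = a * den x := by
      apply hinj
      have h2 : algebraMap A K a / algebraMap A K s = algebraMap A K (num x) / algebraMap A K (den x) :=
        hx x
      rw [div_eq_div_iff (h0 hs) (h0 (hden x))] at h2
      rw [map_mul, map_mul, h2]
    change τ₀ (num x * den x ^ n) / algebraMap A K (den x) = _
    rw [div_eq_div_iff (h0 (hden x)) (h0 hs), mul_comm, ← h, mul_comm (τ₀ _), ← h]
    congr 1
    calc s ^ (n + 1) * (num x * den x ^ n) = (num x * s) * (s ^ n * den x ^ n) := by ring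
      _ = _ := by rw [h1]; ring
  refine ⟨⟨⟨F, ?_⟩, fun x y => ?_⟩, fun r x => ?_, fun a => ?_⟩
  · have := hF 0 1 one_ne_zero
    simpa using this
  · obtain ⟨a, s, hs, rfl⟩ : ∃ a s : A, s ≠ 0 ∧ x = algebraMap A K a / algebraMap A K s :=
      ⟨_, _, hden x, hx x⟩
    obtain ⟨b, t, ht, rfl⟩ : ∃ a s : A, s ≠ 0 ∧ y = algebraMap A K a / algebraMap A K s :=
      ⟨_, _, hden y, hx y⟩
    have h1 : algebraMap A K a / algebraMap A K s + algebraMap A K b / algebraMap A K t =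
        algebraMap A K (a * t + s * b) / algebraMap A K (s * t) := by
      rw [div_add_div _ _ (h0 hs) (h0 ht)]
      simp only [map_add, map_mul]
    change F _ = F _ + F _
    rw [h1, hF _ _ (mul_ne_zero hs ht), hF _ _ hs, hF _ _ ht, div_add_div _ _ (h0 hs) (h0 ht),
      ← map_mul, mul_comm (τ₀ _), ← h, ← h, ← map_add]
    congr 2
    ring
  · obtain ⟨a, s, hs, rfl⟩ : ∃ a s : A, s ≠ 0 ∧ x = algebraMap A K a / algebraMap A K s :=
      ⟨_, _, hden x, hx x⟩
    obtain ⟨b, t, ht, rfl⟩ : ∃ a s : A, s ≠ 0 ∧ r = algebraMap A K a / algebraMap A K s :=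
      ⟨_, _, hden r, hx r⟩
    have h1 : (algebraMap A K b / algebraMap A K t) ^ (n + 1) * (algebraMap A K a / algebraMap A K s) =
        algebraMap A K (b ^ (n + 1) * a) / algebraMap A K (t ^ (n + 1) * s) := by
      rw [div_pow, div_mul_div_comm]
      simp only [map_pow, map_mul]
    change F _ = _ * F _
    have h2 : b ^ (n + 1) * a * (t ^ (n + 1) * s) ^ n = (b * t ^ n) ^ (n + 1) * (a * s ^ n) := by
      ring
    rw [h1, hF _ _ (mul_ne_zero (pow_ne_zero _ ht) hs), hF _ _ hs, h2, h]
    have := h0 ht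
    have := h0 hs
    simp only [map_mul, map_pow]
    field_simp
    ring
  · have := hF a 1 one_ne_zero
    rw [map_one, div_one, div_one, one_pow, mul_one] at this
    exact this

namespace Variety

variable {k : Type u} [Field k] {X Z : Variety k} {p e : ℕ} [hp : Fact p.Prime]
  [CharP k p] {f : X.toScheme ⟶ Z.toScheme}

/-! ### The pairing of functions on the base change with the trace of the base. -/

section Pairing

variable (hf : f (genericPoint X.toScheme) = genericPoint Z.toScheme)
  {V V' : X.toScheme.Opens} [Nonempty V] [Nonempty V'] {U U' : Z.toScheme.Opens} [Nonempty U]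
  [Nonempty U'] {T : AddMonoid.End Z.K}

lemma pairing_induction (hV : IsAffineOpen V) (hU : IsAffineOpen U)
    (h : V ≤ f ⁻¹ᵁ U) {motive : Γ(frobBaseChange p e f, frobFst p e f ⁻¹ᵁ V) → Prop}
    (w) (hmul : ∀ c t, motive ((frobFst p e f).appLE V _ le_rfl c *
        (frobSnd p e f).appLE U _ (fst_preimage_le p e f h) t))
    (hadd : ∀ x y, motive x → motive y → motive (x + y)) : motive w :=
  induction_of_isPushout (isPushout_sections p e f hV hU h) w hmul hadd

/-- The prescription `c ⊗ t ↦ c * T (m * t)` respects the tensor relation because a `p ^ e`-th power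
leaves `T` as its root. -/
lemma exists_pairing (hV : IsAffineOpen V) (hU : IsAffineOpen U) (h : V ≤ f ⁻¹ᵁ U)
    (hT : RootLinear (p ^ e) T) (m : Z.K) :
    ∃ Ψ : Γ(frobBaseChange p e f, frobFst p e f ⁻¹ᵁ V) →+ X.K,
      ∀ c t, Ψ ((frobFst p e f).appLE V _ le_rfl c *
        (frobSnd p e f).appLE U _ (fst_preimage_le p e f h) t) =
      X.toScheme.germToFunctionField V c *
        f.fsharp hf (T (m * Z.toScheme.germToFunctionField U t)) := by
  have : Nonempty (f ⁻¹ᵁ U) := nonempty_preimage hf U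
  refine exists_lift_of_isPushout (isPushout_sections p e f hV hU h) (Q := X.K)
    ((f.fsharp hf).toAddMonoidHom.comp (T.comp ((AddMonoidHom.mulLeft m).comp
      (Z.toScheme.germToFunctionField U).hom.toAddMonoidHom))) (fun r x => ?_)
  change f.fsharp hf (T (m * Z.toScheme.germToFunctionField U _)) =
    X.toScheme.germToFunctionField V (f.appLE U V h r) *
      f.fsharp hf (T (m * Z.toScheme.germToFunctionField U _))
  refine (congrArg (fun a => f.fsharp hf (T (m * Z.toScheme.germToFunctionField U (a * x))))
    (absFrob_appLE Z.toScheme p e U le_rfl r)).trans ?_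
  rw [map_mul (Z.toScheme.germToFunctionField U).hom,
    map_pow (Z.toScheme.germToFunctionField U).hom, mul_left_comm, hT, map_mul (f.fsharp hf),
    fsharp_germ, germToFunctionField_appLE]

/-- The pairing of functions on the Frobenius base change with a multiple of `T`. -/
noncomputable def pairing (hV : IsAffineOpen V) (hU : IsAffineOpen U) (h : V ≤ f ⁻¹ᵁ U)
    (hT : RootLinear (p ^ e) T) (m : Z.K) :
    Γ(frobBaseChange p e f, frobFst p e f ⁻¹ᵁ V) →+ X.K :=
  (exists_pairing hf hV hU h hT m).choose

variable (hV : IsAffineOpen V) (hU : IsAffineOpen U) (h : V ≤ f ⁻¹ᵁ U)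
  (hT : RootLinear (p ^ e) T) (m : Z.K)

lemma pairing_apply (c : Γ(X.toScheme, V)) (t : Γ(Z.toScheme, U)) :
    pairing hf hV hU h hT m ((frobFst p e f).appLE V _ le_rfl c *
        (frobSnd p e f).appLE U _ (fst_preimage_le p e f h) t) =
      X.toScheme.germToFunctionField V c *
        f.fsharp hf (T (m * Z.toScheme.germToFunctionField U t)) :=
  (exists_pairing hf hV hU h hT m).choose_spec c t

lemma pairing_one : pairing hf hV hU h hT m 1 = f.fsharp hf (T m) := by
  have := pairing_apply hf hV hU h hT m 1 1
  rwa [map_one, map_one, map_one, map_one, mul_one, mul_one, one_mul] at this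

lemma pairing_fst_mul (c : Γ(X.toScheme, V)) (w) :
    pairing hf hV hU h hT m ((frobFst p e f).appLE V _ le_rfl c * w) =
      X.toScheme.germToFunctionField V c * pairing hf hV hU h hT m w := by
  refine pairing_induction hV hU h (motive := fun w =>
    pairing hf hV hU h hT m ((frobFst p e f).appLE V _ le_rfl c * w) =
      X.toScheme.germToFunctionField V c * pairing hf hV hU h hT m w) w (fun d t => ?_)
    fun x y hx hy => ?_
  · rw [← mul_assoc, ← map_mul, pairing_apply, pairing_apply,
      map_mul (X.toScheme.germToFunctionField V).hom, mul_assoc]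
  · rw [mul_add, map_add, map_add, hx, hy, mul_add]

lemma pairing_snd_mul (t : Γ(Z.toScheme, U)) (w) :
    pairing hf hV hU h hT m ((frobSnd p e f).appLE U _ (fst_preimage_le p e f h) t * w) =
      pairing hf hV hU h hT (m * Z.toScheme.germToFunctionField U t) w := by
  refine pairing_induction hV hU h (motive := fun w =>
    pairing hf hV hU h hT m ((frobSnd p e f).appLE U _ (fst_preimage_le p e f h) t * w) =
      pairing hf hV hU h hT (m * Z.toScheme.germToFunctionField U t) w) w (fun d t => ?_)
    fun x y hx hy => ?_
  · rw [mul_left_comm, ← map_mul, pairing_apply, pairing_apply,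
      map_mul (Z.toScheme.germToFunctionField U).hom, mul_assoc]
  · rw [mul_add, map_add, map_add, hx, hy]

lemma pairing_pow_mul (r : Z.K) (w) :
    pairing hf hV hU h hT (r ^ p ^ e * m) w = f.fsharp hf r * pairing hf hV hU h hT m w := by
  refine pairing_induction hV hU h (motive := fun w =>
    pairing hf hV hU h hT (r ^ p ^ e * m) w = f.fsharp hf r * pairing hf hV hU h hT m w) w
    (fun d t => ?_) fun x y hx hy => ?_
  · rw [pairing_apply, pairing_apply, mul_assoc, hT, map_mul, mul_left_comm]
  · rw [map_add, map_add, hx, hy, mul_add]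

lemma pairing_mem (hm : ∀ r ∈ secRing U, T (m * r) ∈ secRing U) (w) :
    pairing hf hV hU h hT m w ∈ secRing V := by
  have : Nonempty (f ⁻¹ᵁ U) := nonempty_preimage hf U
  refine pairing_induction hV hU h (motive := fun w => pairing hf hV hU h hT m w ∈ secRing V) w
    (fun d t => ?_) fun x y hx hy => ?_
  · rw [pairing_apply]
    obtain ⟨r, hr⟩ := hm _ ⟨t, rfl⟩
    refine mul_mem ⟨d, rfl⟩ ⟨f.appLE U V h r, ?_⟩
    rw [germToFunctionField_appLE, ← fsharp_germ hf, hr]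
  · rw [map_add]
    exact add_mem hx hy

lemma pairing_res (hV' : IsAffineOpen V') (hU' : IsAffineOpen U') (h' : V' ≤ f ⁻¹ᵁ U')
    (hVV : V' ≤ V) (hUU : U' ≤ U) (w) :
    pairing hf hV' hU' h' hT m ((frobBaseChange p e f).presheaf.map
      (homOfLE ((frobFst p e f).preimage_mono hVV)).op w) = pairing hf hV hU h hT m w := by
  refine pairing_induction hV hU h (motive := fun w =>
    pairing hf hV' hU' h' hT m ((frobBaseChange p e f).presheaf.map
      (homOfLE ((frobFst p e f).preimage_mono hVV)).op w) = pairing hf hV hU h hT m w) w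
    (fun d t => ?_) fun x y hx hy => ?_
  · rw [map_mul]
    have h1 : (frobBaseChange p e f).presheaf.map (homOfLE ((frobFst p e f).preimage_mono hVV)).op
        ((frobFst p e f).appLE V _ le_rfl d) =
        (frobFst p e f).appLE V' _ le_rfl (X.toScheme.presheaf.map (homOfLE hVV).op d) := by
      rw [← CategoryTheory.comp_apply, ← CategoryTheory.comp_apply, Hom.appLE_map, Hom.map_appLE]
    have h2 : (frobBaseChange p e f).presheaf.map (homOfLE ((frobFst p e f).preimage_mono hVV)).op
        ((frobSnd p e f).appLE U _ (fst_preimage_le p e f h) t) =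
        (frobSnd p e f).appLE U' _ (fst_preimage_le p e f h')
          (Z.toScheme.presheaf.map (homOfLE hUU).op t) := by
      rw [← CategoryTheory.comp_apply, ← CategoryTheory.comp_apply, Hom.appLE_map, Hom.map_appLE]
    rw [h1, h2, pairing_apply, pairing_apply, germToFunctionField_res, germToFunctionField_res]
  · rw [map_add, map_add, map_add, hx, hy]

end Pairing

end Variety

/-! ### Dominance of split morphisms and the trace defined by a splitting. -/

namespace Variety

variable {k : Type u} [Field k] {X Z : Variety k} [X.IsNormal] {p e : ℕ} [hp : Fact p.Prime]
  [CharP k p] {f : X.toScheme ⟶ Z.toScheme} {D : X.WeilDivisor} {hD : 0 ≤ D}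
  {T : AddMonoid.End Z.K}

namespace RelFrobSplitting

lemma toFun_mul (s : RelFrobSplitting p e f D hD) (W : (frobBaseChange p e f).Opens) [Nonempty (relFrob p e f ⁻¹ᵁ W)]
    (r : Γ(frobBaseChange p e f, W)) (φ ψ : X.sectionsO D (relFrob p e f ⁻¹ᵁ W))
    (h : ψ.1 = frobGerm p e f W r * φ.1) : s.toFun W ψ = r * s.toFun W φ := by
  rw [← s.map_smul]
  congr 1
  exact Subtype.ext h

lemma toFun_res (s : RelFrobSplitting p e f D hD) {W W' : (frobBaseChange p e f).Opens} [Nonempty (relFrob p e f ⁻¹ᵁ W)]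
    [Nonempty (relFrob p e f ⁻¹ᵁ W')] (h : W' ≤ W) (φ : X.sectionsO D (relFrob p e f ⁻¹ᵁ W))
    (ψ : X.sectionsO D (relFrob p e f ⁻¹ᵁ W')) (hφ : ψ.1 = φ.1) :
    s.toFun W' ψ = (frobBaseChange p e f).presheaf.map (homOfLE h).op (s.toFun W φ) := by
  rw [← s.map_res]
  congr 1
  exact Subtype.ext hφ

/-- The splitting sends `r • 1` to `r`, so `r` is determined by its restriction along the relative
Frobenius. -/
lemma eq_zero_of_frobGerm_eq_zero (s : RelFrobSplitting p e f D hD)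
    (W : (frobBaseChange p e f).Opens)
    [Nonempty (relFrob p e f ⁻¹ᵁ W)] {r : Γ(frobBaseChange p e f, W)}
    (h : frobGerm p e f W r = 0) : r = 0 := by
  have h1 := s.toFun_mul W r ⟨1, X.one_mem_sectionsO hD _⟩ 0 (by rw [h, zero_mul]; rfl)
  rw [map_zero, s.map_one, mul_one] at h1
  exact h1.symm

end RelFrobSplitting

/-- A morphism whose relative Frobenius morphism splits is dominant. -/
theorem map_genericPoint_of_splitting (s : RelFrobSplitting p e f D hD) (he : 0 < e)
    (hc : Z.HasTraceCharts (p ^ e) T) : f (genericPoint X.toScheme) = genericPoint Z.toScheme := by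
  obtain ⟨V, hVn, U, hUn, hV, hU, hηV, -, hVU, v, hv⟩ :=
    exists_good_affine (f := f) hc ⊤ ⟨genericPoint X.toScheme, trivial⟩
  have : Nonempty (f ⁻¹ᵁ U) := ⟨⟨_, hVU hηV⟩⟩
  have : IsNoetherianRing Γ(Z.toScheme, U) := IsLocallyNoetherian.component_noetherian ⟨U, hU⟩
  obtain ⟨ι, _, b, b', hd⟩ := exists_frame_sections hv
  choose θ hθ using fun t : Γ(Z.toScheme, U) => hv.map_mem _ ⟨t, rfl⟩
  have hinj := Z.toScheme.germToFunctionField_injective U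
  have hθr : ∀ r x, θ (r ^ p ^ e * x) = r * θ x := fun r x => by
    apply hinj
    refine (hθ _).trans ?_
    rw [map_mul (Z.toScheme.germToFunctionField U).hom,
      map_pow (Z.toScheme.germToFunctionField U).hom, hv.rootLinear]
    exact ((map_mul (Z.toScheme.germToFunctionField U).hom _ _).trans
      (congrArg _ (hθ x))).symm
  have hpo := isPushout_sections p e f hV hU hVU
  obtain ⟨Ψ, hΨ⟩ := exists_lift_of_isPushout hpo (Q := Γ(X.toScheme, V))
    ((f.appLE U V hVU).hom.toAddMonoidHom.comp
      { toFun := θ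
        map_zero' := hinj (by rw [map_zero]; exact (hθ 0).trans (by simp))
        map_add' := fun x y => hinj (by
          refine (hθ _).trans ?_
          rw [map_add, map_add, map_add]
          exact (congrArg₂ _ (hθ x) (hθ y)).symm) })
    (fun r x => by
      change f.appLE U V hVU (θ _) = f.appLE U V hVU r * f.appLE U V hVU (θ x)
      rw [← map_mul, ← hθr]
      exact congrArg (fun a => f.appLE U V hVU (θ (a * x)))
        (absFrob_appLE Z.toScheme p e U le_rfl r))
  let I := RingHom.ker (f.appLE U V hVU).hom
  -- A function `t` on `Z` that vanishes on `X` already vanishes on the base change by the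
  -- splitting, and the pairing of `1 ⊗ t` is the pullback of `θ t`.
  have hI : ∀ t ∈ I, θ t ∈ I := fun t ht => by
    have h1 : (frobSnd p e f).appLE U _ (fst_preimage_le p e f hVU) t = 0 := by
      apply s.eq_zero_of_frobGerm_eq_zero
      rw [frobGerm_appLE p e (relFrob_snd p e f), ← germToFunctionField_appLE f hVU]
      exact (congrArg _ ht).trans (map_zero _)
    have h2 := hΨ 1 t
    rw [map_one, one_mul, h1, map_zero, one_smul] at h2
    exact h2.symm
  -- Expanding in the frame shows that `I` is generated by `p ^ e`-th powers of its elements, and `p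
  -- ^ e ≥ 2` since `e > 0`. An idempotent ideal of a Noetherian domain is zero or the whole ring,
  -- and it is not the whole ring because `1` does not vanish on `V`.
  have hII : I ≤ I * I := fun t ht => by
    have ht' : t = ∑ i, θ (t * b' i) ^ p ^ e * b i := by
      apply hinj
      rw [map_sum]
      refine (hd.left _).symm.trans (Finset.sum_congr rfl fun i _ => ?_)
      rw [map_mul (Z.toScheme.germToFunctionField U).hom,
        map_pow (Z.toScheme.germToFunctionField U).hom]
      refine congrArg (fun a => a ^ p ^ e * _) (Eq.trans ?_ (hθ (t * b' i)).symm)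
      exact congrArg _ (map_mul (Z.toScheme.germToFunctionField U).hom t (b' i)).symm
    rw [ht']
    refine sum_mem fun i _ => Ideal.mul_mem_right _ _ ?_
    have h2 : 2 ≤ p ^ e := hp.out.two_le.trans (Nat.le_self_pow he.ne' p)
    rw [← Nat.sub_add_cancel h2, pow_add, ← pow_two]
    exact Ideal.mul_mem_left _ _ (Ideal.pow_mem_pow (hI _ (Ideal.mul_mem_right _ _ ht)) 2)
  have hbot : I = ⊥ := by
    rcases (Ideal.isIdempotentElem_iff_eq_bot_or_top I (IsNoetherian.noetherian I)).mp
      (le_antisymm Ideal.mul_le_left hII) with h | h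
    · exact h
    · exfalso
      have : (1 : Γ(Z.toScheme, U)) ∈ I := h ▸ trivial
      have h3 : f.appLE U V hVU 1 = 0 := this
      rw [map_one] at h3
      exact one_ne_zero h3
  have h1 := IsAffineOpen.comap_primeIdealOf_appLE (f := f) U hU V hV hVU hηV
  have h2 : ∀ {S : Scheme.{u}} [IsIntegral S] {O : S.Opens} [Nonempty O] (hO : IsAffineOpen O)
      (h : genericPoint S ∈ O), (hO.primeIdealOf ⟨_, h⟩).asIdeal = ⊥ := by
    intro S _ O _ hO h
    have := hO.primeIdealOf_genericPoint
    rw [genericPoint_eq_bot_of_affine] at this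
    rw [this]
    rfl
  have h3 := congrArg PrimeSpectrum.asIdeal h1
  rw [PrimeSpectrum.comap_asIdeal, h2] at h3
  have h4 : (hU.primeIdealOf ⟨f (genericPoint X.toScheme), hVU hηV⟩) =
      hU.primeIdealOf ⟨genericPoint Z.toScheme, genericPoint_mem U⟩ := by
    apply PrimeSpectrum.ext
    rw [h2, ← h3]
    exact hbot
  exact congrArg Subtype.val (primeIdealOf_injective hU h4)

section Trace

variable (hf : f (genericPoint X.toScheme) = genericPoint Z.toScheme)
  (s : RelFrobSplitting p e f D hD) (hT : RootLinear (p ^ e) T)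

lemma mem_sectionsO_relFrob {V : X.toScheme.Opens} [Nonempty V] {φ : X.K}
    (h : ∀ x : X.PrimeDivisor, x.1 ∈ V → MemDivAt D x φ) :
    φ ∈ X.sectionsO D (relFrob p e f ⁻¹ᵁ (frobFst p e f ⁻¹ᵁ V)) :=
  mem_sectionsO_iff.mpr fun x hx => h x (by rwa [relFrob_preimage_fst] at hx)

/-- The pairing with the image of a section of `𝒪(D)` under a splitting. -/
noncomputable def splitPairing {V : X.toScheme.Opens} [Nonempty V] {U : Z.toScheme.Opens}
    [Nonempty U] (hV : IsAffineOpen V) (hU : IsAffineOpen U) (h : V ≤ f ⁻¹ᵁ U) (m : Z.K) (φ : X.K)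
    (hφ : ∀ x : X.PrimeDivisor, x.1 ∈ V → MemDivAt D x φ) : X.K :=
  pairing hf hV hU h hT m (s.toFun (frobFst p e f ⁻¹ᵁ V) ⟨φ, mem_sectionsO_relFrob hφ⟩)

variable {V V' : X.toScheme.Opens} [Nonempty V] [Nonempty V'] {U U' : Z.toScheme.Opens}
  [Nonempty U] [Nonempty U'] (hV : IsAffineOpen V) (hU : IsAffineOpen U) (h : V ≤ f ⁻¹ᵁ U)
  (m : Z.K) {φ : X.K} (hφ : ∀ x : X.PrimeDivisor, x.1 ∈ V → MemDivAt D x φ)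

lemma splitPairing_res (hV' : IsAffineOpen V') (hU' : IsAffineOpen U') (h' : V' ≤ f ⁻¹ᵁ U')
    (hVV : V' ≤ V) (hUU : U' ≤ U) :
    splitPairing hf s hT hV' hU' h' m φ (fun x hx => hφ x (hVV hx)) =
      splitPairing hf s hT hV hU h m φ hφ := by
  rw [splitPairing, splitPairing, ← pairing_res hf hV hU h hT m hV' hU' h' hVV hUU]
  congr 1
  exact s.toFun_res ((frobFst p e f).preimage_mono hVV) _ _ rfl

lemma splitPairing_fst (c : Γ(X.toScheme, V)) {ψ : X.K}
    (hψ : ∀ x : X.PrimeDivisor, x.1 ∈ V → MemDivAt D x ψ)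
    (h1 : ψ = X.toScheme.germToFunctionField V c ^ p ^ e * φ) :
    splitPairing hf s hT hV hU h m ψ hψ =
      X.toScheme.germToFunctionField V c * splitPairing hf s hT hV hU h m φ hφ := by
  rw [splitPairing, splitPairing, ← pairing_fst_mul]
  congr 1
  apply s.toFun_mul
  rw [frobGerm_fst]
  exact h1

lemma splitPairing_snd (t : Γ(Z.toScheme, U)) {ψ : X.K}
    (hψ : ∀ x : X.PrimeDivisor, x.1 ∈ V → MemDivAt D x ψ)
    (h1 : ψ = f.fsharp hf (Z.toScheme.germToFunctionField U t) * φ) :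
    splitPairing hf s hT hV hU h m ψ hψ =
      splitPairing hf s hT hV hU h (m * Z.toScheme.germToFunctionField U t) φ hφ := by
  rw [splitPairing, splitPairing, ← pairing_snd_mul]
  congr 1
  apply s.toFun_mul
  rw [frobGerm_snd p e hf h]
  exact h1

end Trace

/-- A splitting of the relative Frobenius morphism is given by a compatible root-linear map on the
function field. -/
theorem exists_isSplitTrace_of_splitting (s : RelFrobSplitting p e f D hD)
    (hf : f (genericPoint X.toScheme) = genericPoint Z.toScheme) (hT : RootLinear (p ^ e) T)
    (hc : Z.HasTraceCharts (p ^ e) T) : ∃ τ, IsSplitTrace (p ^ e) f hf D T τ := by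
  have hpe : p ^ e ≠ 0 := pow_ne_zero _ hp.out.ne_zero
  obtain ⟨V₀, hVn₀, U₀, hUn₀, hV₀, hU₀, -, -, hVU₀, -⟩ :=
    exists_good_affine (f := f) hc ⊤ ⟨genericPoint X.toScheme, trivial⟩
  have := functionField_isFractionRing_of_isAffineOpen X.toScheme V₀ hV₀
  have := functionField_isFractionRing_of_isAffineOpen Z.toScheme U₀ hU₀
  have hsec : ∀ (a : Γ(X.toScheme, V₀)) (x : X.PrimeDivisor), x.1 ∈ V₀ →
      MemDivAt D x (X.toScheme.germToFunctionField V₀ a) := fun a x hx =>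
    memDivAt_of_mem_locRing hD (germ_mem_locRing hx a)
  -- The trace is defined on one affine chart, by pairing the splitting with `m = 1`, and then
  -- extended to fractions.
  obtain ⟨τ, hτ, hτ₀⟩ := exists_rootLinear_extension (A := Γ(X.toScheme, V₀)) (K := X.K) hpe
    { toFun := fun a => splitPairing hf s hT hV₀ hU₀ hVU₀ 1 _ (hsec a)
      map_zero' := by
        rw [splitPairing, ← map_zero (pairing hf hV₀ hU₀ hVU₀ hT 1),
          ← map_zero (s.toFun (frobFst p e f ⁻¹ᵁ V₀))]
        congr 2
        exact Subtype.ext (map_zero (X.toScheme.germToFunctionField V₀).hom)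
      map_add' := fun a b => by
        rw [splitPairing, splitPairing, splitPairing, ← map_add, ← map_add]
        congr 2
        exact Subtype.ext (map_add (X.toScheme.germToFunctionField V₀).hom a b) }
    (fun r a => splitPairing_fst hf s hT hV₀ hU₀ hVU₀ 1 (hsec a) r (hsec (r ^ p ^ e * a))
      (by rw [map_mul, map_pow]))
  -- The same `τ` computes the splitting on every chart, for every multiplier `m` and every section
  -- of `𝒪(D)`.
  have key : ∀ {V : X.toScheme.Opens} [Nonempty V] {U : Z.toScheme.Opens} [Nonempty U]
      (hV : IsAffineOpen V) (hU : IsAffineOpen U) (h : V ≤ f ⁻¹ᵁ U) (m : Z.K) (φ : X.K)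
      (hφ : ∀ x : X.PrimeDivisor, x.1 ∈ V → MemDivAt D x φ),
      splitPairing hf s hT hV hU h m φ hφ = τ (f.fsharp hf m * φ) := by
    intro V _ U _ hV hU h m φ hφ
    obtain ⟨U', hUn', hU', hηU', hUU'⟩ :=
      exists_affine_mem (x := genericPoint Z.toScheme) (W := U ⊓ U₀)
        ⟨genericPoint_mem U, genericPoint_mem U₀⟩
    have := nonempty_preimage hf U'
    obtain ⟨V', hVn', hV', -, hVV'⟩ :=
      exists_affine_mem (x := genericPoint X.toScheme) (W := (V ⊓ V₀) ⊓ f ⁻¹ᵁ U')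
        ⟨⟨genericPoint_mem V, genericPoint_mem V₀⟩, genericPoint_mem _⟩
    have hV1 : V' ≤ V := hVV'.trans (inf_le_left.trans inf_le_left)
    have hV2 : V' ≤ V₀ := hVV'.trans (inf_le_left.trans inf_le_right)
    have hU1 : U' ≤ U := hUU'.trans inf_le_left
    have hU2 : U' ≤ U₀ := hUU'.trans inf_le_right
    have hVU' : V' ≤ f ⁻¹ᵁ U' := hVV'.trans inf_le_right
    have hφ' : ∀ x : X.PrimeDivisor, x.1 ∈ V' → MemDivAt D x φ := fun x hx => hφ x (hV1 hx)
    rw [← splitPairing_res hf s hT hV hU h m hφ hV' hU' hVU' hV1 hU1]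
    obtain ⟨a, c, hc0, hac⟩ := IsFractionRing.div_surjective Γ(X.toScheme, V₀) φ
    obtain ⟨x, y, hy0, hxy⟩ := IsFractionRing.div_surjective Γ(Z.toScheme, U₀) m
    have hgc : X.toScheme.germToFunctionField V₀ c ≠ 0 :=
      (map_ne_zero_iff _ (X.toScheme.germToFunctionField_injective V₀)).mpr
        (nonZeroDivisors.ne_zero hc0)
    have hgy : Z.toScheme.germToFunctionField U₀ y ≠ 0 :=
      (map_ne_zero_iff _ (Z.toScheme.germToFunctionField_injective U₀)).mpr
        (nonZeroDivisors.ne_zero hy0)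
    have hac' : X.toScheme.germToFunctionField V₀ a = X.toScheme.germToFunctionField V₀ c * φ := by
      rw [← hac]
      exact (mul_div_cancel₀ _ hgc).symm
    have hxy' : Z.toScheme.germToFunctionField U₀ x = Z.toScheme.germToFunctionField U₀ y * m := by
      rw [← hxy]
      exact (mul_div_cancel₀ _ hgy).symm
    -- With `φ = a / c` and `m = x / y`, multiplication by the `p ^ e`-th powers of `c` and `y`
    -- gives sections `d` and `t` on the original chart, where the value is known. On both sides
    -- these powers come out as the factors `c` and `y`, which are then cancelled.
    obtain ⟨q, hq⟩ : ∃ q, p ^ e = q + 1 := ⟨p ^ e - 1, by omega⟩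
    let t := x * y ^ q
    have ht : Z.toScheme.germToFunctionField U₀ t =
        Z.toScheme.germToFunctionField U₀ y ^ p ^ e * m := by
      rw [map_mul (Z.toScheme.germToFunctionField U₀).hom,
        map_pow (Z.toScheme.germToFunctionField U₀).hom, hxy', hq]
      ring
    let d := a * c ^ q
    have hd : X.toScheme.germToFunctionField V₀ d =
        X.toScheme.germToFunctionField V₀ c ^ p ^ e * φ := by
      rw [map_mul (X.toScheme.germToFunctionField V₀).hom,
        map_pow (X.toScheme.germToFunctionField V₀).hom, hac', hq]
      ring
    let c' := X.toScheme.presheaf.map (homOfLE hV2).op c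
    let t' := Z.toScheme.presheaf.map (homOfLE hU2).op t
    have hc' : X.toScheme.germToFunctionField V' c' = X.toScheme.germToFunctionField V₀ c :=
      germToFunctionField_res hV2 c
    have ht' : Z.toScheme.germToFunctionField U' t' = Z.toScheme.germToFunctionField U₀ t :=
      germToFunctionField_res hU2 t
    have : Nonempty (f ⁻¹ᵁ U₀) := nonempty_preimage hf U₀
    have hftd : X.toScheme.germToFunctionField V₀ (f.appLE U₀ V₀ hVU₀ t * d) =
        f.fsharp hf (Z.toScheme.germToFunctionField U₀ t) *
          X.toScheme.germToFunctionField V₀ d := by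
      rw [map_mul (X.toScheme.germToFunctionField V₀).hom, fsharp_germ, germToFunctionField_appLE]
    have h1 : f.fsharp hf (Z.toScheme.germToFunctionField U₀ y) *
        (X.toScheme.germToFunctionField V₀ c *
          splitPairing hf s hT hV' hU' hVU' m φ hφ') =
        splitPairing hf s hT hV₀ hU₀ hVU₀ 1 _ (hsec (f.appLE U₀ V₀ hVU₀ t * d)) := by
      rw [← splitPairing_res hf s hT hV₀ hU₀ hVU₀ 1 _ hV' hU' hVU' hV2 hU2,
        splitPairing_snd hf s hT hV' hU' hVU' 1 (φ := X.toScheme.germToFunctionField V₀ d)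
          (fun x hx => hsec d x (hV2 hx)) t' _ (by rw [hftd, ht']), one_mul, ht', ht,
        splitPairing_fst hf s hT hV' hU' hVU' _ hφ' c'
          (ψ := X.toScheme.germToFunctionField V₀ d) (fun x hx => hsec d x (hV2 hx)) (by rw [hd, hc']), hc', splitPairing,
        splitPairing, pairing_pow_mul]
      ring
    have h2 := hτ₀ (f.appLE U₀ V₀ hVU₀ t * d)
    have h3 : τ (X.toScheme.germToFunctionField V₀ (f.appLE U₀ V₀ hVU₀ t * d)) =
      f.fsharp hf (Z.toScheme.germToFunctionField U₀ y) *
        (X.toScheme.germToFunctionField V₀ c * τ (f.fsharp hf m * φ)) := by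
      rw [hftd, ht, hd, map_mul (f.fsharp hf), map_pow (f.fsharp hf), ← hτ, ← hτ]
      congr 1
      ring
    have h4 := h1.trans (h2.symm.trans h3)
    have hfy : f.fsharp hf (Z.toScheme.germToFunctionField U₀ y) ≠ 0 := (map_ne_zero _).mpr hgy
    exact mul_left_cancel₀ hgc (mul_left_cancel₀ hfy h4)
  refine ⟨τ, hτ, fun m => ?_, fun x w hw φ hφ => ?_⟩
  · have h1 : ∀ x : X.PrimeDivisor, x.1 ∈ V₀ → MemDivAt D x (1 : X.K) := fun x hx =>
      memDivAt_of_mem_locRing hD (one_mem _)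
    rw [← mul_one (f.fsharp hf m), ← key hV₀ hU₀ hVU₀ m 1 h1, splitPairing, s.map_one, pairing_one]
  · obtain ⟨U, hUn, hU, hxU, v, hv⟩ := hc (f x.1)
    -- The prescribed local generator differs from that of the chart by a unit, which is absorbed
    -- into `φ`.
    obtain ⟨u, hu, -, rfl⟩ := (hv.locRing hpe hU hxU).exists_unit hw
    obtain ⟨V, hVn, hV, hxV, hVU, hφV⟩ := exists_mem_sectionsO hD
      (hφ.mul (fsharp_mem_locRing hf hu)) (f ⁻¹ᵁ U) hxU
    rw [map_mul (f.fsharp hf), mul_assoc, ← key hV hU hVU v _ (mem_sectionsO_iff.mp hφV)]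
    exact secRing_le_locRing hxV (pairing_mem hf hV hU hVU hT v hv.map_mem _)

end Variety

/-! ### Coordinates on smooth varieties -/

lemma Module.Basis.ofIsLocalizedModule_det {A N V W ι : Type*} [CommRing A] [CommRing N]
    [Algebra A N] [AddCommGroup V] [Module A V] [AddCommGroup W] [Module A W] [Module N W]
    [IsScalarTower A N W] [Fintype ι] [DecidableEq ι] (M : Submonoid A) [IsLocalization M N]
    (φ : V →ₗ[A] W) [IsLocalizedModule M φ] (B : Module.Basis ι A V) (v : ι → V) :
    (B.ofIsLocalizedModule N M φ).det (fun i => φ (v i)) = algebraMap A N (B.det v) := by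
  rw [Module.Basis.det_apply, Module.Basis.det_apply, RingHom.map_det]
  congr 1
  ext i j
  simp [Module.Basis.toMatrix_apply]

lemma Module.Basis.exists_kaehler_of_isLocalization {k A N ι : Type*} [CommRing k] [CommRing A]
    [CommRing N] [Algebra k A] [Algebra k N] [Algebra A N] [IsScalarTower k A N] [Fintype ι]
    [DecidableEq ι] (M : Submonoid A) [IsLocalization M N] (B : Module.Basis ι A (Ω[A⁄k]))
    {b : ι → A} (hb : ∀ i, B i = KaehlerDifferential.D k A (b i)) :
    ∃ B' : Module.Basis ι N (Ω[N⁄k]),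
      (∀ i, B' i = KaehlerDifferential.D k N (algebraMap A N (b i))) ∧
      ∀ v : ι → A, B'.det (fun i => KaehlerDifferential.D k N (algebraMap A N (v i))) =
        algebraMap A N (B.det fun i => KaehlerDifferential.D k A (v i)) := by
  refine ⟨B.ofIsLocalizedModule N M (KaehlerDifferential.map k k A N), fun i => ?_, fun v => ?_⟩
  · rw [Module.Basis.ofIsLocalizedModule_apply, hb, KaehlerDifferential.map_D]
  · rw [← Module.Basis.ofIsLocalizedModule_det M (KaehlerDifferential.map k k A N) B]
    simp

lemma Module.Basis.ιMulti_eq_det_smul {N V : Type*} [CommRing N] [AddCommGroup V] [Module N V]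
    {n : ℕ} (B : Module.Basis (Fin n) N V) (v : Fin n → V) :
    exteriorPower.ιMulti N n v = B.det v • exteriorPower.ιMulti N n B := by
  have : exteriorPower.ιMulti N n =
      (LinearMap.toSpanSingleton N _ (exteriorPower.ιMulti N n B)).compAlternatingMap B.det := by
    refine B.ext_alternating fun σ hσ => ?_
    obtain ⟨σ, rfl⟩ : ∃ σ' : Equiv.Perm (Fin n), ⇑σ' = σ :=
      ⟨Equiv.ofBijective σ (Finite.injective_iff_bijective.mp hσ), rfl⟩
    have h1 := (exteriorPower.ιMulti N n).map_perm B σ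
    have h2 := B.det.map_perm B σ
    rw [B.det_self] at h2
    change exteriorPower.ιMulti N n (⇑B ∘ ⇑σ) =
      B.det (⇑B ∘ ⇑σ) • exteriorPower.ιMulti N n B
    rw [h1, h2, smul_assoc, one_smul]
  exact congrArg (fun φ => φ v) this

lemma PSpans.frobenius_finite {p : ℕ} [Fact p.Prime] {ι : Type} [Fintype ι] [DecidableEq ι]
    {R : Type*} [CommRing R] [CharP R p] {b : ι → R} (h : PSpans p b) : (frobenius R p).Finite := by
  have key : ∀ (S : Type _) [CommRing S] [Algebra R S] (m : (ι → Fin p) → S),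
      (∀ x : S, ∃ c : (ι → Fin p) → R, x = ∑ α, c α • m α) → Module.Finite R S := by
    intro S _ _ m hm
    refine ⟨Submodule.fg_def.mpr ⟨Set.range m, Set.finite_range _, ?_⟩⟩
    rw [eq_top_iff]
    rintro x -
    obtain ⟨c, rfl⟩ := hm x
    exact Submodule.sum_mem _ fun α _ =>
      Submodule.smul_mem _ (c α) (Submodule.subset_span (Set.mem_range_self α))
  exact @key R _ (frobenius R p).toAlgebra _ h

lemma PSpans.of_isFractionRing {p : ℕ} [hp : Fact p.Prime] {ι : Type} [Fintype ι] [DecidableEq ι]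
    {R N : Type*} [CommRing R] [IsDomain R] [Field N] [Algebra R N] [IsFractionRing R N] {b : ι → R}
    (h : PSpans p b) : PSpans p fun i => algebraMap R N (b i) := by
  intro x
  obtain ⟨a, s, hs, rfl⟩ := IsFractionRing.div_surjective R x
  obtain ⟨c, hc⟩ := h (a * s ^ (p - 1))
  have hs' : algebraMap R N s ≠ 0 := fun h0 => nonZeroDivisors.ne_zero hs
    (IsFractionRing.injective R N (by rw [h0, map_zero]))
  refine ⟨fun α => algebraMap R N (c α) / algebraMap R N s, ?_⟩
  have h1 := congrArg (algebraMap R N) hc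
  simp only [map_mul, map_pow, map_sum, mono, map_prod] at h1
  obtain ⟨r, rfl⟩ := Nat.exists_eq_succ_of_ne_zero hp.out.ne_zero
  simp only [div_pow, div_mul_eq_mul_div, ← Finset.sum_div, mono]
  rw [← h1]
  simp only [Nat.succ_eq_add_one, Nat.add_sub_cancel]
  field_simp
  ring

namespace Variety

variable {k : Type u} [Field k] (X : Variety k)

/-- The rational top form `da₁ ∧ ⋯ ∧ daₙ` given by rational functions. -/
noncomputable def ratForm (a : Fin X.dim → X.K) : X.RatForm :=
  exteriorPower.ιMulti X.K X.dim fun i => KaehlerDifferential.D k X.K (a i)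

instance (x : X.toScheme) : IsScalarTower k (X.toScheme.presheaf.stalk x) X.K :=
  have : Nonempty (⊤ : X.toScheme.Opens) := ⟨⟨x, trivial⟩⟩
  IsScalarTower.of_algebraMap_eq fun c =>
    (algebraMap_germ_eq_germToFunctionField X.toScheme (x := x) (U := ⊤) trivial (X.scalars c)).symm

variable {X}

lemma ratForm_ne_zero {a : Fin X.dim → X.K} (ha : IsCoordBasis k a) : X.ratForm a ≠ 0 := by
  obtain ⟨B, hB⟩ := ha
  intro h0
  have h1 : exteriorPower.alternatingMapLinearEquiv B.det (X.ratForm a) = 1 := by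
    rw [ratForm, exteriorPower.alternatingMapLinearEquiv_apply_ιMulti]
    simp_rw [← hB]
    exact B.det_self
  rw [h0, map_zero] at h1
  exact zero_ne_one h1

lemma IsCoordinates.isCoordBasis {x : X.toScheme} {a : Fin X.dim → X.toScheme.presheaf.stalk x}
    (ha : X.IsCoordinates x a) : IsCoordBasis k fun i => algebraMap _ X.K (a i) := by
  obtain ⟨B, hB⟩ := ha
  obtain ⟨B', hB', -⟩ := B.exists_kaehler_of_isLocalization (N := X.K)
    (nonZeroDivisors (X.toScheme.presheaf.stalk x)) hB
  exact ⟨B', hB'⟩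

/-- The Jacobian of two systems of local coordinates is a unit. -/
lemma IsCoordinates.exists_unit {x : X.toScheme} {a b : Fin X.dim → X.toScheme.presheaf.stalk x}
    (ha : X.IsCoordinates x a) (hb : X.IsCoordinates x b) :
    ∃ u ∈ locRing x, u⁻¹ ∈ locRing x ∧ u ≠ 0 ∧ X.coordForm x a = u • X.coordForm x b := by
  obtain ⟨A, hA⟩ := ha
  obtain ⟨B, hB⟩ := hb
  obtain ⟨B', hB', hdet⟩ := B.exists_kaehler_of_isLocalization (N := X.K)
    (nonZeroDivisors (X.toScheme.presheaf.stalk x)) hB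
  have h1 : B.det A * A.det B = 1 := by rw [Module.Basis.det_mul_det, B.det_self]
  have h2 := congrArg (algebraMap _ X.K) h1
  rw [map_mul, map_one] at h2
  refine ⟨algebraMap _ X.K (B.det A), ⟨_, rfl⟩, ⟨A.det B, ?_⟩, left_ne_zero_of_mul_eq_one h2, ?_⟩
  · exact (inv_eq_of_mul_eq_one_right h2).symm
  · have h3 := B'.ιMulti_eq_det_smul fun i => KaehlerDifferential.D k X.K (algebraMap _ X.K (a i))
    rw [hdet] at h3
    simp_rw [← hA] at h3
    rw [coordForm, h3, coordForm]
    simp_rw [← hB']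

/-- The ring homomorphism from `k` to the functions on an open subset of a variety over `k`. -/
noncomputable def scalarsOn (X : Variety k) (U : X.toScheme.Opens) : k →+* Γ(X.toScheme, U) :=
  (X.toScheme.presheaf.map (homOfLE le_top).op).hom.comp X.scalars

lemma appLE_str_comp {V : X.toScheme.Opens} (h : V ≤ X.str ⁻¹ᵁ ⊤) :
    (X.str.appLE ⊤ V h).hom.comp (Scheme.ΓSpecIso (.of k)).inv.hom = X.scalarsOn V :=
  rfl

/-- Coordinates on an affine open subset. -/
structure IsChart (p : ℕ) (X : Variety k) (U : X.toScheme.Opens)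
    (b : Fin X.dim → Γ(X.toScheme, U)) : Prop where
  isAffineOpen : IsAffineOpen U
  isCoordinates : ∀ x (hx : x ∈ U), X.IsCoordinates x fun i => X.toScheme.presheaf.germ U x hx (b i)
  pSpans : PSpans p b

/-- A standard smooth presentation has a basis of differentials consisting of differentials of
functions, and over a perfect field such functions generate the ring over the `p`-th powers. -/
lemma exists_isChart {p : ℕ} [hp : Fact p.Prime] [CharP k p] (hk : ∀ a : k, ∃ c, c ^ p = a)
    (hX : Smooth X.str) (x : X.toScheme) : ∃ (U : X.toScheme.Opens) (_ : Nonempty U)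
      (b : Fin X.dim → Γ(X.toScheme, U)), x ∈ U ∧ IsChart p X U b := by
  obtain ⟨U, hU, V, hV, hxV, e, h⟩ := Smooth.exists_isStandardSmooth X.str x
  have hVn : Nonempty V := ⟨⟨x, hxV⟩⟩
  obtain rfl : U = ⊤ := by
    rw [eq_top_iff]
    intro y _
    rw [Subsingleton.elim y (X.str x)]
    exact e hxV
  have h1 : (X.scalarsOn V).IsStandardSmooth := by
    rw [← appLE_str_comp e]
    exact RingHom.isStandardSmooth_respectsIso.2 (X.str.appLE ⊤ V e).hom
      (Scheme.ΓSpecIso (.of k)).symm.commRingCatIsoToRingEquiv h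
  let := (X.scalarsOn V).toAlgebra
  have h2 : Algebra.IsStandardSmooth k Γ(X.toScheme, V) := h1
  have htower : ∀ y (hy : y ∈ V), letI := (X.toScheme.presheaf.germ V y hy).hom.toAlgebra
      IsScalarTower k Γ(X.toScheme, V) (X.toScheme.presheaf.stalk y) := fun y hy => by
    let := (X.toScheme.presheaf.germ V y hy).hom.toAlgebra
    refine IsScalarTower.of_algebraMap_eq fun c => ?_
    exact (X.toScheme.presheaf.germ_res_apply (homOfLE le_top) y hy (X.scalars c)).symm
  obtain ⟨ι, σ, _, _, ⟨P⟩⟩ := h2.out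
  have : IsFractionRing Γ(X.toScheme, V) X.K := functionField_isFractionRing_of_isAffineOpen _ V hV
  have htK : IsScalarTower k Γ(X.toScheme, V) X.K := htower _ (genericPoint_mem V)
  classical
  have := Fintype.ofFinite ((Set.range P.map)ᶜ : Set ι)
  obtain ⟨B', -, -⟩ := P.basisKaehler.exists_kaehler_of_isLocalization (N := X.K)
    (nonZeroDivisors Γ(X.toScheme, V)) P.basisKaehler_apply
  -- The basis localizes to the function field, where its size is the rank that defines `X.dim`.
  have hcard : Fintype.card ((Set.range P.map)ᶜ : Set ι) = X.dim :=
    (Module.finrank_eq_card_basis B').symm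
  let B := P.basisKaehler.reindex (Fintype.equivFinOfCardEq hcard)
  let b : Fin X.dim → Γ(X.toScheme, V) := fun i => P.val ((Fintype.equivFinOfCardEq hcard).symm i)
  have hB : ∀ i, B i = KaehlerDifferential.D k _ (b i) := fun i => by
    simp [B, b]
  refine ⟨V, hVn, b, hxV, hV, fun y hy => ?_, ?_⟩
  · let := (X.toScheme.presheaf.germ V y hy).hom.toAlgebra
    have := htower y hy
    have hloc : IsLocalization.AtPrime (X.toScheme.presheaf.stalk y) _ :=
      hV.isLocalization_stalk ⟨y, hy⟩
    obtain ⟨B', hB', -⟩ := B.exists_kaehler_of_isLocalization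
      (N := X.toScheme.presheaf.stalk y) (hV.primeIdealOf ⟨y, hy⟩).asIdeal.primeCompl hB
    exact ⟨B', hB'⟩
  · have : CharP Γ(X.toScheme, V) p := charP_of_injective_algebraMap (X.scalarsOn V).injective p
    refine pSpans_of_span_eq_top p hk (frobenius_finite_of_finiteType p hk) b ?_
    rw [← B.span_eq]
    congr 2
    ext i
    exact (hB i).symm

/-! ### Traces of charts and their comparison. -/

section Trace

variable {p : ℕ} [hp : Fact p.Prime] [CharP k p] {U : X.toScheme.Opens} [Nonempty U]
  {b : Fin X.dim → Γ(X.toScheme, U)}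

/-- The rational functions given by the coordinates of a chart. -/
noncomputable abbrev ratCoord {X : Variety k} {U : X.toScheme.Opens} [Nonempty U]
    (b : Fin X.dim → Γ(X.toScheme, U)) (i : Fin X.dim) : X.K :=
  X.toScheme.germToFunctionField U (b i)

lemma IsChart.isFractionRing (h : IsChart p X U b) : IsFractionRing Γ(X.toScheme, U) X.K :=
  functionField_isFractionRing_of_isAffineOpen _ U h.isAffineOpen

lemma IsChart.pSpans_ratCoord (h : IsChart p X U b) : PSpans p (ratCoord b) :=
  have := h.isFractionRing
  h.pSpans.of_isFractionRing (N := X.K)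

lemma coordForm_germ_eq (b : Fin X.dim → Γ(X.toScheme, U)) {x : X.toScheme} (hx : x ∈ U) :
    X.coordForm x (fun i => X.toScheme.presheaf.germ U x hx (b i)) = X.ratForm (ratCoord b) := by
  rw [coordForm, ratForm]
  simp_rw [algebraMap_germ_eq_germToFunctionField]

lemma IsChart.isCoordBasis (h : IsChart p X U b) : IsCoordBasis k (ratCoord b) := by
  have := (h.isCoordinates _ (genericPoint_mem U)).isCoordBasis
  simpa only [algebraMap_germ_eq_germToFunctionField] using this

lemma IsChart.isPBasis (h : IsChart p X U b) : IsPBasis p (ratCoord b) := by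
  obtain ⟨B, hB⟩ := h.isCoordBasis
  exact isPBasis_of_basis p _ B hB h.pSpans_ratCoord

lemma IsChart.isTraceOn (h : IsChart p X U b) : IsTraceOn p h.isPBasis.trace (secRing U) := by
  refine h.isPBasis.isTraceOn _ (fun i => ⟨b i, rfl⟩) ?_
  rintro _ ⟨x, rfl⟩
  obtain ⟨c, hc⟩ := h.pSpans x
  refine ⟨fun α => X.toScheme.germToFunctionField U (c α), fun α => ⟨c α, rfl⟩, ?_⟩
  nth_rw 1 [hc]
  simp [mono]

variable {U' : X.toScheme.Opens} [Nonempty U'] {b' : Fin X.dim → Γ(X.toScheme, U')}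

/-- Comparison of the traces of two charts. -/
lemma IsChart.exists_trace_eq (hk : ∀ a : k, ∃ c, c ^ p = a) (h : IsChart p X U b)
    (h' : IsChart p X U' b') :
    ∃ J : X.K, J ≠ 0 ∧ X.ratForm (ratCoord b') = J • X.ratForm (ratCoord b) ∧
      ∀ x, h'.isPBasis.trace x = J⁻¹ * h.isPBasis.trace (J * x) := by
  obtain ⟨B, hB⟩ := h.isCoordBasis
  obtain ⟨B', hB'⟩ := h'.isCoordBasis
  have h0 : B.det B' ≠ 0 := left_ne_zero_of_mul_eq_one
    (b := B'.det B) (by rw [Module.Basis.det_mul_det, B.det_self])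
  refine ⟨B.det B', h0, ?_, fun x => ?_⟩
  · rw [ratForm, ratForm]
    simp_rw [← hB, ← hB']
    exact B.ιMulti_eq_det_smul B'
  · rw [IsPBasis.trace_change hk h.pSpans_ratCoord.frobenius_finite B hB B' hB' h.isPBasis
      h'.isPBasis, inv_mul_cancel_left₀ h0]

/-- Relative to a fixed chart, the local generators behave like sections of the power `1 - p ^ e` of
the canonical sheaf: the factor is the corresponding power of the Jacobian `J`. -/
lemma IsChart.isTraceOn_pow (hk : ∀ a : k, ∃ c, c ^ p = a) (h : IsChart p X U b)
    (h' : IsChart p X U' b') {J : X.K}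
    (hJb : X.ratForm (ratCoord b') = J • X.ratForm (ratCoord b)) (e : ℕ) :
    IsTraceOn (p ^ e) (scaleEnd (h.isPBasis.trace ^ e) (J / J ^ p ^ e)) (secRing U') := by
  obtain ⟨J', h0, hJ', htr⟩ := h.exists_trace_eq hk h'
  obtain rfl : J = J' := smul_left_injective _ (ratForm_ne_zero h.isCoordBasis)
    (hJb.symm.trans hJ')
  rw [← pow_eq_scaleEnd h.isPBasis.trace_rootLinear h0 htr]
  exact h'.isTraceOn.pow e

lemma IsChart.hasTraceCharts (hk : ∀ a : k, ∃ c, c ^ p = a) (hX : Smooth X.str)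
    (h : IsChart p X U b) (e : ℕ) : X.HasTraceCharts (p ^ e) (h.isPBasis.trace ^ e) := by
  intro x
  obtain ⟨U', _, b', hx, h'⟩ := exists_isChart hk hX x
  obtain ⟨J, -, hJb, -⟩ := h.exists_trace_eq hk h'
  exact ⟨U', inferInstance, h'.isAffineOpen, hx, _, h.isTraceOn_pow hk h' hJb e⟩

end Trace

end Variety

/-! ### The criterion for `F`-splitting on the function field -/

lemma IsAlgClosed.exists_pow_prime_eq {k : Type*} [Field k] [IsAlgClosed k] (p : ℕ) [hp : Fact p.Prime]
    (a : k) : ∃ c, c ^ p = a :=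
  IsAlgClosed.exists_pow_nat_eq a hp.out.pos

lemma AlgebraicGeometry.Scheme.mem_locRing_genericPoint {X : Scheme.{u}} [IsIntegral X]
    (c : X.functionField) : c ∈ locRing (genericPoint X) := by
  obtain ⟨U, hU, s, rfl⟩ := exists_germToFunctionField_eq c
  exact germ_mem_locRing (genericPoint_mem U) s

namespace Variety

variable {k : Type u} [Field k] {X Y Z : Variety k} {p : ℕ} [hp : Fact p.Prime]

variable (p) in
/-- The divisor `⌈(p ^ e - 1) Δ⌉`. -/
noncomputable abbrev ceilDiv (Δ : X.QWeilDivisor) (e : ℕ) : X.WeilDivisor :=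
  (((p : ℚ) ^ e - 1) • Δ).roundUp

lemma ceilDiv_apply (Δ : X.QWeilDivisor) (e : ℕ) (x : X.PrimeDivisor) :
    ceilDiv p Δ e x = ⌈((p : ℚ) ^ e - 1) * Δ x⌉ := rfl

lemma ceilDiv_zero (e : ℕ) : ceilDiv p (0 : X.QWeilDivisor) e = 0 := by
  ext x
  simp [ceilDiv_apply]

/-- From `p ^ (d + e) - 1 = p ^ e * (p ^ d - 1) + (p ^ e - 1)`. Rounding up goes in the direction
needed to compose splittings of exponents `d` and `e`. -/
lemma ceilDiv_add_le (Δ : X.QWeilDivisor) (d e : ℕ) (x : X.PrimeDivisor) :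
    ceilDiv p Δ (d + e) x ≤ (p ^ e : ℕ) * ceilDiv p Δ d x + ceilDiv p Δ e x := by
  simp only [ceilDiv_apply]
  rw [Int.ceil_le]
  push_cast
  have h1 := Int.le_ceil (((p : ℚ) ^ d - 1) * Δ x)
  have h2 := Int.le_ceil (((p : ℚ) ^ e - 1) * Δ x)
  have h3 : (0 : ℚ) ≤ (p : ℚ) ^ e := by positivity
  have h4 := mul_le_mul_of_nonneg_left h1 h3
  have h5 : ((p : ℚ) ^ (d + e) - 1) * Δ x =
      (p : ℚ) ^ e * (((p : ℚ) ^ d - 1) * Δ x) + ((p : ℚ) ^ e - 1) * Δ x := by ring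
  linarith

/-- Traces over a local ring come from charts up to a unit. -/
lemma HasTraceCharts.exists_chart {q : ℕ} (hq : q ≠ 0) {T : AddMonoid.End Z.K}
    (hc : Z.HasTraceCharts q T) {z : Z.toScheme} {v : Z.K}
    (hv : IsTraceOn q (scaleEnd T v) (locRing z)) :
    ∃ (U : Z.toScheme.Opens) (_ : Nonempty U) (w u : Z.K), IsAffineOpen U ∧ z ∈ U ∧
      IsTraceOn q (scaleEnd T w) (secRing U) ∧ u ∈ locRing z ∧ u⁻¹ ∈ locRing z ∧ v = w * u := by
  obtain ⟨U, hUn, hU, hz, w, hw⟩ := hc z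
  obtain ⟨u, hu, hu', h⟩ := (hw.locRing hq hU hz).exists_unit hv
  exact ⟨U, hUn, w, u, hU, hz, hw, hu, hu', h⟩

variable [CharP k p]

/-- The passage from schemes to function fields: after this, only split traces are manipulated.
Dominance of `f` is part of the conclusion because pullback to the function field of `X` requires
it. -/
lemma IsChart.isFSplit_iff [X.IsNormal] (hk : ∀ a : k, ∃ c, c ^ p = a) (hZ : Smooth Z.str)
    {U : Z.toScheme.Opens} [Nonempty U] {b : Fin Z.dim → Γ(Z.toScheme, U)} (hb : IsChart p Z U b)
    (f : X.toScheme ⟶ Z.toScheme) (Δ : X.QWeilDivisor) (hΔ : 0 ≤ Δ) :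
    IsFSplit p f Δ hΔ ↔ ∃ e, 0 < e ∧ ∃ hf : f (genericPoint X.toScheme) = genericPoint Z.toScheme,
      ∃ τ, IsSplitTrace (p ^ e) f hf (ceilDiv p Δ e) (hb.isPBasis.trace ^ e) τ := by
  refine exists_congr fun e => and_congr_right fun he => ⟨fun ⟨s⟩ => ?_, fun ⟨hf, τ, hτ⟩ => ?_⟩
  · have hf := map_genericPoint_of_splitting s he (hb.hasTraceCharts hk hZ e)
    exact ⟨hf, exists_isSplitTrace_of_splitting s hf (pow_rootLinear hb.isPBasis.trace_rootLinear e)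
      (hb.hasTraceCharts hk hZ e)⟩
  · exact nonempty_relFrobSplitting _ (hb.hasTraceCharts hk hZ e) hτ

/-! ### Iteration -/

section Iterate

variable [X.IsNormal] {f : X.toScheme ⟶ Z.toScheme}
  {hf : f (genericPoint X.toScheme) = genericPoint Z.toScheme} {T : AddMonoid.End Z.K}

/-- Used to iterate splittings, so that two of them can be brought to a common exponent, or the
exponent made divisible as needed. -/
lemma IsSplitTrace.mul (hT : RootLinear p T) (hc : Z.HasTraceCharts p T) {d e : ℕ}
    {D D₁ D₂ : X.WeilDivisor} {τ₁ τ₂ : AddMonoid.End X.K}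
    (h₁ : IsSplitTrace (p ^ d) f hf D₁ (T ^ d) τ₁) (h₂ : IsSplitTrace (p ^ e) f hf D₂ (T ^ e) τ₂)
    (hD : ∀ x, D x ≤ (p ^ e : ℕ) * D₁ x + D₂ x) :
    IsSplitTrace (p ^ (d + e)) f hf D (T ^ (d + e)) (τ₁ * τ₂) := by
  refine ⟨fun r x => ?_, fun m => ?_, fun x v hv φ hφ => ?_⟩
  · rw [endMul_apply, endMul_apply, pow_add, pow_mul, h₂.rootLinear, h₁.rootLinear]
  · rw [endMul_apply, h₂.map_fsharp, h₁.map_fsharp, pow_add, endMul_apply]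
  · obtain ⟨U, hUn, hU, hz, w, hw⟩ := hc (f x.1)
    have hw' := hw.locRing hp.out.ne_zero hU hz
    have htr : ∀ n, IsTraceOn (p ^ n) (scaleEnd (T ^ n) (w ^ ∑ i ∈ Finset.range n, p ^ i))
        (locRing (f x.1)) := fun n => scaleEnd_pow hT w n ▸ hw'.pow n
    obtain ⟨u, hu, -, rfl⟩ := (htr (d + e)).exists_unit hv
    set w₁ := w ^ ∑ i ∈ Finset.range d, p ^ i
    set w₂ := w ^ ∑ i ∈ Finset.range e, p ^ i
    -- The geometric sum of length `d + e` splits as `p ^ e` times that of length `d` plus that of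
    -- length `e`, so the generator factors in the form that `τ₂` followed by `τ₁` can consume.
    have hw12 : w ^ ∑ i ∈ Finset.range (d + e), p ^ i = w₁ ^ p ^ e * w₂ := by
      rw [← pow_mul, ← pow_add, add_comm d e, Finset.sum_range_add, Finset.sum_mul, add_comm]
      congr 2
      exact Finset.sum_congr rfl fun i _ => by rw [pow_add, mul_comm]
    have h3 : f.fsharp hf (w ^ (∑ i ∈ Finset.range (d + e), p ^ i) * u) * φ =
        f.fsharp hf w₁ ^ p ^ e * (f.fsharp hf w₂ * (f.fsharp hf u * φ)) := by
      rw [hw12, map_mul (f.fsharp hf), map_mul (f.fsharp hf), map_pow (f.fsharp hf)]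
      ring
    rw [h3, endMul_apply, h₂.rootLinear]
    refine h₁.mem x w₁ (htr d) _ ?_
    -- A factor of order `D₁ x` clears the pole allowed by `D₁`. It enters `τ₂` as its `p ^ e`-th
    -- power, which accounts for the term `p ^ e * D₁` in `hD`.
    obtain ⟨t, ht, htD⟩ := exists_ord_eq x.2 (D₁ x)
    rw [memDivAt_iff ht htD, ← h₂.rootLinear, mul_left_comm]
    refine h₂.mem x w₂ (htr e) _ ?_
    rw [mul_left_comm]
    refine MemDivAt.mul ?_ (fsharp_mem_locRing hf hu)
    intro h0
    have hφ0 : φ ≠ 0 := right_ne_zero_of_mul h0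
    have := hφ hφ0
    rw [ord_mul (pow_ne_zero _ ht) hφ0, ord_pow ht, htD]
    have := hD x
    linarith

lemma IsSplitTrace.exists_iterate (hT : RootLinear p T) (hc : Z.HasTraceCharts p T) {e : ℕ}
    {Δ : X.QWeilDivisor} {τ : AddMonoid.End X.K}
    (h : IsSplitTrace (p ^ e) f hf (ceilDiv p Δ e) (T ^ e) τ) {n : ℕ} (hn : 0 < n) :
    ∃ τ', IsSplitTrace (p ^ (e * n)) f hf (ceilDiv p Δ (e * n)) (T ^ (e * n)) τ' := by
  induction n, hn using Nat.le_induction with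
  | base => exact ⟨τ, by simpa using h⟩
  | succ n _ ih =>
    obtain ⟨τ', hτ'⟩ := ih
    exact ⟨_, hτ'.mul hT hc h (ceilDiv_add_le Δ _ _)⟩

end Iterate

/-! ### Descent of a split trace -/

/-- A nonempty open set of `Y` has nonzero functions, hence a nonempty preimage; so the image of the
generic point is dense. -/
lemma map_genericPoint_of_isIso {g : X.toScheme ⟶ Y.toScheme}
    (hgO : ∀ U : Y.toScheme.Opens, IsIso (g.app U)) :
    g (genericPoint X.toScheme) = genericPoint Y.toScheme := by
  refine IsGenericPoint.eq (S := ⊤) (dense_iff_inter_open.mpr fun U hU hUn => ?_).closure_eq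
    (genericPoint_spec Y.toScheme)
  let V : Y.toScheme.Opens := ⟨U, hU⟩
  have hVn : Nonempty V := hUn.to_subtype
  refine ⟨_, ?_, rfl⟩
  have : Nonempty (g ⁻¹ᵁ V) := by
    by_contra hne
    have hbot : g ⁻¹ᵁ V = ⊥ := by
      ext x
      exact ⟨fun hx => hne ⟨⟨x, hx⟩⟩, fun hx => hx.elim⟩
    have h1 : (0 : Γ(X.toScheme, g ⁻¹ᵁ V)) = 1 := by
      rw [hbot]
      exact Subsingleton.elim _ _
    have := hgO V
    have h2 := congrArg (inv (g.app V)) h1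
    rw [map_zero, map_one] at h2
    exact zero_ne_one h2
  exact genericPoint_mem (g ⁻¹ᵁ V)

section Descent

variable [X.IsNormal] [Y.IsNormal] {g : X.toScheme ⟶ Y.toScheme} {h : Y.toScheme ⟶ Z.toScheme}
  {hf : (g ≫ h) (genericPoint X.toScheme) = genericPoint Z.toScheme}
  (hg : g (genericPoint X.toScheme) = genericPoint Y.toScheme)
  (hh : h (genericPoint Y.toScheme) = genericPoint Z.toScheme)
  {T : AddMonoid.End Z.K} {q : ℕ} {D : X.WeilDivisor} {τ : AddMonoid.End X.K}

/-- The value of `τ` is regular in codimension one, hence regular on `g ⁻¹ᵁ W`, and all functions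
there come from `W` because `g_* 𝒪_X = 𝒪_Y`. -/
lemma IsSplitTrace.exists_fsharp_eq (hq : q ≠ 0) (hgO : ∀ U : Y.toScheme.Opens, IsIso (g.app U))
    (hD : 0 ≤ D) (hτ : IsSplitTrace q (g ≫ h) hf D T τ) {U : Z.toScheme.Opens} [Nonempty U]
    (hU : IsAffineOpen U) {v : Z.K} (hv : IsTraceOn q (scaleEnd T v) (secRing U))
    {W : Y.toScheme.Opens} [Nonempty W] (hWU : W ≤ h ⁻¹ᵁ U) {c : Y.K} (hc : c ∈ secRing W) :
    ∃ c' ∈ secRing W, τ (g.fsharp hg (h.fsharp hh v * c)) = g.fsharp hg c' := by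
  have : Nonempty (g ⁻¹ᵁ W) := nonempty_preimage hg W
  have h1 : τ (g.fsharp hg (h.fsharp hh v * c)) ∈ secRing (g ⁻¹ᵁ W) := by
    refine mem_secRing_of_codim_one fun x hx hx1 => ?_
    rw [map_mul (g.fsharp hg), ← fsharp_comp hg hh hf]
    refine hτ.mem ⟨x, hx1⟩ v (hv.locRing hq hU (hWU hx)) _ (memDivAt_of_mem_locRing hD ?_)
    exact fsharp_mem_locRing hg (secRing_le_locRing (x := g x) hx hc)
  obtain ⟨s, hs⟩ := h1
  have := hgO W
  refine ⟨_, ⟨inv (g.app W) s, rfl⟩, ?_⟩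
  rw [← hs, fsharp_germ hg]
  congr 1
  simp

/-- The restriction of a split trace to the function field of an intermediate variety. -/
lemma IsSplitTrace.exists_descent (hq : q ≠ 0) (hgO : ∀ U : Y.toScheme.Opens, IsIso (g.app U))
    (hD : 0 ≤ D) (hτ : IsSplitTrace q (g ≫ h) hf D T τ) (hc : Z.HasTraceCharts q T) :
    ∃ σ, (∀ n, τ (g.fsharp hg n) = g.fsharp hg (σ n)) ∧ IsSplitTrace q h hh 0 T σ := by
  have hinj := (g.fsharp hg).injective
  have hex : ∀ n, ∃ m, τ (g.fsharp hg n) = g.fsharp hg m := fun n => by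
    obtain ⟨U, hUn, hU, hz, v, hv⟩ := hc (genericPoint Z.toScheme)
    have hv0 : h.fsharp hh v ≠ 0 := by simpa using hv.scale_ne_zero
    have : Nonempty (h ⁻¹ᵁ U) := nonempty_preimage hh U
    -- Any rational function, divided by the pullback of `v`, becomes regular on a small enough open
    -- set `W`.
    obtain ⟨W, hWn, -, -, hWU, hW⟩ := exists_mem_secRing (x := genericPoint Y.toScheme)
      (c := n / h.fsharp hh v) (mem_locRing_genericPoint _) (h ⁻¹ᵁ U) (genericPoint_mem _)
    obtain ⟨c, -, hc⟩ := hτ.exists_fsharp_eq hg hh hq hgO hD hU hv hWU hW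
    exact ⟨c, by rwa [mul_div_cancel₀ _ hv0] at hc⟩
  choose σ hσ using hex
  refine ⟨{ toFun := σ, map_zero' := hinj ?_, map_add' := fun x y => hinj ?_ }, hσ,
    fun r x => hinj ?_, fun m => hinj ?_, fun y v hv φ hφ => ?_⟩
  · rw [← hσ, map_zero, map_zero]
  · rw [← hσ, map_add, map_add, map_add, hσ, hσ]
  · change g.fsharp hg (σ _) = g.fsharp hg (r * σ x)
    rw [← hσ, map_mul (g.fsharp hg), map_pow (g.fsharp hg), hτ.rootLinear,
      map_mul (g.fsharp hg), hσ]
  · change g.fsharp hg (σ _) = _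
    rw [← hσ, ← fsharp_comp hg hh hf, hτ.map_fsharp, fsharp_comp hg hh hf]
  · rw [memDivAt_zero_iff] at hφ
    obtain ⟨U, hUn, w, u, hU, hz, hw, hu, -, rfl⟩ := hc.exists_chart hq hv
    obtain ⟨W, hWn, -, hyW, hWU, hW⟩ := exists_mem_secRing
      (mul_mem (fsharp_mem_locRing hh hu) hφ) (h ⁻¹ᵁ U) hz
    obtain ⟨c, hcW, hc⟩ := hτ.exists_fsharp_eq hg hh hq hgO hD hU hw hWU hW
    have h1 : h.fsharp hh (w * u) * φ = h.fsharp hh w * (h.fsharp hh u * φ) := by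
      rw [map_mul (h.fsharp hh), mul_assoc]
    change σ _ ∈ _
    rw [h1, hinj ((hσ _).symm.trans hc)]
    exact secRing_le_locRing hyW hcW

end Descent

/-! ### Composition of split traces -/

section Composition

variable [X.IsNormal] [Y.IsNormal] {g : X.toScheme ⟶ Y.toScheme} {h : Y.toScheme ⟶ Z.toScheme}
  {hf : (g ≫ h) (genericPoint X.toScheme) = genericPoint Z.toScheme}
  {hg : g (genericPoint X.toScheme) = genericPoint Y.toScheme}
  {hh : h (genericPoint Y.toScheme) = genericPoint Z.toScheme}
  {S : AddMonoid.End Y.K} {T : AddMonoid.End Z.K} {q : ℕ} {D : X.WeilDivisor}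
  {τ : AddMonoid.End X.K}

/-- The map of `h`, written as a multiple `t` of the generator `S`, supplies the factor by which the
map of `g` has to be rescaled in order to become compatible with `T`. -/
lemma IsSplitTrace.comp (hq : q ≠ 0) (hS : Y.HasTraceCharts q S) (hT : Z.HasTraceCharts q T)
    (hτ : IsSplitTrace q g hg D S τ) {t : Y.K} (hσ : IsSplitTrace q h hh 0 T (scaleEnd S t)) :
    IsSplitTrace q (g ≫ h) hf D T (scaleEnd τ (g.fsharp hg t)) := by
  refine ⟨hτ.rootLinear.scaleEnd _, fun m => ?_, fun x v hv φ hφ => ?_⟩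
  · rw [scaleEnd_apply, fsharp_comp hg hh hf, ← map_mul (g.fsharp hg), hτ.map_fsharp,
      ← scaleEnd_apply S, hσ.map_fsharp, fsharp_comp hg hh hf]
  · obtain ⟨U, hUn, w, u, hU, hz, hw, hu, -, rfl⟩ := hT.exists_chart hq hv
    obtain ⟨V, hVn, hV, hy, v, hv'⟩ := hS (g x.1)
    have hv0 := hv'.scale_ne_zero
    -- Relative to the generators on `Y` and `Z`, the factor `t` is regular: at codimension one
    -- points this is the integrality condition for `h`, and normality of `Y` extends it to `g x`,
    -- which may have higher codimension.
    have key : v⁻¹ * (t * h.fsharp hh w) ∈ locRing (g x.1) := by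
      refine mem_locRing_of_codim_one (U := V ⊓ h ⁻¹ᵁ U) (fun y hyU hy1 => ?_) ⟨hy, hz⟩
      obtain ⟨c, hc, hc'⟩ := (hv'.locRing hq hV hyU.1).exists_eq_mul (z := t * h.fsharp hh w)
        fun r hr => by
          rw [mul_assoc]
          exact hσ.mem ⟨y, hy1⟩ w (hw.locRing hq hU hyU.2) r ((memDivAt_zero_iff _).mpr hr)
      rwa [hc', inv_mul_cancel_left₀ hv0]
    have h1 : g.fsharp hg t * ((g ≫ h).fsharp hf (w * u) * φ) = g.fsharp hg v *
        (g.fsharp hg (v⁻¹ * (t * h.fsharp hh w) * h.fsharp hh u) * φ) := by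
      rw [fsharp_comp hg hh hf, map_mul (h.fsharp hh), ← mul_assoc, ← mul_assoc,
        ← map_mul (g.fsharp hg), ← map_mul (g.fsharp hg)]
      congr 2
      field_simp
    rw [scaleEnd_apply, h1]
    refine hτ.mem x v (hv'.locRing hq hV hy) _ (hφ.mul (fsharp_mem_locRing hg (mul_mem key ?_)))
    exact fsharp_mem_locRing hh hu

end Composition

end Variety

/-! ### Algebraic elements and compatible root-linear maps -/

/-- An algebraic element over a field with a compatible root-linear map is separable, in the sense
that its inverse is a combination of `q`-th powers. -/
lemma exists_inv_eq_sum_pow {M N : Type*} [Field M] [Field N] [Algebra M N] {q : ℕ}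
    {σ : AddMonoid.End N} {T : AddMonoid.End M} (hσ : RootLinear q σ)
    (hσT : ∀ m, σ (algebraMap M N m) = algebraMap M N (T m))
    (hT : ∀ m, (∀ x, T (m * x) = 0) → m = 0) {u : N} (hu : IsIntegral M u) :
    ∃ (n : ℕ) (m : Fin n → M) (c : Fin n → N), u⁻¹ = ∑ i, c i ^ q * algebraMap M N (m i) := by
  -- Applying `σ` to multiples of a relation among the `u ^ (i * q)` gives relations among the `u ^
  -- i` with coefficients `T (g i * x)`. These vanish for all `x`, so the `g i` vanish by
  -- nondegeneracy of `T`. By counting, the `u ^ (i * q)` form a basis of the simple extension,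
  -- which contains `u⁻¹`.
  have hind : LinearIndependent M fun i : Fin (minpoly M u).natDegree =>
      IntermediateField.AdjoinSimple.gen M u ^ ((i : ℕ) * q) := by
    rw [Fintype.linearIndependent_iff]
    intro g hg
    have h1 : ∑ i : Fin (minpoly M u).natDegree, algebraMap M N (g i) * (u ^ (i : ℕ)) ^ q = 0 := by
      have := congrArg (algebraMap (IntermediateField.adjoin M {u}) N) hg
      rw [map_sum, map_zero] at this
      rw [← this]
      refine Finset.sum_congr rfl fun i _ => ?_
      rw [Algebra.smul_def, map_mul, map_pow, IntermediateField.AdjoinSimple.algebraMap_gen, pow_mul]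
      rfl
    intro i
    refine hT _ fun x => ?_
    have h2 : ∑ i : Fin (minpoly M u).natDegree, T (g i * x) • u ^ (i : ℕ) = 0 := by
      have h3 := congrArg (fun y => σ (algebraMap M N x * y)) h1
      beta_reduce at h3
      rw [mul_zero, map_zero, Finset.mul_sum, map_sum] at h3
      rw [← h3]
      refine Finset.sum_congr rfl fun i _ => ?_
      have h4 : algebraMap M N x * (algebraMap M N (g i) * (u ^ (i : ℕ)) ^ q) =
          (u ^ (i : ℕ)) ^ q * algebraMap M N (g i * x) := by
        rw [map_mul]; ring
      rw [h4, hσ, hσT, Algebra.smul_def, mul_comm]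
    exact (Fintype.linearIndependent_iff.mp (linearIndependent_pow u)) _ h2 i
  have := IntermediateField.adjoin.finiteDimensional hu
  have hspan := hind.span_eq_top_of_card_eq_finrank'
    (by rw [Fintype.card_fin, IntermediateField.adjoin.finrank hu])
  have hmem : (IntermediateField.AdjoinSimple.gen M u)⁻¹ ∈ Submodule.span M (Set.range
      fun i : Fin (minpoly M u).natDegree =>
        IntermediateField.AdjoinSimple.gen M u ^ ((i : ℕ) * q)) := hspan ▸ trivial
  obtain ⟨m, hm⟩ := (Submodule.mem_span_range_iff_exists_fun M).mp hmem
  refine ⟨_, m, fun i => u ^ (i : ℕ), ?_⟩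
  have := congrArg (algebraMap (IntermediateField.adjoin M {u}) N) hm
  rw [map_inv₀, IntermediateField.AdjoinSimple.algebraMap_gen, map_sum] at this
  rw [← this]
  refine Finset.sum_congr rfl fun i _ => ?_
  rw [Algebra.smul_def, map_mul, map_pow, IntermediateField.AdjoinSimple.algebraMap_gen, pow_mul,
    mul_comm]
  rfl

/-! ### Splittings given by generators when the canonical classes agree. -/

namespace Variety

variable {k : Type u} [Field k] {X Y Z : Variety k} {p : ℕ} [hp : Fact p.Prime]

/-- A rational function without poles is integral over the base of a proper morphism. -/
lemma isIntegralElem_fsharp {h : Y.toScheme ⟶ Z.toScheme} [UniversallyClosed h]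
    (hh : h (genericPoint Y.toScheme) = genericPoint Z.toScheme) {u : Y.K}
    (hu : ∀ y, u ∈ locRing y) : (h.fsharp hh).IsIntegralElem u := by
  obtain ⟨U, hUn, hU, hz, -⟩ := exists_affine_mem (x := genericPoint Z.toScheme) (W := ⊤) trivial
  have : IsAffine U := hU
  -- Over an affine open set of `Z`, the global functions of a universally closed scheme are
  -- integral over those of the base.
  have hint : (h.appLE (U.ι ''ᵁ ⊤) ((h ⁻¹ᵁ U).ι ''ᵁ ⊤)
      (image_morphismRestrict_preimage h U ⊤).le).hom.IsIntegral := by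
    have := isIntegral_appTop_of_universallyClosed (h ∣_ U)
    rwa [Hom.appTop, morphismRestrict_app'] at this
  have hV : Nonempty (h ⁻¹ᵁ U) := nonempty_preimage hh U
  have hU' : Nonempty (U.ι ''ᵁ ⊤ : Z.toScheme.Opens) := by simpa using hUn
  have hV' : Nonempty ((h ⁻¹ᵁ U).ι ''ᵁ ⊤ : Y.toScheme.Opens) := by simpa using hV
  obtain ⟨s, rfl⟩ : u ∈ secRing ((h ⁻¹ᵁ U).ι ''ᵁ ⊤ : Y.toScheme.Opens) :=
    mem_secRing_of_forall fun y _ => hu y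
  obtain ⟨P, hP, hPs⟩ := hint s
  refine ⟨P.map (Z.toScheme.germToFunctionField (U.ι ''ᵁ ⊤)).hom, hP.map _, ?_⟩
  rw [Polynomial.eval₂_map]
  have h1 := congrArg (Y.toScheme.germToFunctionField ((h ⁻¹ᵁ U).ι ''ᵁ ⊤)).hom hPs
  rw [Polynomial.hom_eval₂, map_zero] at h1
  rw [← h1]
  congr 1
  ext c
  have : Nonempty (h ⁻¹ᵁ (U.ι ''ᵁ ⊤)) := nonempty_preimage hh _
  exact (fsharp_germ hh c).trans (germToFunctionField_appLE h _ c).symm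

variable [CharP k p] [Y.IsNormal] {h : Y.toScheme ⟶ Z.toScheme}
  {hh : h (genericPoint Y.toScheme) = genericPoint Z.toScheme}
  {S : AddMonoid.End Y.K} {T : AddMonoid.End Z.K} {e : ℕ} {t : Y.K}

/-- The frame sum `F` of `σ` is evaluated at `u⁻¹` in two ways. It fixes `u⁻¹`, a combination of `p
^ e`-th powers over the base field; and its terms are regular, because `hr` says that the pole of
`u⁻¹` is absorbed by the zero of `t` relative to the generators. -/
lemma IsSplitTrace.inv_mem_locRing
    (hσ : IsSplitTrace (p ^ e) h hh 0 T (scaleEnd S t)) {u : Y.K}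
    (hu : (h.fsharp hh).IsIntegralElem u) {y : Y.toScheme} {v : Y.K} {w : Z.K}
    (hv : IsTraceOn (p ^ e) (scaleEnd S v) (locRing y))
    (hw : IsTraceOn (p ^ e) (scaleEnd T w) (locRing (h y)))
    (hr : v⁻¹ * (t * h.fsharp hh w) * u⁻¹ ∈ locRing y) : u⁻¹ ∈ locRing y := by
  obtain ⟨ι, _, b, b', hb, hb', hd⟩ := hw.exists_frame
  have hw0 := hw.scale_ne_zero
  have hv0 := hv.scale_ne_zero
  let := (h.fsharp hh).toAlgebra
  obtain ⟨n, m, c, hmc⟩ := exists_inv_eq_sum_pow hσ.rootLinear hσ.map_fsharp (fun m hm => by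
    have : m * w⁻¹ = 0 := hw.eq_of_forall fun y => by
      rw [zero_mul, map_zero, scaleEnd_apply]
      convert hm y using 2
      field_simp
    simpa [hw0] using this) hu
  let F : Y.K →+ Y.K := ⟨⟨frameSum (p ^ e) (h.fsharp hh) (scaleEnd S t) w b b', frameSum_zero p e⟩,
    frameSum_add p e⟩
  -- `F` is linear over `p ^ e`-th powers and over the function field of `Z`, and sends `1` to `1`.
  have hF : F u⁻¹ = u⁻¹ := by
    rw [hmc, map_sum]
    refine Finset.sum_congr rfl fun i _ => ?_
    change frameSum (p ^ e) (h.fsharp hh) (scaleEnd S t) w b b' _ = _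
    rw [frameSum_pow_mul hσ.rootLinear, ← mul_one (algebraMap Z.K Y.K (m i))]
    refine congrArg _ ((frameSum_map_mul hσ.rootLinear hd (m i) 1).trans ?_)
    rw [frameSum_one hσ.map_fsharp hd]
    rfl
  rw [← hF]
  refine sum_mem fun i _ => mul_mem (pow_mem ?_ _) (fsharp_mem_locRing hh (hb i))
  have h1 : t * (h.fsharp hh (w * b' i) * u⁻¹) =
      v * (h.fsharp hh (b' i) * (v⁻¹ * (t * h.fsharp hh w) * u⁻¹)) := by
    rw [map_mul (h.fsharp hh)]
    field_simp
  rw [scaleEnd_apply, h1]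
  exact hv.map_mem _ (mul_mem (fsharp_mem_locRing hh (hb' i)) hr)

lemma IsSplitTrace.mul_mem_locRing {q : ℕ} (hσ : IsSplitTrace q h hh 0 T (scaleEnd S t))
    {y : Y.PrimeDivisor} {v : Y.K} {w : Z.K} (hv : IsTraceOn q (scaleEnd S v) (locRing y.1))
    (hw : IsTraceOn q (scaleEnd T w) (locRing (h y.1))) :
    v⁻¹ * (t * h.fsharp hh w) ∈ locRing y.1 := by
  obtain ⟨c, hc, hc'⟩ := hv.exists_eq_mul (z := t * h.fsharp hh w) fun r hr => by
    rw [mul_assoc]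
    exact hσ.mem y w hw r ((memDivAt_zero_iff _).mpr hr)
  rwa [hc', inv_mul_cancel_left₀ hv.scale_ne_zero]

/-- If the comparison of the traces on `Y` and `Z` is given by a rational function, then a splitting
of `h` is given by a generator of the dual of the rings of sections. -/
lemma IsSplitTrace.inv_mul_mem_locRing [UniversallyClosed h] (hS : Y.HasTraceCharts (p ^ e) S)
    (hT : Z.HasTraceCharts (p ^ e) T) (hσ : IsSplitTrace (p ^ e) h hh 0 T (scaleEnd S t))
    (ht : t ≠ 0) {ρ : Y.K} (hρ : ρ ≠ 0)
    (hρv : ∀ (y : Y.PrimeDivisor) (v : Y.K) (w : Z.K),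
      IsTraceOn (p ^ e) (scaleEnd S v) (locRing y.1) →
      IsTraceOn (p ^ e) (scaleEnd T w) (locRing (h y.1)) →
      Y.toScheme.ord (v⁻¹ * h.fsharp hh w) y.1 = Y.toScheme.ord ρ y.1)
    {y : Y.toScheme} {v : Y.K} {w : Z.K} (hv : IsTraceOn (p ^ e) (scaleEnd S v) (locRing y))
    (hw : IsTraceOn (p ^ e) (scaleEnd T w) (locRing (h y))) :
    (v⁻¹ * (t * h.fsharp hh w))⁻¹ ∈ locRing y := by
  have hq : p ^ e ≠ 0 := pow_ne_zero _ hp.out.ne_zero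
  -- At each prime divisor, `t * ρ` is a local equation of the effective divisor that `t` defines
  -- relative to the generators.
  have hunit : ∀ (y : Y.PrimeDivisor) (v : Y.K) (w : Z.K),
      IsTraceOn (p ^ e) (scaleEnd S v) (locRing y.1) →
      IsTraceOn (p ^ e) (scaleEnd T w) (locRing (h y.1)) →
      v⁻¹ * (t * h.fsharp hh w) * (t * ρ)⁻¹ ∈ locRing y.1 ∧
      (t * ρ) * (v⁻¹ * (t * h.fsharp hh w))⁻¹ ∈ locRing y.1 := by
    intro y v w hv hw
    have hw0 : h.fsharp hh w ≠ 0 := by simpa using hw.scale_ne_zero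
    have hv0 := hv.scale_ne_zero
    have h0 : v⁻¹ * h.fsharp hh w * ρ⁻¹ ≠ 0 := by positivity
    have hord : Y.toScheme.ord (v⁻¹ * h.fsharp hh w * ρ⁻¹) y.1 = 0 := by
      rw [ord_mul (mul_ne_zero (inv_ne_zero hv0) hw0) (inv_ne_zero hρ), hρv y v w hv hw, ord_inv hρ,
        add_neg_cancel]
    have h1 : v⁻¹ * (t * h.fsharp hh w) * (t * ρ)⁻¹ = v⁻¹ * h.fsharp hh w * ρ⁻¹ := by
      field_simp
    have h2 : (t * ρ) * (v⁻¹ * (t * h.fsharp hh w))⁻¹ = (v⁻¹ * h.fsharp hh w * ρ⁻¹)⁻¹ := by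
      field_simp
    rw [h1, h2, ← ord_nonneg_iff y.2 h0, ← ord_nonneg_iff y.2 (inv_ne_zero h0), ord_inv h0, hord]
    simp
  have hex : ∀ y : Y.toScheme, ∃ v w, IsTraceOn (p ^ e) (scaleEnd S v) (locRing y) ∧
      IsTraceOn (p ^ e) (scaleEnd T w) (locRing (h y)) := fun y => by
    obtain ⟨U, hUn, hU, hy, v, hv⟩ := hS y
    obtain ⟨V, hVn, hV, hz, w, hw⟩ := hT (h y)
    exact ⟨v, w, hv.locRing hq hU hy, hw.locRing hq hV hz⟩
  have hne : ∀ {v : Y.K} {w : Z.K} {y : Y.toScheme}, IsTraceOn (p ^ e) (scaleEnd S v) (locRing y) →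
      IsTraceOn (p ^ e) (scaleEnd T w) (locRing (h y)) → v⁻¹ * (t * h.fsharp hh w) ≠ 0 :=
    fun hv hw => mul_ne_zero (inv_ne_zero hv.scale_ne_zero)
      (mul_ne_zero ht (by simpa using hw.scale_ne_zero))
  have hmem : ∀ y : Y.PrimeDivisor, t * ρ ∈ locRing y.1 := fun y => by
    obtain ⟨v, w, hv, hw⟩ := hex y.1
    have := mul_mem (hunit y v w hv hw).2 (hσ.mul_mem_locRing hv hw)
    rwa [inv_mul_cancel_right₀ (hne hv hw)] at this
  -- Being regular at all prime divisors, `t * ρ` is a global function on the normal variety `Y`,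
  -- hence integral over the function field of `Z` by properness of `h`.
  have hint : (h.fsharp hh).IsIntegralElem (t * ρ) := isIntegralElem_fsharp hh fun y =>
    mem_locRing_of_codim_one (U := ⊤) (fun y _ hy => hmem ⟨y, hy⟩) trivial
  have hinv : ∀ (y : Y.PrimeDivisor) (v : Y.K) (w : Z.K),
      IsTraceOn (p ^ e) (scaleEnd S v) (locRing y.1) →
      IsTraceOn (p ^ e) (scaleEnd T w) (locRing (h y.1)) →
      (v⁻¹ * (t * h.fsharp hh w))⁻¹ ∈ locRing y.1 := fun y v w hv hw => by
    have := mul_mem (hσ.inv_mem_locRing hint hv hw (hunit y v w hv hw).1) (hunit y v w hv hw).2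
    rwa [inv_mul_cancel_left₀ (mul_ne_zero ht hρ)] at this
  obtain ⟨U, hUn, v', a, hU, hy, hv', ha, -, rfl⟩ := hS.exists_chart hq hv
  obtain ⟨V, hVn, w', b, hV, hz, hw', -, hb, rfl⟩ := hT.exists_chart hq hw
  -- Regularity of the inverse passes from codimension one to all points. Chart generators are used
  -- since they serve on a whole neighbourhood; the prescribed ones differ from them by units.
  have key : (v'⁻¹ * (t * h.fsharp hh w'))⁻¹ ∈ locRing y :=
    mem_locRing_of_codim_one (U := U ⊓ h ⁻¹ᵁ V) (fun y' hy' hy1 => hinv ⟨y', hy1⟩ v' w'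
      (hv'.locRing hq hU hy'.1) (hw'.locRing hq hV hy'.2)) ⟨hy, hz⟩
  have : ((v' * a)⁻¹ * (t * h.fsharp hh (w' * b)))⁻¹ =
      a * h.fsharp hh b⁻¹ * (v'⁻¹ * (t * h.fsharp hh w'))⁻¹ := by
    rw [map_mul (h.fsharp hh), map_inv₀ (h.fsharp hh)]
    simp only [mul_inv, inv_inv]
    ring
  rw [this]
  exact mul_mem (mul_mem ha (fsharp_mem_locRing hh hb)) key

/-! ### Division of split traces. -/

section Quotient

variable [X.IsNormal] {g : X.toScheme ⟶ Y.toScheme}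
  {hf : (g ≫ h) (genericPoint X.toScheme) = genericPoint Z.toScheme}
  {hg : g (genericPoint X.toScheme) = genericPoint Y.toScheme} {D : X.WeilDivisor}
  {τ : AddMonoid.End X.K}

/-- Division of a split trace of a composition by a split trace that generates. -/
lemma IsSplitTrace.of_comp (hτ : IsSplitTrace (p ^ e) (g ≫ h) hf D T τ) (ht : t ≠ 0)
    (hT : Z.HasTraceCharts (p ^ e) T)
    (hτσ : ∀ n, τ (g.fsharp hg n) = g.fsharp hg (scaleEnd S t n))
    (hinv : ∀ (y : Y.toScheme) (v : Y.K) (w : Z.K), IsTraceOn (p ^ e) (scaleEnd S v) (locRing y) →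
      IsTraceOn (p ^ e) (scaleEnd T w) (locRing (h y)) →
      (v⁻¹ * (t * h.fsharp hh w))⁻¹ ∈ locRing y) :
    IsSplitTrace (p ^ e) g hg D S (scaleEnd τ (g.fsharp hg t⁻¹)) := by
  have hq : p ^ e ≠ 0 := pow_ne_zero _ hp.out.ne_zero
  refine ⟨hτ.rootLinear.scaleEnd _, fun m => ?_, fun x v hv φ hφ => ?_⟩
  · rw [scaleEnd_apply, ← map_mul (g.fsharp hg), hτσ, scaleEnd_apply, mul_inv_cancel_left₀ ht]
  · obtain ⟨V, hVn, hV, hz, w, hw⟩ := hT (h (g x.1))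
    have hw' := hw.locRing hq hV hz
    have hw0 : h.fsharp hh w ≠ 0 := by simpa using hw.scale_ne_zero
    -- The generator on `Y` divided by `t` is the pullback of the generator on `Z` times a regular
    -- factor, so the integrality condition for the composition applies.
    have h1 : g.fsharp hg t⁻¹ * (g.fsharp hg v * φ) = (g ≫ h).fsharp hf w *
        (g.fsharp hg (v⁻¹ * (t * h.fsharp hh w))⁻¹ * φ) := by
      rw [fsharp_comp hg hh hf, ← mul_assoc, ← mul_assoc, ← map_mul (g.fsharp hg),
        ← map_mul (g.fsharp hg)]
      congr 2
      have := hv.scale_ne_zero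
      field_simp
    rw [scaleEnd_apply, h1]
    exact hτ.mem x w hw' _ (hφ.mul (fsharp_mem_locRing hg (hinv _ v w hv hw')))

end Quotient

end Variety

/-! ### Canonical divisors and traces -/

lemma AlgebraicGeometry.Scheme.algebraMap_genericPoint {X : Scheme.{u}} [IsIntegral X]
    (c : X.presheaf.stalk (genericPoint X)) :
    (stalkFunctionFieldAlgebra X (genericPoint X)).algebraMap c = c := by
  obtain ⟨U, hU, s, rfl⟩ := X.presheaf.exists_germ_eq c
  have : Nonempty U := ⟨⟨_, hU⟩⟩
  exact algebraMap_germ_eq_germToFunctionField X hU s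

namespace Variety

variable {k : Type u} [Field k] {X Y Z : Variety k} {p : ℕ} [hp : Fact p.Prime]

lemma exists_eq_smul_ratForm {a : Fin X.dim → X.K} (ha : IsCoordBasis k a) (ω : X.RatForm) :
    ∃ c : X.K, ω = c • X.ratForm a := by
  obtain ⟨B, hB⟩ := ha
  suffices h : (⊤ : Submodule X.K X.RatForm) ≤ Submodule.span X.K {X.ratForm a} by
    obtain ⟨c, hc⟩ := Submodule.mem_span_singleton.mp (h (Submodule.mem_top (x := ω)))
    exact ⟨c, hc.symm⟩
  rw [← exteriorPower.ιMulti_span, Submodule.span_le]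
  rintro _ ⟨v, rfl⟩
  rw [B.ιMulti_eq_det_smul, ratForm]
  simp_rw [← hB]
  exact Submodule.smul_mem _ _ (Submodule.mem_span_singleton_self _)

lemma ord_unit [X.IsNormal] {x : X.PrimeDivisor} {u : X.K} (hu : u ∈ locRing x.1)
    (hu' : u⁻¹ ∈ locRing x.1) (h0 : u ≠ 0) : X.toScheme.ord u x.1 = 0 := by
  have h1 := (ord_nonneg_iff x.2 h0).mpr hu
  have h2 := (ord_nonneg_iff x.2 (inv_ne_zero h0)).mpr hu'
  rw [ord_inv h0] at h2
  omega

variable [CharP k p]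

/-- The trace at a point with given coordinates, in terms of the trace of a chart. -/
lemma IsChart.exists_trace_of_isCoordinates (hk : ∀ a : k, ∃ c, c ^ p = a) (hX : Smooth X.str)
    {U : X.toScheme.Opens} [Nonempty U] {b : Fin X.dim → Γ(X.toScheme, U)} (hb : IsChart p X U b)
    {x : X.toScheme} {a : Fin X.dim → X.toScheme.presheaf.stalk x} (ha : X.IsCoordinates x a) :
    ∃ J : X.K, J ≠ 0 ∧ X.coordForm x a = J • X.ratForm (ratCoord b) ∧ ∀ e,
      IsTraceOn (p ^ e) (scaleEnd (hb.isPBasis.trace ^ e) (J / J ^ p ^ e)) (locRing x) := by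
  obtain ⟨V, hVn, c, hx, hc⟩ := exists_isChart hk hX x
  obtain ⟨J, hJ, hJc, -⟩ := hb.exists_trace_eq hk hc
  obtain ⟨u, hu, hu', hu0, h⟩ := ha.exists_unit (hc.isCoordinates x hx)
  rw [coordForm_germ_eq] at h
  refine ⟨u * J, mul_ne_zero hu0 hJ, by rw [h, hJc, mul_smul], fun e => ?_⟩
  -- The Jacobian `u` between the given coordinates and those of a chart is a unit at `x`, so the
  -- power `u ^ (1 - p ^ e)` preserves the generator.
  have h1 := ((hb.isTraceOn_pow hk hc hJc e).locRing (pow_ne_zero _ hp.out.ne_zero)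
    hc.isAffineOpen hx).scale_unit (u := u / u ^ p ^ e)
    (by rw [div_eq_mul_inv, ← inv_pow]; exact mul_mem hu (pow_mem hu' _))
    (by rw [inv_div, div_eq_mul_inv]; exact mul_mem (pow_mem hu _) hu')
    (div_ne_zero hu0 (pow_ne_zero _ hu0))
  convert h1 using 1
  ext x
  simp only [scaleEnd_apply]
  congr 1
  rw [mul_pow]
  field_simp

variable [Y.IsNormal] {h : Y.toScheme ⟶ Z.toScheme}

/-- The comparison of the traces on `Y` and `Z` is given by a rational function when the canonical
divisors are equivalent. -/
lemma CanonicalZpEquivPullback.exists_ord_eq (hk : ∀ a : k, ∃ c, c ^ p = a) (hY : Smooth Y.str)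
    (hZ : Smooth Z.str) (hcan : CanonicalZpEquivPullback p h)
    (hh : h (genericPoint Y.toScheme) = genericPoint Z.toScheme)
    {U : Y.toScheme.Opens} [Nonempty U] {a : Fin Y.dim → Γ(Y.toScheme, U)} (ha : IsChart p Y U a)
    {V : Z.toScheme.Opens} [Nonempty V] {b : Fin Z.dim → Γ(Z.toScheme, V)} (hb : IsChart p Z V b) :
    ∃ m : ℕ, ¬ p ∣ m ∧ ∀ e, m ∣ p ^ e - 1 → ∃ ρ : Y.K, ρ ≠ 0 ∧
      ∀ (y : Y.PrimeDivisor) (v : Y.K) (w : Z.K),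
        IsTraceOn (p ^ e) (scaleEnd (ha.isPBasis.trace ^ e) v) (locRing y.1) →
        IsTraceOn (p ^ e) (scaleEnd (hb.isPBasis.trace ^ e) w) (locRing (h y.1)) →
        Y.toScheme.ord (v⁻¹ * h.fsharp hh w) y.1 = Y.toScheme.ord ρ y.1 := by
  obtain ⟨D, E, ⟨ω, hω, hD⟩, ⟨ω', hE⟩, m, hm, ψ, hψ, hDE⟩ := hcan
  refine ⟨m, hm, fun e ⟨r, hr⟩ => ?_⟩
  obtain ⟨φ₀, hφ₀⟩ := exists_eq_smul_ratForm ha.isCoordBasis ω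
  obtain ⟨c₀, hc₀⟩ := exists_eq_smul_ratForm hb.isCoordBasis ω'
  have hφ₀0 : φ₀ ≠ 0 := by
    rintro rfl
    exact hω (by rw [hφ₀, zero_smul])
  have hZ' : ∀ y : Y.PrimeDivisor, ∃ (c J : Z.K), c ≠ 0 ∧ J ≠ 0 ∧ c₀ = c * J ∧
      E y = Y.toScheme.ord (h.fsharp hh c) y.1 ∧
      IsTraceOn (p ^ e) (scaleEnd (hb.isPBasis.trace ^ e) (J / J ^ p ^ e)) (locRing (h y.1)) := by
    intro y
    obtain ⟨b', c, hb', hc, hω', hEy⟩ := hE y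
    obtain ⟨J, hJ, hJb, htr⟩ := hb.exists_trace_of_isCoordinates hk hZ hb'
    refine ⟨algebraMap _ Z.K c, J, (hc.map (algebraMap _ Z.K)).ne_zero, hJ, ?_, ?_, htr e⟩
    · apply smul_left_injective _ (ratForm_ne_zero hb.isCoordBasis)
      beta_reduce
      rw [← hc₀, hω', hJb, mul_smul]
    · rw [hEy, fsharp_algebraMap]
      exact congrArg (fun c => Y.toScheme.ord c y.1) (algebraMap_genericPoint _).symm
  -- Without prime divisors any `ρ` will do. Otherwise a prime divisor is needed to see that `ω'` is
  -- nonzero, as the pullback condition is imposed only at prime divisors.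
  rcases isEmpty_or_nonempty Y.PrimeDivisor with hemp | ⟨⟨y₀⟩⟩
  · exact ⟨1, one_ne_zero, fun y => hemp.elim y⟩
  have hc₀0 : c₀ ≠ 0 := by
    obtain ⟨c, J, hc, hJ, h1, -⟩ := hZ' y₀
    exact h1 ▸ mul_ne_zero hc hJ
  have hhne : ∀ {c : Z.K}, c ≠ 0 → h.fsharp hh c ≠ 0 := fun hc => by simpa using hc
  -- With `p ^ e - 1 = m * r`, the first factor has order `(p ^ e - 1) * (D - E)` plus the order of
  -- the Jacobian terms, and `ψ ^ r` cancels the former since `m * (D - E) = div ψ`. The Jacobian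
  -- terms are those of the generators.
  refine ⟨(φ₀ * (h.fsharp hh c₀)⁻¹) ^ (p ^ e - 1) * (ψ ^ r)⁻¹, mul_ne_zero (pow_ne_zero _
    (mul_ne_zero hφ₀0 (inv_ne_zero (hhne hc₀0)))) (inv_ne_zero (pow_ne_zero _ hψ)),
    fun y v w hv hw => ?_⟩
  obtain ⟨c, J, hc, hJ, hcJ, hEy, hJtr⟩ := hZ' y
  obtain ⟨a', φ, ha', hω', hDy⟩ := hD y
  obtain ⟨I, hI, hIa, hItr⟩ := ha.exists_trace_of_isCoordinates hk hY ha'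
  have hφI : φ₀ = φ * I := by
    apply smul_left_injective _ (ratForm_ne_zero ha.isCoordBasis)
    beta_reduce
    rw [← hφ₀, hω', hIa, mul_smul]
  have hφ : φ ≠ 0 := by
    rintro rfl
    exact hφ₀0 (by rw [hφI, zero_mul])
  obtain ⟨u, hu, hu', rfl⟩ := (hItr e).exists_unit hv
  obtain ⟨u₁, hu₁, hu₁', rfl⟩ := hJtr.exists_unit hw
  have hu0 : u ≠ 0 := right_ne_zero_of_mul hv.scale_ne_zero
  have hu₁0 : u₁ ≠ 0 := right_ne_zero_of_mul hw.scale_ne_zero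
  obtain ⟨q, hq⟩ : ∃ q, p ^ e = q + 1 :=
    ⟨p ^ e - 1, by have := pow_pos hp.out.pos e; omega⟩
  have h1 : (I / I ^ p ^ e * u)⁻¹ * h.fsharp hh (J / J ^ p ^ e * u₁) =
      (u⁻¹ * h.fsharp hh u₁) * (I ^ q * ((h.fsharp hh J) ^ q)⁻¹) := by
    rw [map_mul (h.fsharp hh), map_div₀ (h.fsharp hh), map_pow (h.fsharp hh), hq]
    have := hhne hJ
    field_simp
    ring
  have h2 := hDE y
  have hu2 : Y.toScheme.ord u y.1 = 0 := ord_unit hu hu' hu0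
  have hu3 : Y.toScheme.ord (h.fsharp hh u₁) y.1 = 0 := ord_unit (fsharp_mem_locRing hh hu₁)
    (by rw [← map_inv₀]; exact fsharp_mem_locRing hh hu₁') (hhne hu₁0)
  have hJ' := hhne hJ
  have hc' := hhne hc
  have hu₁' := hhne hu₁0
  rw [h1, hφI, hcJ, map_mul (h.fsharp hh), hq, Nat.add_sub_cancel]
  rw [hq, Nat.add_sub_cancel] at hr
  have hr' : (q : ℤ) = m * r := by exact_mod_cast hr
  rw [ord_mul (by positivity) (by positivity), ord_mul (by positivity) (by positivity),
    ord_mul (by positivity) (by positivity), ord_mul (by positivity) (by positivity),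
    ord_inv (by positivity), ord_inv (by positivity), ord_inv (by positivity), ord_pow hI,
    ord_pow hJ', ord_pow (by positivity), ord_pow hψ, ord_mul (by positivity) (by positivity),
    ord_mul hφ hI, ord_inv (by positivity), ord_mul hc' hJ', hu2, hu3, ← hDy, ← hEy, ← h2, hr']
  ring

end Variety

/-! ### `F`-split morphisms and composition -/

namespace Variety

section

variable {k : Type u} [Field k] {X Y Z : Variety k} [X.IsNormal] [Y.IsNormal] {p : ℕ}
  [hp : Fact p.Prime] [CharP k p] (hk : ∀ a : k, ∃ c, c ^ p = a) (hZ : Smooth Z.str)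
  {Δ : X.QWeilDivisor} (hΔ : 0 ≤ Δ) {g : X.toScheme ⟶ Y.toScheme} {h : Y.toScheme ⟶ Z.toScheme}

include hk hZ

lemma IsChart.exists_iterate {U : Z.toScheme.Opens} [Nonempty U] {b : Fin Z.dim → Γ(Z.toScheme, U)}
    (hb : IsChart p Z U b) {f : X.toScheme ⟶ Z.toScheme}
    {hf : f (genericPoint X.toScheme) = genericPoint Z.toScheme} {e : ℕ} {τ : AddMonoid.End X.K}
    (h : IsSplitTrace (p ^ e) f hf (ceilDiv p Δ e) (hb.isPBasis.trace ^ e) τ) {n : ℕ} (hn : 0 < n) :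
    ∃ τ', IsSplitTrace (p ^ (e * n)) f hf (ceilDiv p Δ (e * n)) (hb.isPBasis.trace ^ (e * n)) τ' :=
  h.exists_iterate hb.isPBasis.trace_rootLinear
    (by simpa only [pow_one] using hb.hasTraceCharts hk hZ 1) hn

/-- If a composition with a contraction is `F`-split, then so is the second morphism. -/
theorem IsFSplit.of_comp_right (hgO : ∀ U : Y.toScheme.Opens, IsIso (g.app U))
    (H : IsFSplit p (g ≫ h) Δ hΔ) : IsFSplit p h 0 le_rfl := by
  obtain ⟨U, _, b, -, hb⟩ := exists_isChart (p := p) hk hZ (genericPoint Z.toScheme)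
  rw [hb.isFSplit_iff hk hZ] at H ⊢
  obtain ⟨e, he, hf, τ, hτ⟩ := H
  have hg := map_genericPoint_of_isIso hgO
  have hh : h (genericPoint Y.toScheme) = genericPoint Z.toScheme := by rw [← hg]; exact hf
  obtain ⟨σ, -, hσ⟩ := hτ.exists_descent hg hh (pow_ne_zero _ hp.out.ne_zero) hgO
    (roundUp_nonneg (scaled_nonneg p e hΔ)) (hb.hasTraceCharts hk hZ e)
  exact ⟨e, he, hh, σ, by rwa [ceilDiv_zero]⟩

/-- Compositions of `F`-split morphisms are `F`-split. -/
theorem IsFSplit.comp (hY : Smooth Y.str) (H : IsFSplit p g Δ hΔ) (H' : IsFSplit p h 0 le_rfl) :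
    IsFSplit p (g ≫ h) Δ hΔ := by
  obtain ⟨U, _, b, -, hb⟩ := exists_isChart (p := p) hk hZ (genericPoint Z.toScheme)
  obtain ⟨V, _, a, -, ha⟩ := exists_isChart (p := p) hk hY (genericPoint Y.toScheme)
  rw [hb.isFSplit_iff hk hZ] at H' ⊢
  rw [ha.isFSplit_iff hk hY] at H
  obtain ⟨d, hd, hg, τ, hτ⟩ := H
  obtain ⟨e, he, hh, σ, hσ⟩ := H'
  -- The splittings of `g` and `h` have exponents `d` and `e`; both are iterated to the common
  -- exponent `d * e`.
  obtain ⟨τ', hτ'⟩ := ha.exists_iterate hk hY hτ he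
  obtain ⟨σ', hσ'⟩ := hb.exists_iterate hk hZ hσ hd
  rw [mul_comm e d, ceilDiv_zero] at hσ'
  obtain ⟨t, ht⟩ := (ha.isTraceOn.pow (d * e)).exists_scale hσ'.rootLinear
  obtain rfl : σ' = scaleEnd (ha.isPBasis.trace ^ (d * e)) t := AddMonoidHom.ext ht
  have hf : (g ≫ h) (genericPoint X.toScheme) = genericPoint Z.toScheme :=
    (congrArg h hg).trans hh
  exact ⟨d * e, Nat.mul_pos hd he, hf, _, hτ'.comp (pow_ne_zero _ hp.out.ne_zero)
    (ha.hasTraceCharts hk hY _) (hb.hasTraceCharts hk hZ _) hσ'⟩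

/-- If a composition with a contraction is `F`-split and the canonical divisors are equivalent, then
the first morphism is `F`-split. -/
theorem IsFSplit.of_comp_left [UniversallyClosed h] (hY : Smooth Y.str)
    (hgO : ∀ U : Y.toScheme.Opens, IsIso (g.app U)) (hcan : CanonicalZpEquivPullback p h)
    (H : IsFSplit p (g ≫ h) Δ hΔ) : IsFSplit p g Δ hΔ := by
  obtain ⟨U, _, b, -, hb⟩ := exists_isChart (p := p) hk hZ (genericPoint Z.toScheme)
  obtain ⟨V, _, a, -, ha⟩ := exists_isChart (p := p) hk hY (genericPoint Y.toScheme)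
  rw [hb.isFSplit_iff hk hZ] at H
  rw [ha.isFSplit_iff hk hY]
  obtain ⟨e, he, hf, τ, hτ⟩ := H
  have hg := map_genericPoint_of_isIso hgO
  have hh : h (genericPoint Y.toScheme) = genericPoint Z.toScheme := by rw [← hg]; exact hf
  obtain ⟨m, hm, hcan⟩ := hcan.exists_ord_eq hk hY hZ hh ha hb
  have hm0 : 0 < m := Nat.pos_of_ne_zero fun h0 => hm (h0 ▸ dvd_zero p)
  have hn : 0 < m.totient := Nat.totient_pos.mpr hm0
  obtain ⟨τ', hτ'⟩ := hb.exists_iterate hk hZ hτ hn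
  set d := e * m.totient
  -- Euler's theorem, applicable since `p` does not divide `m`; this explains the choice of `d`.
  have hdvd : m ∣ p ^ d - 1 := by
    have h1 := Nat.ModEq.pow_totient (((hp.out.coprime_iff_not_dvd.mpr hm).pow_left e))
    rw [← pow_mul] at h1
    exact (Nat.modEq_iff_dvd' (Nat.one_le_pow _ _ hp.out.pos)).mp h1.symm
  obtain ⟨ρ, hρ, hρv⟩ := hcan d hdvd
  obtain ⟨σ, hτσ, hσ⟩ := hτ'.exists_descent hg hh (pow_ne_zero _ hp.out.ne_zero) hgO
    (roundUp_nonneg (scaled_nonneg p d hΔ)) (hb.hasTraceCharts hk hZ d)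
  obtain ⟨t, ht⟩ := (ha.isTraceOn.pow d).exists_scale hσ.rootLinear
  obtain rfl : σ = scaleEnd (ha.isPBasis.trace ^ d) t := AddMonoidHom.ext ht
  -- Otherwise `σ` would vanish, and with it the trace of `Z`, to which `σ` restricts.
  have ht0 : t ≠ 0 := by
    rintro rfl
    refine (hb.isTraceOn.pow d).ne_zero (AddMonoidHom.ext fun c => (h.fsharp hh).injective ?_)
    refine (hσ.map_fsharp c).symm.trans ?_
    rw [scaleEnd_apply, zero_mul, map_zero]
    exact (map_zero _).symm
  exact ⟨d, Nat.mul_pos he hn, hg, _, hτ'.of_comp ht0 (hb.hasTraceCharts hk hZ d) hτσ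
    fun y v w hv hw => hσ.inv_mul_mem_locRing (ha.hasTraceCharts hk hY d)
      (hb.hasTraceCharts hk hZ d) ht0 hρ hρv hv hw⟩

end

end Variety

theorem mainTheorem10 {p : ℕ} [Fact p.Prime] {k : Type u} [Field k] [IsAlgClosed k] [CharP k p]
    (X Y Z : Variety k) [X.IsNormal] [Y.IsNormal] (hZ : Smooth Z.str)
    (Δ : X.QWeilDivisor) (hΔ : 0 ≤ Δ)
    (f : X.toScheme ⟶ Z.toScheme) (g : X.toScheme ⟶ Y.toScheme) (h : Y.toScheme ⟶ Z.toScheme)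
    (hfgh : f = g ≫ h) (hg_over : g ≫ Y.str = X.str) (hh_over : h ≫ Z.str = Y.str)
    (hg : IsProper g) (hh : IsProper h)
    (hgO : ∀ U : Y.toScheme.Opens, IsIso (g.app U)) :
    (Variety.IsFSplit p f Δ hΔ → Variety.IsFSplit p h 0 le_rfl) ∧
    (Smooth Y.str → Variety.IsFSplit p g Δ hΔ → Variety.IsFSplit p h 0 le_rfl →
      Variety.IsFSplit p f Δ hΔ) ∧
    (Smooth Y.str → Variety.CanonicalZpEquivPullback p h → Variety.IsFSplit p f Δ hΔ →
      Variety.IsFSplit p g Δ hΔ ∧ Variety.IsFSplit p h 0 le_rfl) := by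
  have hk := IsAlgClosed.exists_pow_prime_eq (k := k) p
  have := hh.toUniversallyClosed
  subst hfgh
  exact ⟨Variety.IsFSplit.of_comp_right hk hZ hΔ hgO,
    fun hY => Variety.IsFSplit.comp hk hZ hΔ hY,
    fun hY hcan H => ⟨Variety.IsFSplit.of_comp_left hk hZ hΔ hY hgO hcan H,
      Variety.IsFSplit.of_comp_right hk hZ hΔ hgO H⟩⟩
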